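/- Let $n\ge 3$ and let $M$ be a smooth (Hausdorff, second countable) $n$-manifold with a conformal structure $c$ of signature $(p,q)$, $p+q=n$. For $g\in c$, with Levi-Civita connection $\nabla^g$, Ricci tensor $\mathrm{Ric}^g$, scalar curvature $\mathrm{scal}^g$ and Schouten tensor $\mathsf P^g=\frac1{n-2}\bigl(\mathrm{Ric}^g-\frac{\mathrm{scal}^g}{2(n-1)}g\bigr)$ (viewed also as an endomorphism of $TM$), the standard tractor bundle of $(M,c)$ is $\mathcal T\cong\mathbb R\oplus TM\oplus\mathbb R$ with metric $h\bigl((\alpha,Y,\beta),(\alpha',Y',\beta')\bigr)=\alpha\beta'+\alpha'\beta+g(Y,Y')$, canonical lightlike line $\mathcal I=\{(\alpha,0,0)\}$ and normal conformal tractor connection $$\nabla^{nc}_X(\alpha,Y,\beta)=\bigl(X(\alpha)-\mathsf P^g(X,Y),\ \nabla^g_XY+\alpha X+\beta\,\mathsf P^g(X),\ X(\beta)-g(X,Y)\bigr).$$ Let $\mathrm{Hol}_x(M,c)$ be the group of $\nabla^{nc}$-parallel transports in $\mathcal T_x$ along piecewise smooth loops at $x$, let $\mathfrak{hol}_x(M,c)$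 be its Lie algebra, and put $$r^{\mathcal E}(x)=\dim\bigl(\mathfrak{hol}_x(M,c)\cap\mathfrak g_1\bigr),\qquad \mathfrak g_1=\{A\in\mathfrak{so}(\mathcal T_x,h_x)\mid A\,\mathcal I_x=0,\ A\,\mathcal I_x^\perp\subset\mathcal I_x\}.$$ Let $G=\mathbf O(p+1,q+1)$, let $L\subset\mathbb R^{p+1,q+1}$ be a lightlike line with stabiliser $P\subset G$, let $\widehat{\mathcal G}\to M$ be the principal $G$-bundle of linear isometries $u:\mathbb R^{p+1,q+1}\to\mathcal T_x$, and let $\mathcal G\subset\widehat{\mathcal G}$ be the principal $P$-bundle of those $u$ with $u(L)=\mathcal I_x$. Let $\rho$ be a smooth representation of $G$ on a finite-dimensional real vector space $V$, and let $\psi$ be a parallel section of $\widehat{\mathcal G}\times_GV$, that is, a $G$-equivariant map $s:\widehat{\mathcal G}\to V$ that is constant along $\nabla^{nc}$-parallel frames. The $P$-type of $x\in M$ is the $P$-orbit $s(\mathcal G_x)\subset V$; a curved orbit is the set of all points of $M$ that have the same $P$-type as some given point. A subset $N\subset M$ is an initial submanifold of dimension $m$ if around each $x\in N$ there is a chart $e:U\to\mathbb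 R^n$ of $M$ with $e(x)=0$ and $e\bigl(C_x(U\cap N)\bigr)=e(U)\cap(\mathbb R^m\times 0)$, where $C_x(A)$ is the set of points that can be joined to $x$ by a smooth curve in $M$ that lies in $A$. **Theorem.** If for every $x\in M$ the group $\mathrm{Hol}_x(M,c)$ equals the stabiliser of $\psi_x$ in $\mathbf O(\mathcal T_x,h_x)$, then for every integer $k\ge 0$ the set $M_k=\{x\in M\mid r^{\mathcal E}(x)=k\}$ is a union of curved orbits, and each of these curved orbits is an initial submanifold of $M$. In particular, $M_k$ is a union of initial submanifolds. -/

import Mathlib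

open Set
open scoped Manifold ContDiff

noncomputable section

namespace ConformalHolonomy

/-! ### Coordinate formulas on an open subset of `ℝⁿ`

`G y` is the matrix `(g_{ij}(y))` of a semi-Riemannian metric in coordinates. -/

section Coordinates

variable {n : ℕ}

/-- The partial derivative `∂_i f`. -/
def pd (i : Fin n) (f : EuclideanSpace ℝ (Fin n) → ℝ) (y : EuclideanSpace ℝ (Fin n)) : ℝ :=
  fderiv ℝ f y (EuclideanSpace.single i 1)

/-- The Christoffel symbols `Γ^k_{ij} = ½ g^{kl} (∂_i g_{jl} + ∂_j g_{il} - ∂_l g_{ij})`. -/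
def christoffel (G : EuclideanSpace ℝ (Fin n) → Matrix (Fin n) (Fin n) ℝ) (k i j : Fin n)
    (y : EuclideanSpace ℝ (Fin n)) : ℝ :=
  (1 / 2 : ℝ) * ∑ l, (G y)⁻¹ k l *
    (pd i (fun z => G z j l) y + pd j (fun z => G z i l) y - pd l (fun z => G z i j) y)

/-- `riemann G l k i j` is the component `R^l_{kij}` of the curvature:
`R(∂_i, ∂_j) ∂_k = R^l_{kij} ∂_l`, where `R(X,Y) = [∇_X, ∇_Y] - ∇_{[X,Y]}`. -/
def riemann (G : EuclideanSpace ℝ (Fin n) → Matrix (Fin n) (Fin n) ℝ) (l k i j : Fin n)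
    (y : EuclideanSpace ℝ (Fin n)) : ℝ :=
  pd i (christoffel G l j k) y - pd j (christoffel G l i k) y
    + ∑ m, (christoffel G l i m y * christoffel G m j k y
        - christoffel G l j m y * christoffel G m i k y)

/-- The Ricci tensor `Ric(X,Y) = tr (Z ↦ R(Z,X)Y)`. -/
def ricci (G : EuclideanSpace ℝ (Fin n) → Matrix (Fin n) (Fin n) ℝ) (j k : Fin n)
    (y : EuclideanSpace ℝ (Fin n)) : ℝ :=
  ∑ i, riemann G i k i j y

/-- The scalar curvature `g^{jk} Ric_{jk}`. -/
def scal (G : EuclideanSpace ℝ (Fin n) → Matrix (Fin n) (Fin n) ℝ)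
    (y : EuclideanSpace ℝ (Fin n)) : ℝ :=
  ∑ j, ∑ k, (G y)⁻¹ j k * ricci G j k y

/-- The Schouten tensor `P = (n-2)⁻¹ (Ric - scal / (2 (n-1)) g)`. -/
def schouten (G : EuclideanSpace ℝ (Fin n) → Matrix (Fin n) (Fin n) ℝ) (i j : Fin n)
    (y : EuclideanSpace ℝ (Fin n)) : ℝ :=
  1 / ((n : ℝ) - 2) * (ricci G i j y - scal G y / (2 * ((n : ℝ) - 1)) * G y i j)

end Coordinates

/-! ### Semi-Riemannian metrics and conformal structures -/

section Metrics

variable {n : ℕ} {M : Type*} [TopologicalSpace M] [ChartedSpace (EuclideanSpace ℝ (Fin n)) M]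

/-- The components `g(∂_i, ∂_j)` of a family of bilinear forms on the tangent spaces, in the chart
around `x₀`, as functions on the image of the chart. -/
def chartComponents [IsManifold (𝓡 n) ∞ M]
    (g : ∀ x : M, TangentSpace (𝓡 n) x →L[ℝ] TangentSpace (𝓡 n) x →L[ℝ] ℝ)
    (x₀ : M) (y : EuclideanSpace ℝ (Fin n)) : Matrix (Fin n) (Fin n) ℝ :=
  Matrix.of fun i j =>
    let x := (extChartAt (𝓡 n) x₀).symm y
    g x (tangentCoordChange (𝓡 n) x₀ x x (EuclideanSpace.single i 1))
      (tangentCoordChange (𝓡 n) x₀ x x (EuclideanSpace.single j 1))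

end Metrics

/-- A smooth semi-Riemannian metric of signature `(p, q)`: every tangent space has a basis in which
the metric is `diag(-1, …, -1, 1, …, 1)` with `p` minus and `q` plus signs. -/
structure SemiRiemannianMetric (n p q : ℕ) (M : Type*) [TopologicalSpace M]
    [ChartedSpace (EuclideanSpace ℝ (Fin n)) M] [IsManifold (𝓡 n) ∞ M] where
  /-- the bilinear form on each tangent space -/
  val : ∀ x : M, TangentSpace (𝓡 n) x →L[ℝ] TangentSpace (𝓡 n) x →L[ℝ] ℝ
  signature : ∀ x, ∃ b : Module.Basis (Fin p ⊕ Fin q) ℝ (TangentSpace (𝓡 n) x),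
    ∀ i j, val x (b i) (b j) =
      Matrix.diagonal (Sum.elim (fun _ : Fin p => (-1 : ℝ)) (fun _ : Fin q => 1)) i j
  smooth : ∀ x₀ : M, ∀ i j, ContDiffOn ℝ ∞ (fun y => chartComponents val x₀ y i j)
    (extChartAt (𝓡 n) x₀).target

section Tractors

variable {n p q : ℕ} {M : Type*} [TopologicalSpace M]
  [ChartedSpace (EuclideanSpace ℝ (Fin n)) M] [IsManifold (𝓡 n) ∞ M]

/-- `ĝ = e^{2f} g` for a smooth function `f`. -/
def SemiRiemannianMetric.ConformallyEquivalent (g g' : SemiRiemannianMetric n p q M) : Prop :=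
  ∃ f : M → ℝ, ContMDiff (𝓡 n) 𝓘(ℝ) ∞ f ∧
    ∀ (x : M) (v w : TangentSpace (𝓡 n) x), g'.val x v w = Real.exp (2 * f x) * g.val x v w

/-- A conformal structure of signature `(p, q)`: an equivalence class of metrics. -/
def IsConformalStructure (c : Set (SemiRiemannianMetric n p q M)) : Prop :=
  ∃ g : SemiRiemannianMetric n p q M, c = {g' | g.ConformallyEquivalent g'}

/-! ### The standard tractor bundle in the splitting given by a metric of the conformal class -/

/-- The fibre at `x` of the standard tractor bundle, in the splitting `𝒯 ≅ ℝ ⊕ TM ⊕ ℝ` given by a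
metric in the conformal class; the triple `(α, Y, β)` stands for `α s₋ + Y + β s₊`.
(The type `TangentSpace (𝓡 n) x` is by definition `EuclideanSpace ℝ (Fin n)`; the latter is used so
that the norm is available.) -/
abbrev Tractor (n : ℕ) {M : Type*} (_x : M) : Type :=
  ℝ × EuclideanSpace ℝ (Fin n) × ℝ

/-- The tractor metric `h`. -/
def tractorMetric (g : SemiRiemannianMetric n p q M) (x : M) (T T' : Tractor n x) : ℝ :=
  T.1 * T'.2.2 + T'.1 * T.2.2 + g.val x T.2.1 T'.2.1

theorem tractorMetric_add_left (g : SemiRiemannianMetric n p q M) (x : M) (S T U : Tractor n x) :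
    tractorMetric g x (S + T) U = tractorMetric g x S U + tractorMetric g x T U := by
  have h : g.val x (S + T).2.1 U.2.1 = g.val x S.2.1 U.2.1 + g.val x T.2.1 U.2.1 :=
    (g.val x).map_add₂ S.2.1 T.2.1 U.2.1
  simp only [tractorMetric, Prod.fst_add, Prod.snd_add] at h ⊢
  linear_combination h

theorem tractorMetric_add_right (g : SemiRiemannianMetric n p q M) (x : M) (S T U : Tractor n x) :
    tractorMetric g x S (T + U) = tractorMetric g x S T + tractorMetric g x S U := by
  have h : g.val x S.2.1 (T + U).2.1 = g.val x S.2.1 T.2.1 + g.val x S.2.1 U.2.1 :=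
    (g.val x S.2.1).map_add T.2.1 U.2.1
  simp only [tractorMetric, Prod.fst_add, Prod.snd_add] at h ⊢
  linear_combination h

theorem tractorMetric_smul_left (g : SemiRiemannianMetric n p q M) (x : M) (r : ℝ)
    (S T : Tractor n x) : tractorMetric g x (r • S) T = r * tractorMetric g x S T := by
  have h : g.val x (r • S).2.1 T.2.1 = r * g.val x S.2.1 T.2.1 :=
    (g.val x).map_smul₂ r S.2.1 T.2.1
  simp only [tractorMetric, Prod.smul_fst, Prod.smul_snd, smul_eq_mul] at h ⊢
  linear_combination h

theorem tractorMetric_smul_right (g : SemiRiemannianMetric n p q M) (x : M) (r : ℝ)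
    (S T : Tractor n x) : tractorMetric g x S (r • T) = r * tractorMetric g x S T := by
  have h : g.val x S.2.1 (r • T).2.1 = r * g.val x S.2.1 T.2.1 :=
    (g.val x S.2.1).map_smul r T.2.1
  simp only [tractorMetric, Prod.smul_fst, Prod.smul_snd, smul_eq_mul] at h ⊢
  linear_combination h

/-- The lightlike tractor `s₋`, which spans the canonical line `ℐ`. -/
def sMinus (n : ℕ) {M : Type*} (x : M) : Tractor n x := (1, 0, 0)

/-- The canonical lightlike line `ℐ_x`. -/
def canonicalLine (n : ℕ) {M : Type*} (x : M) : Submodule ℝ (Tractor n x) :=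
  Submodule.span ℝ {sMinus n x}

/-- The tractor field `T` along the curve `γ : [0,1] → M` is parallel for the normal conformal
tractor connection
`∇_X (α, Y, β) = (X(α) - P(X,Y), ∇_X Y + α X + β P(X), X(β) - g(X,Y))`.
At each time the equation is written in a chart of the atlas around `γ t`; by covariance it does
not matter in which one. Here `c` is the coordinate expression of `γ` and `y` the one of `Y`. -/
def IsParallelAlong (g : SemiRiemannianMetric n p q M) (γ : ℝ → M)
    (T : ∀ t : ℝ, Tractor n (γ t)) : Prop :=
  ∀ t ∈ Icc (0 : ℝ) 1, ∃ x₀ : M, γ t ∈ (chartAt (EuclideanSpace ℝ (Fin n)) x₀).source ∧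
    let G := chartComponents g.val x₀
    let c : ℝ → EuclideanSpace ℝ (Fin n) := fun s => extChartAt (𝓡 n) x₀ (γ s)
    let c' := derivWithin c (Icc 0 1) t
    let y : ℝ → EuclideanSpace ℝ (Fin n) := fun s =>
      tangentCoordChange (𝓡 n) (γ s) x₀ (γ s) (T s).2.1
    let α : ℝ → ℝ := fun s => (T s).1
    let β : ℝ → ℝ := fun s => (T s).2.2
    HasDerivWithinAt α (∑ i, ∑ j, schouten G i j (c t) * c' i * y t j) (Icc 0 1) t ∧
    HasDerivWithinAt y
      (WithLp.toLp 2 fun k =>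
        -(∑ i, ∑ j, christoffel G k i j (c t) * c' i * y t j)
          - α t * c' k
          - β t * ∑ l, ∑ i, (G (c t))⁻¹ k l * schouten G l i (c t) * c' i) (Icc 0 1) t ∧
    HasDerivWithinAt β (∑ i, ∑ j, G (c t) i j * c' i * y t j) (Icc 0 1) t

/-- `A : 𝒯_x → 𝒯_y` is the parallel transport along some piecewise smooth curve from `x` to `y`. -/
inductive IsParallelTransport (g : SemiRiemannianMetric n p q M) :
    ∀ x y : M, (Tractor n x ≃L[ℝ] Tractor n y) → Prop
  | smooth (x y : M) (γ : ℝ → M) (A : Tractor n x ≃L[ℝ] Tractor n y)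
      (hγ : ContMDiffOn 𝓘(ℝ) (𝓡 n) ∞ γ (Icc 0 1)) (h0 : γ 0 = x) (h1 : γ 1 = y)
      (hA : ∀ v : Tractor n x, ∃ T : ∀ t : ℝ, Tractor n (γ t),
        IsParallelAlong g γ T ∧ T 0 = v ∧ T 1 = A v) :
      IsParallelTransport g x y A
  | trans (x y z : M) (A : Tractor n x ≃L[ℝ] Tractor n y) (B : Tractor n y ≃L[ℝ] Tractor n z) :
      IsParallelTransport g x y A → IsParallelTransport g y z B →
        IsParallelTransport g x z (A.trans B)

/-- The conformal holonomy group `Hol_x(M, c)`: parallel transports along loops at `x`. -/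
def Hol (g : SemiRiemannianMetric n p q M) (x : M) : Set (Tractor n x ≃L[ℝ] Tractor n x) :=
  {A | IsParallelTransport g x x A}

/-- The conformal holonomy algebra `𝔥𝔬𝔩_x(M, c)`, i.e. the Lie algebra of `Hol_x(M, c)`. It consists
of the `A` whose one-parameter group `exp (tA)` lies in the Lie group `Hol_x(M, c)`; these form
a linear subspace, so that taking the span only turns the set into a `Submodule`. -/
def holAlgebra (g : SemiRiemannianMetric n p q M) (x : M) :
    Submodule ℝ (Tractor n x →L[ℝ] Tractor n x) :=
  Submodule.span ℝ {A | ∀ t : ℝ, ∃ B ∈ Hol g x,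
    (B : Tractor n x →L[ℝ] Tractor n x) = NormedSpace.exp (t • A)}

/-- The subspace `𝔤₁` of `𝔰𝔬(𝒯_x, h_x)`: the skew endomorphisms that kill `ℐ` and map `ℐ^⊥`
to `ℐ`. In the splitting these are the maps `(α, Y, β) ↦ (μ(Y), -β μ^♯, 0)`. -/
def gOne (g : SemiRiemannianMetric n p q M) (x : M) :
    Submodule ℝ (Tractor n x →L[ℝ] Tractor n x) where
  carrier := {A | (∀ v w, tractorMetric g x (A v) w + tractorMetric g x v (A w) = 0) ∧
    A (sMinus n x) = 0 ∧
    ∀ v, tractorMetric g x v (sMinus n x) = 0 → A v ∈ canonicalLine n x}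
  zero_mem' := by
    refine ⟨fun v w => ?_, rfl, fun v _ => Submodule.zero_mem _⟩
    have h1 := tractorMetric_smul_left g x 0 0 w
    have h2 := tractorMetric_smul_right g x 0 v 0
    simp only [zero_smul, zero_mul] at h1 h2
    exact (congrArg₂ (· + ·) h1 h2).trans (add_zero 0)
  add_mem' := by
    rintro A B ⟨hA, hA', hA''⟩ ⟨hB, hB', hB''⟩
    refine ⟨fun v w => ?_, by simp [hA', hB'], fun v hv => ?_⟩
    · have h1 := tractorMetric_add_left g x (A v) (B v) w
      have h2 := tractorMetric_add_right g x v (A w) (B w)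
      exact (congrArg₂ (· + ·) h1 h2).trans (by linear_combination hA v w + hB v w)
    · exact Submodule.add_mem _ (hA'' v hv) (hB'' v hv)
  smul_mem' := by
    rintro r A ⟨hA, hA', hA''⟩
    refine ⟨fun v w => ?_, by simp [hA'], fun v hv => ?_⟩
    · have h1 := tractorMetric_smul_left g x r (A v) w
      have h2 := tractorMetric_smul_right g x r v (A w)
      exact (congrArg₂ (· + ·) h1 h2).trans (by linear_combination r * hA v w)
    · exact Submodule.smul_mem _ _ (hA'' v hv)

/-- The rank `r^ℰ(x) = dim (𝔥𝔬𝔩_x(M, c) ∩ 𝔤₁)` of the conformal holonomy distribution. -/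
def rankE (g : SemiRiemannianMetric n p q M) (x : M) : ℕ :=
  Module.finrank ℝ (holAlgebra g x ⊓ gOne g x : Submodule ℝ (Tractor n x →L[ℝ] Tractor n x))

end Tractors

/-! ### The structure group, frames and parallel sections of associated bundles -/

/-- The vector space `ℝ^{p+1,q+1}`. -/
abbrev Model (p q : ℕ) : Type := Fin (p + 1) ⊕ Fin (q + 1) → ℝ

/-- The standard inner product of `ℝ^{p+1,q+1}`. -/
def modelForm (p q : ℕ) (v w : Model p q) : ℝ :=
  -(∑ i, v (Sum.inl i) * w (Sum.inl i)) + ∑ j, v (Sum.inr j) * w (Sum.inr j)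

/-- The group `G = O(p+1, q+1)`. -/
def orthogonalGroup (p q : ℕ) : Subgroup (Model p q ≃L[ℝ] Model p q) where
  carrier := {a | ∀ v w, modelForm p q (a v) (a w) = modelForm p q v w}
  one_mem' := fun _ _ => rfl
  mul_mem' := by
    intro a b ha hb v w
    exact (ha (b v) (b w)).trans (hb v w)
  inv_mem' := by
    intro a ha v w
    have h := ha (a⁻¹ v) (a⁻¹ w)
    have h1 : ∀ u, a (a⁻¹ u) = u := fun u => a.apply_symm_apply u
    rw [h1, h1] at h
    exact h.symm

/-- A representation of `G = O(p+1, q+1)` is smooth. As `G` is a closed submanifold of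
`End(ℝ^{p+1,q+1})`, this means that it is the restriction of a smooth map on that space. -/
def IsSmoothRep {p q : ℕ} {V : Type*} [NormedAddCommGroup V] [NormedSpace ℝ V]
    (ρ : Representation ℝ (orthogonalGroup p q) V) : Prop :=
  ∃ F : (Model p q →L[ℝ] Model p q) → (V →L[ℝ] V), ContDiff ℝ ∞ F ∧
    ∀ (a : orthogonalGroup p q) (v : V),
      F ((a : Model p q ≃L[ℝ] Model p q) : Model p q →L[ℝ] Model p q) v = ρ a v

section Frames

variable {n p q : ℕ} {M : Type*} [TopologicalSpace M]
  [ChartedSpace (EuclideanSpace ℝ (Fin n)) M] [IsManifold (𝓡 n) ∞ M]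

/-- The fibre at `x` of the principal `G`-bundle `Ĝ → M`: the linear isometries
`ℝ^{p+1,q+1} → 𝒯_x`. -/
structure Frame (g : SemiRiemannianMetric n p q M) (x : M) where
  /-- the underlying linear isomorphism -/
  toEquiv : Model p q ≃L[ℝ] Tractor n x
  isometry : ∀ v w, tractorMetric g x (toEquiv v) (toEquiv w) = modelForm p q v w

/-- The right action of `G` on frames. -/
def Frame.act {g : SemiRiemannianMetric n p q M} {x : M} (u : Frame g x)
    (a : orthogonalGroup p q) : Frame g x where
  toEquiv := (a : Model p q ≃L[ℝ] Model p q).trans u.toEquiv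
  isometry := fun v w => (u.isometry _ _).trans (a.2 v w)

/-- The frame maps the line `L` spanned by `ℓ` to the canonical line `ℐ_x`. These frames make up the
principal `P`-bundle `𝒢 → M`, where `P` is the stabiliser of `L`. -/
def Frame.IsAdapted {g : SemiRiemannianMetric n p q M} {x : M} (u : Frame g x)
    (ℓ : Model p q) : Prop :=
  u.toEquiv ℓ ∈ canonicalLine n x

/-- A parallel section `ψ` of the bundle `ℋ = Ĝ ×_G V` associated with the representation `ρ`,
encoded as a `G`-equivariant map `s : Ĝ → V`, `u ↦ [u]⁻¹ ψ`, that is constant along horizontal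
curves in `Ĝ` (that is, along parallel frames). -/
structure ParallelSection (g : SemiRiemannianMetric n p q M) {V : Type*} [NormedAddCommGroup V]
    [NormedSpace ℝ V] (ρ : Representation ℝ (orthogonalGroup p q) V) where
  /-- the equivariant map on the frame bundle -/
  toFun : ∀ x : M, Frame g x → V
  equivariant : ∀ (x : M) (u : Frame g x) (a : orthogonalGroup p q),
    toFun x (u.act a) = ρ a⁻¹ (toFun x u)
  parallel : ∀ (x y : M) (A : Tractor n x ≃L[ℝ] Tractor n y), IsParallelTransport g x y A →
    ∀ (u : Frame g x) (u' : Frame g y), (∀ w, u'.toEquiv w = A (u.toEquiv w)) →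
      toFun y u' = toFun x u

variable {g : SemiRiemannianMetric n p q M} {V : Type*} [NormedAddCommGroup V] [NormedSpace ℝ V]
  {ρ : Representation ℝ (orthogonalGroup p q) V}

/-- The stabiliser of `ψ_x` in the orthogonal group of `𝒯_x`, which acts on `ℋ_x`: the maps
`u ∘ a ∘ u⁻¹` with `a ∈ G` and `u` a frame at `x` such that `ρ(a)` fixes `[u]⁻¹ ψ_x`. -/
def ParallelSection.stabiliser (ψ : ParallelSection g ρ) (x : M) :
    Set (Tractor n x ≃L[ℝ] Tractor n x) :=
  {A | ∃ (u : Frame g x) (a : orthogonalGroup p q), ρ a (ψ.toFun x u) = ψ.toFun x u ∧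
    ∀ w, A (u.toEquiv w) = u.toEquiv ((a : Model p q ≃L[ℝ] Model p q) w)}

/-- The `P`-type `s(𝒢_x) ⊆ V` of the point `x`. -/
def ParallelSection.pType (ψ : ParallelSection g ρ) (ℓ : Model p q) (x : M) : Set V :=
  {v | ∃ u : Frame g x, u.IsAdapted ℓ ∧ ψ.toFun x u = v}

/-- A curved orbit: the set of all points with the same `P`-type as a given point. -/
def ParallelSection.IsCurvedOrbit (ψ : ParallelSection g ρ) (ℓ : Model p q) (N : Set M) : Prop :=
  ∃ x : M, N = {y | ψ.pType ℓ y = ψ.pType ℓ x}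

end Frames

/-! ### Initial submanifolds -/

section InitialSubmanifolds

variable (n : ℕ) {M : Type*} [TopologicalSpace M] [ChartedSpace (EuclideanSpace ℝ (Fin n)) M]

/-- The set `C_x(A)` of all points that can be joined to `x` by a smooth curve in `M` that lies
in `A`. -/
def smoothPathComponent (x : M) (A : Set M) : Set M :=
  {y | ∃ γ : ℝ → M, ContMDiffOn 𝓘(ℝ) (𝓡 n) ∞ γ (Icc 0 1) ∧ MapsTo γ (Icc 0 1) A ∧
    γ 0 = x ∧ γ 1 = y}

/-- `N` is an initial submanifold of `M`, of some dimension `m`: around each `x ∈ N` there is a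
chart `e : U → ℝⁿ` of the smooth manifold `M`, centred at `x`, such that
`e(C_x(U ∩ N)) = e(U) ∩ (ℝᵐ × 0)`. -/
def IsInitialSubmanifold (N : Set M) : Prop :=
  ∃ m ≤ n, ∀ x ∈ N, ∃ e ∈ IsManifold.maximalAtlas (𝓡 n) ∞ M, x ∈ e.source ∧ e x = 0 ∧
    e '' smoothPathComponent n x (e.source ∩ N) =
      e.target ∩ {v : EuclideanSpace ℝ (Fin n) | ∀ i : Fin n, m ≤ (i : ℕ) → v i = 0}

end InitialSubmanifolds

end ConformalHolonomy

end

/-! Near a point of a curved orbit, choose a smooth orthonormal frame field of the tractor bundle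
that sends `ℓ` into the canonical line. In it the parallel section becomes a smooth map `f` from a
coordinate ball to `V`, and the `P`-type of a point is the `P`-orbit of the value of `f` there
(`exists_localSection`). So the curved orbit is locally the preimage under `f` of one `P`-orbit
`P·v`.

Parallel transport is isometric, so `f` stays in the single `G`-orbit `G·v` and `df` takes values in
its tangent spaces. Since `∇_X s₋ = X`, the connection form is onto modulo the Lie algebra of `P`
(`exists_sub_frameForm_mem_stabAlg`); hence `df` fills `T(G·v)` modulo `T(P·v)`. Thus `f`, as a map
into `G·v`, is transverse to `P·v`.

Near `v` there are smooth functions `y`, transverse to `G·v`, and `z`, transverse to `P·v` inside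
`G·v`. The `P`-orbit need not be embedded, but `z` takes only countably many values on it, and `y =
z = 0` implies membership (`exists_orbit_slice`). Now `y ∘ f = 0` and `z ∘ f` is a submersion onto
the range of `dz`. A smooth curve in the curved orbit cannot leave a level of `z ∘ f`, because a
countable set is totally disconnected. So the smooth path component of the centre is the slice `z ∘
f = 0` (`exists_slice_chart`), which is the condition for an initial submanifold.

The holonomy hypothesis serves to show that the rank is constant on a curved orbit. Two points of
equal `P`-type have adapted frames `u`, `u'` with the same value of `s`. Then `u' ∘ u⁻¹` is an
isometry that carries the canonical line to the canonical line and the stabiliser of `ψ_x` to that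
of `ψ_y`. As these are the holonomy groups, it carries the intersection of the holonomy algebra with
`𝔤₁` at `x` to the one at `y` (`rankE_le_of_toFun_eq`). -/

open Set
open scoped Manifold ContDiff Topology

noncomputable section

namespace ConformalHolonomy

/-! ### The stabiliser of a line in the orthogonal group, and its Lie algebra -/

section StabiliserOfLine

variable {p q : ℕ}

/-- The standard inner product as a bilinear map. -/
def modelBilin (p q : ℕ) : Model p q →ₗ[ℝ] Model p q →ₗ[ℝ] ℝ :=
  LinearMap.mk₂ ℝ (modelForm p q)
    (by intro u v w; simp only [modelForm, Pi.add_apply, add_mul, Finset.sum_add_distrib]; ring)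
    (by intro r u v; simp only [modelForm, Pi.smul_apply, smul_eq_mul, mul_assoc, Finset.mul_sum,
          mul_add, mul_neg])
    (by intro u v w; simp only [modelForm, Pi.add_apply, mul_add, Finset.sum_add_distrib]; ring)
    (by intro r u v; simp only [modelForm, Pi.smul_apply, smul_eq_mul, mul_left_comm _ r,
          Finset.mul_sum, mul_add, mul_neg])

theorem modelBilin_apply (v w : Model p q) : modelBilin p q v w = modelForm p q v w := rfl

theorem modelForm_comm (v w : Model p q) : modelForm p q v w = modelForm p q w v := by
  simp only [modelForm, mul_comm]

theorem modelForm_zero_left (w : Model p q) : modelForm p q 0 w = 0 := by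
  simp [modelForm]

theorem modelForm_add_left (u v w : Model p q) :
    modelForm p q (u + v) w = modelForm p q u w + modelForm p q v w := by
  simp [← modelBilin_apply]

theorem modelForm_sub_left (u v w : Model p q) :
    modelForm p q (u - v) w = modelForm p q u w - modelForm p q v w := by
  simp [← modelBilin_apply]

theorem modelForm_smul_left (r : ℝ) (v w : Model p q) :
    modelForm p q (r • v) w = r * modelForm p q v w := by
  simp [← modelBilin_apply]

theorem modelForm_add_right (u v w : Model p q) :
    modelForm p q u (v + w) = modelForm p q u v + modelForm p q u w := by
  simp [← modelBilin_apply]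

theorem modelForm_sub_right (u v w : Model p q) :
    modelForm p q u (v - w) = modelForm p q u v - modelForm p q u w := by
  simp [← modelBilin_apply]

theorem modelForm_smul_right (r : ℝ) (v w : Model p q) :
    modelForm p q v (r • w) = r * modelForm p q v w := by
  simp [← modelBilin_apply]

theorem modelForm_nondegenerate {v : Model p q} (h : ∀ w, modelForm p q v w = 0) : v = 0 := by
  funext i
  rcases i with i | j
  · have := h (Pi.single (Sum.inl i) 1)
    simpa [modelForm, Pi.single_apply] using this
  · have := h (Pi.single (Sum.inr j) 1)
    simpa [modelForm, Pi.single_apply] using this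

/-- The isometries of `ℝ^{p+1,q+1}` that preserve the line spanned by `ℓ` (all isometries if
`ℓ = 0`), as a set of endomorphisms. -/
def stab (ℓ : Model p q) : Set (Model p q →L[ℝ] Model p q) :=
  {a | (∀ v w, modelForm p q (a v) (a w) = modelForm p q v w) ∧ a ℓ ∈ Submodule.span ℝ {ℓ}}

/-- The skew endomorphisms of `ℝ^{p+1,q+1}` that preserve the line spanned by `ℓ`. -/
def stabAlg (ℓ : Model p q) : Submodule ℝ (Model p q →L[ℝ] Model p q) where
  carrier := {X | (∀ v w, modelForm p q (X v) w + modelForm p q v (X w) = 0) ∧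
    X ℓ ∈ Submodule.span ℝ {ℓ}}
  zero_mem' := ⟨fun v w => by simp [← modelBilin_apply], by simp⟩
  add_mem' := by
    rintro X Y ⟨hX, hX'⟩ ⟨hY, hY'⟩
    refine ⟨fun v w => ?_, Submodule.add_mem _ hX' hY'⟩
    simp only [add_apply, modelForm_add_left, modelForm_add_right]
    linear_combination hX v w + hY v w
  smul_mem' := by
    rintro r X ⟨hX, hX'⟩
    refine ⟨fun v w => ?_, Submodule.smul_mem _ _ hX'⟩
    simp only [smul_apply, modelForm_smul_left, modelForm_smul_right]
    linear_combination r * hX v w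

theorem stab_subset (ℓ : Model p q) : stab ℓ ⊆ stab 0 :=
  fun _ h => ⟨h.1, by simp⟩

/-- For `ℓ = 0` the condition on the line is void, so `stabAlg 0` is the full orthogonal Lie
algebra. This convention lets one set of lemmas treat `P` and `G` together. -/
theorem stabAlg_le (ℓ : Model p q) : stabAlg ℓ ≤ stabAlg 0 :=
  fun _ h => ⟨h.1, by simp⟩

theorem one_mem_stab (ℓ : Model p q) : 1 ∈ stab ℓ :=
  ⟨fun _ _ => rfl, Submodule.mem_span_singleton_self ℓ⟩

theorem apply_span_mem {ℓ v : Model p q} {a : Model p q →L[ℝ] Model p q}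
    (ha : a ℓ ∈ Submodule.span ℝ {ℓ}) (hv : v ∈ Submodule.span ℝ {ℓ}) :
    a v ∈ Submodule.span ℝ {ℓ} := by
  obtain ⟨r, rfl⟩ := Submodule.mem_span_singleton.1 hv
  rw [map_smul]
  exact Submodule.smul_mem _ _ ha

theorem mul_mem_stab {ℓ : Model p q} {a b : Model p q →L[ℝ] Model p q} (ha : a ∈ stab ℓ)
    (hb : b ∈ stab ℓ) : a * b ∈ stab ℓ :=
  ⟨fun v w => (ha.1 _ _).trans (hb.1 v w), apply_span_mem (a := a) ha.2 hb.2⟩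

theorem injective_of_isometry {a : Model p q →L[ℝ] Model p q}
    (ha : ∀ v w, modelForm p q (a v) (a w) = modelForm p q v w) : Function.Injective a := by
  rw [injective_iff_map_eq_zero]
  intro v hv
  refine modelForm_nondegenerate fun w => ?_
  rw [← ha, hv, modelForm_zero_left]

/-- An isometry as an element of `O(p+1, q+1)`. -/
theorem exists_orthogonalGroup {a : Model p q →L[ℝ] Model p q} (ha : a ∈ stab 0) :
    ∃ b : orthogonalGroup p q, ((b : Model p q ≃L[ℝ] Model p q) :
      Model p q →L[ℝ] Model p q) = a := by
  let e := (LinearEquiv.ofInjectiveEndo (a : Model p q →ₗ[ℝ] Model p q)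
    (injective_of_isometry ha.1)).toContinuousLinearEquiv
  have he : ∀ v, e v = a v := fun v => rfl
  exact ⟨⟨e, fun v w => ha.1 v w⟩, ContinuousLinearMap.ext he⟩

theorem exists_inv_stab {ℓ : Model p q} {a : Model p q →L[ℝ] Model p q} (ha : a ∈ stab ℓ) :
    ∃ b ∈ stab ℓ, a * b = 1 ∧ b * a = 1 := by
  obtain ⟨e, he⟩ := exists_orthogonalGroup (stab_subset ℓ ha)
  have hab : a * ((e⁻¹ : orthogonalGroup p q) : Model p q ≃L[ℝ] Model p q) = 1 := by
    rw [← he]; ext1 v; exact (e : Model p q ≃L[ℝ] Model p q).apply_symm_apply v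
  have hba : ((e⁻¹ : orthogonalGroup p q) : Model p q ≃L[ℝ] Model p q) * a = 1 := by
    rw [← he]; ext1 v; exact (e : Model p q ≃L[ℝ] Model p q).symm_apply_apply v
  refine ⟨_, ⟨fun v w => (e⁻¹).2 v w, ?_⟩, hab, hba⟩
  obtain ⟨r, hr⟩ := Submodule.mem_span_singleton.1 ha.2
  have hb := DFunLike.congr_fun hba ℓ
  simp only [mul_apply_eq_comp, one_apply_eq_self, ← hr, map_smul] at hb
  -- The case `r = 0` only occurs for `ℓ = 0`.
  by_cases h0 : r = 0
  · rw [h0, zero_smul] at hb; rw [← hb]; simp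
  · exact Submodule.mem_span_singleton.2 ⟨r⁻¹, by
      rw [inv_smul_eq_iff₀ h0]; exact hb.symm⟩

/-- Differentiating the invariance of the inner product at the identity gives skewness. The line is
closed, so it contains the limit of the difference quotients of `a s ℓ`. -/
theorem mem_stabAlg_of_hasDerivAt {ℓ : Model p q} {a : ℝ → Model p q →L[ℝ] Model p q}
    {X : Model p q →L[ℝ] Model p q} (h : HasDerivAt a X 0) (h0 : a 0 = 1)
    (ha : ∀ᶠ s in 𝓝 0, a s ∈ stab ℓ) : X ∈ stabAlg ℓ := by
  have hv : ∀ v, HasDerivAt (fun s => a s v) (X v) 0 := fun v => by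
    simpa using h.clm_apply (hasDerivAt_const 0 v)
  constructor
  · intro v w
    let B : Model p q →L[ℝ] Model p q →L[ℝ] ℝ := (modelBilin p q).toContinuousBilinearMap
    have h1 : HasDerivAt (fun s => B (a s v) (a s w)) (B (X v) (a 0 w) + B (a 0 v) (X w)) 0 := by
      have := (B.hasFDerivAt.comp_hasDerivAt 0 (hv v)).clm_apply (hv w)
      exact this
    have h2 : HasDerivAt (fun s => B (a s v) (a s w)) 0 0 :=
      (hasDerivAt_const 0 (B v w)).congr_of_eventuallyEq
        (ha.mono fun s hs => hs.1 v w)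
    have h3 := h1.unique h2
    rw [h0] at h3
    exact h3
  · have h1 : IsClosed ((Submodule.span ℝ {ℓ} : Submodule ℝ (Model p q)) : Set (Model p q)) :=
      Submodule.closed_of_finiteDimensional _
    refine h1.mem_of_tendsto (hv ℓ).tendsto_slope_zero ?_
    filter_upwards [nhdsWithin_le_nhds ha] with t ht
    refine Submodule.smul_mem _ _ (Submodule.sub_mem _ ?_ ?_)
    · simpa using ht.2
    · simp [h0]

end StabiliserOfLine

/-! ### The Cayley transform as a local chart at the identity -/

section CayleyTransform

variable {A : Type*} [NormedRing A] [NormedAlgebra ℝ A]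

/-- The Cayley transform. -/
def cay (X : A) : A := Ring.inverse (1 - (1 / 2 : ℝ) • X) * (1 + (1 / 2 : ℝ) • X)

theorem cay_zero : cay (0 : A) = 1 := by
  simp [cay]

variable [CompleteSpace A]

theorem isUnit_one_sub_half {X : A} (hX : ‖X‖ < 1) : IsUnit (1 - (1 / 2 : ℝ) • X) := by
  refine isUnit_one_sub_of_norm_lt_one ?_
  rw [norm_smul]; norm_num; linarith

theorem contDiffAt_cay {X : A} (hX : ‖X‖ < 1) : ContDiffAt ℝ ∞ cay X := by
  obtain ⟨u, hu⟩ := isUnit_one_sub_half hX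
  have h1 : ContDiffAt ℝ ∞ Ring.inverse (1 - (1 / 2 : ℝ) • X) := by
    rw [← hu]; exact contDiffAt_ringInverse ℝ u
  have h2 : ContDiffAt ℝ ∞ (fun Y : A => 1 - (1 / 2 : ℝ) • Y) X := by
    fun_prop
  have h3 : ContDiffAt ℝ ∞ (fun Y : A => 1 + (1 / 2 : ℝ) • Y) X := by
    fun_prop
  exact (h1.comp X h2).mul h3

/-- The factors `1/2` make `cay X = 1 + X + O(X²)`, so `cay` replaces the exponential map to first
order. Being rational with a rational inverse, it respects the inner product and the line by plain
algebra. -/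
theorem hasFDerivAt_cay_zero : HasFDerivAt cay (ContinuousLinearMap.id ℝ A) 0 := by
  have h1 : HasFDerivAt (fun Y : A => 1 - (1 / 2 : ℝ) • Y)
      (-((1 / 2 : ℝ) • ContinuousLinearMap.id ℝ A)) 0 :=
    ((hasFDerivAt_id _).const_smul (1 / 2 : ℝ)).const_sub 1
  have h2 : HasFDerivAt (fun Y : A => 1 + (1 / 2 : ℝ) • Y)
      ((1 / 2 : ℝ) • ContinuousLinearMap.id ℝ A) 0 :=
    ((hasFDerivAt_id _).const_smul (1 / 2 : ℝ)).const_add 1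
  have h3 := hasFDerivAt_ringInverse (𝕜 := ℝ) (1 : Aˣ)
  have h4 := (HasFDerivAt.comp (0 : A) (by simpa using h3) h1).mul' h2
  refine h4.congr_fderiv ?_
  ext1 Y
  simp only [Function.comp_apply, smul_zero, sub_zero, add_zero, Ring.inverse_one, one_smul]
  simp [← add_smul]
  norm_num

theorem one_sub_mul_cay {X : A} (hX : ‖X‖ < 1) :
    (1 - (1 / 2 : ℝ) • X) * cay X = 1 + (1 / 2 : ℝ) • X := by
  rw [cay, Ring.mul_inverse_cancel_left _ _ (isUnit_one_sub_half hX)]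

theorem cay_mul_one_sub {X : A} (hX : ‖X‖ < 1) :
    cay X * (1 - (1 / 2 : ℝ) • X) = 1 + (1 / 2 : ℝ) • X := by
  have h : (1 + (1 / 2 : ℝ) • X) * (1 - (1 / 2 : ℝ) • X) =
    (1 - (1 / 2 : ℝ) • X) * (1 + (1 / 2 : ℝ) • X) := by
    rw [((Commute.one_left _).sub_left (Commute.one_right _ |>.add_right (Commute.refl _))).eq]
  rw [cay, mul_assoc, h, ← mul_assoc, Ring.inverse_mul_cancel _ (isUnit_one_sub_half hX), one_mul]

/-- Solving `(1 - X/2) a = 1 + X/2` for `X` gives `X = 2 (a - 1)(a + 1)⁻¹`. Conversely, multiplied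
by `a + 1` on the right, both sides of this equation become `2a`. -/
theorem cay_two_mul_inverse {a : A} (ha : IsUnit (a + 1))
    (hX : ‖(2 : ℝ) • ((a - 1) * Ring.inverse (a + 1))‖ < 1) :
    cay ((2 : ℝ) • ((a - 1) * Ring.inverse (a + 1))) = a := by
  have h1 := one_sub_mul_cay hX
  set X := (2 : ℝ) • ((a - 1) * Ring.inverse (a + 1)) with hXdef
  have h2 : ((1 / 2 : ℝ) • X) * (a + 1) = a - 1 := by
    rw [hXdef, smul_smul]
    norm_num
    rw [Ring.inverse_mul_cancel_right _ _ ha]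
  refine (isUnit_one_sub_half hX).mul_left_cancel (h1.trans (ha.mul_right_cancel ?_))
  have h3 : (1 - (1 / 2 : ℝ) • X) * a * (a + 1) = (a + 1 - ((1 / 2 : ℝ) • X) * (a + 1)) * a := by
    noncomm_ring
  rw [h3, add_mul, one_mul, h2]
  noncomm_ring

theorem eventually_cay_param {r : ℝ} (hr : 0 < r) : ∀ᶠ a in 𝓝 (1 : A),
    IsUnit (a + 1) ∧ ‖(2 : ℝ) • ((a - 1) * Ring.inverse (a + 1))‖ < r := by
  have h2 : IsUnit ((1 : A) + 1) := by
    have : IsUnit ((2 : ℝ) • (1 : A)) :=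
      (isUnit_one (M := A)).smul (Units.mk0 (2 : ℝ) two_ne_zero)
    rwa [two_smul] at this
  obtain ⟨u, hu⟩ := h2
  have hc : ContinuousAt (fun a : A => a + 1) 1 := by fun_prop
  have h3 : ContinuousAt (fun a : A => Ring.inverse (a + 1)) 1 :=
    ContinuousAt.comp (g := Ring.inverse)
      (by simp only [← hu]; exact NormedRing.inverse_continuousAt u) hc
  have h4 : ContinuousAt (fun a : A => ‖(2 : ℝ) • ((a - 1) * Ring.inverse (a + 1))‖) 1 := by
    fun_prop
  refine Filter.Eventually.and ?_ (h4.eventually_lt continuousAt_const (by simpa using hr))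
  exact hc.eventually (by simp only [← hu]; exact u.nhds)

end CayleyTransform

/-! ### Cayley coordinates on the stabiliser of a line -/

section StabiliserOfLine

variable {p q : ℕ}

/-- Every vector is `w - Xw/2` for some `w`, and `cay X` sends it to `w + Xw/2`. For skew `X` the
terms linear in `X` cancel in the inner product of two such vectors, so the sign of `X` does not
matter. -/
theorem cay_mem_stab {ℓ : Model p q} {X : Model p q →L[ℝ] Model p q} (hX : ‖X‖ < 1)
    (h : X ∈ stabAlg ℓ) : cay X ∈ stab ℓ := by
  have hu := isUnit_one_sub_half hX
  have hc : ∀ w, cay X (w - (1 / 2 : ℝ) • X w) = w + (1 / 2 : ℝ) • X w := fun w =>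
    DFunLike.congr_fun (cay_mul_one_sub hX) w
  constructor
  · have hs : ∀ v, ∃ w, w - (1 / 2 : ℝ) • X w = v := fun v =>
      ⟨Ring.inverse (1 - (1 / 2 : ℝ) • X) v,
        DFunLike.congr_fun (Ring.mul_inverse_cancel _ hu) v⟩
    intro v v'
    obtain ⟨w, rfl⟩ := hs v
    obtain ⟨w', rfl⟩ := hs v'
    rw [hc, hc]
    simp only [modelForm_add_left, modelForm_add_right, modelForm_sub_left, modelForm_sub_right,
      modelForm_smul_left, modelForm_smul_right]
    linear_combination h.1 w w'
  · obtain ⟨r, hr⟩ := Submodule.mem_span_singleton.1 h.2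
    have h1 := hc ℓ
    rw [← hr, show ℓ - (1 / 2 : ℝ) • r • ℓ = (1 - 1 / 2 * r) • ℓ by module, map_smul,
      show ℓ + (1 / 2 : ℝ) • r • ℓ = (1 + 1 / 2 * r) • ℓ by module] at h1
    -- As `1 - X/2` is invertible, this case forces `ℓ = 0`.
    by_cases h0 : 1 - 1 / 2 * r = 0
    · have h2 : Ring.inverse (1 - (1 / 2 : ℝ) • X) ((1 - (1 / 2 : ℝ) • X) ℓ) = ℓ :=
        DFunLike.congr_fun (Ring.inverse_mul_cancel _ hu) ℓ
      have h3 : (1 - (1 / 2 : ℝ) • X) ℓ = (1 - 1 / 2 * r) • ℓ := by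
        rw [sub_smul, ← smul_smul, hr, one_smul]; rfl
      rw [h3, h0, zero_smul, map_zero] at h2
      simp [← h2]
    · exact Submodule.mem_span_singleton.2 ⟨(1 - 1 / 2 * r)⁻¹ * (1 + 1 / 2 * r), by
        rw [mul_smul, inv_smul_eq_iff₀ h0]; exact h1.symm⟩

/-- With such an `X`, the path `cay (t • X)` joins `1` to `a` inside the stabiliser. -/
theorem eventually_exists_cay_eq (ℓ : Model p q) {r : ℝ} (hr : 0 < r) :
    ∀ᶠ a in 𝓝 (1 : Model p q →L[ℝ] Model p q), a ∈ stab ℓ →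
      ∃ X ∈ stabAlg ℓ, ‖X‖ < r ∧ cay X = a := by
  filter_upwards [eventually_cay_param (lt_min hr one_pos)] with a ⟨hu, hX⟩ ha
  refine ⟨_, ?_, hX.trans_le (min_le_left _ _),
    cay_two_mul_inverse hu (hX.trans_le (min_le_right _ _))⟩
  set X := (2 : ℝ) • ((a - 1) * Ring.inverse (a + 1)) with hXdef
  have hc : ∀ w, X (a w + w) = (2 : ℝ) • (a w - w) := by
    have : X * (a + 1) = (2 : ℝ) • (a - 1) := by
      rw [hXdef, smul_mul_assoc, Ring.inverse_mul_cancel_right _ _ hu]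
    exact fun w => DFunLike.congr_fun this w
  constructor
  · have hs : ∀ v, ∃ w, a w + w = v := fun v =>
      ⟨Ring.inverse (a + 1) v, DFunLike.congr_fun (Ring.mul_inverse_cancel _ hu) v⟩
    intro v v'
    obtain ⟨w, rfl⟩ := hs v
    obtain ⟨w', rfl⟩ := hs v'
    rw [hc, hc]
    simp only [modelForm_add_left, modelForm_add_right, modelForm_sub_left, modelForm_sub_right,
      modelForm_smul_left, modelForm_smul_right]
    linear_combination 4 * ha.1 w w'
  · obtain ⟨t, ht⟩ := Submodule.mem_span_singleton.1 ha.2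
    have h1 := hc ℓ
    rw [← ht, show t • ℓ + ℓ = (t + 1) • ℓ by module, map_smul,
      show (2 : ℝ) • (t • ℓ - ℓ) = (2 * (t - 1)) • ℓ by module] at h1
    -- As `a + 1` is invertible, the eigenvalue `-1` forces `ℓ = 0`.
    by_cases h0 : t + 1 = 0
    · have h2 : Ring.inverse (a + 1) ((a + 1) ℓ) = ℓ :=
        DFunLike.congr_fun (Ring.inverse_mul_cancel _ hu) ℓ
      have h3 : (a + 1) ℓ = (t + 1) • ℓ := by
        rw [add_smul, ht, one_smul]; rfl
      rw [h3, h0, zero_smul, map_zero] at h2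
      simp [← h2]
    · exact Submodule.mem_span_singleton.2 ⟨(t + 1)⁻¹ * (2 * (t - 1)), by
        rw [mul_smul, inv_smul_eq_iff₀ h0]; exact h1.symm⟩

end StabiliserOfLine

/-! ### Inverse functions and auxiliary calculus -/

/-- The source is cut down to the open set where the derivative is invertible; the inverse is then
smooth on the whole target and not only at the image of `a`. -/
theorem exists_smooth_openPartialHomeomorph {E F : Type*} [NormedAddCommGroup E] [NormedSpace ℝ E]
    [CompleteSpace E] [NormedAddCommGroup F] [NormedSpace ℝ F] {f : E → F} {D : Set E}
    (hD : IsOpen D) (hf : ContDiffOn ℝ ∞ f D) {a : E} (ha : a ∈ D) (f' : E ≃L[ℝ] F)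
    (hf' : HasFDerivAt f (f' : E →L[ℝ] F) a) :
    ∃ h : OpenPartialHomeomorph E F, a ∈ h.source ∧ h.source ⊆ D ∧ (h : E → F) = f ∧
      ContDiffOn ℝ ∞ h.symm h.target := by
  have h1 : ContDiffAt ℝ ∞ f a := hf.contDiffAt (hD.mem_nhds ha)
  have h2 : ContinuousOn (fderiv ℝ f) D := hf.continuousOn_fderiv_of_isOpen hD (by simp)
  let D' := D ∩ fderiv ℝ f ⁻¹' range ((↑) : (E ≃L[ℝ] F) → E →L[ℝ] F)
  have hD' : IsOpen D' := h2.isOpen_inter_preimage hD ContinuousLinearEquiv.isOpen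
  let h := (h1.toOpenPartialHomeomorph f hf' (by simp)).restrOpen D' hD'
  have hh : (h : E → F) = f := rfl
  have hs : h.source = (h1.toOpenPartialHomeomorph f hf' (by simp)).source ∩ D' := rfl
  refine ⟨h, ?_, ?_, hh, ?_⟩
  · rw [hs]
    exact ⟨h1.mem_toOpenPartialHomeomorph_source hf' (by simp), ha, ⟨f', hf'.fderiv.symm⟩⟩
  · rw [hs]; exact fun x hx => hx.2.1
  · intro w hw
    have hx : h.symm w ∈ h.source := h.map_target hw
    obtain ⟨hxD, e, he⟩ : h.symm w ∈ D' := (hs ▸ hx).2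
    have hd := hf.contDiffAt (hD.mem_nhds hxD)
    refine (h.contDiffAt_symm (f₀' := e) hw ?_ ?_).contDiffWithinAt
    · rw [hh, he]; exact (hd.differentiableAt (by simp)).hasFDerivAt
    · rw [hh]; exact hd

theorem hasDerivAt_clm_comp_apply {A V W : Type*} [NormedAddCommGroup A] [NormedSpace ℝ A]
    [NormedAddCommGroup V] [NormedSpace ℝ V] [NormedAddCommGroup W] [NormedSpace ℝ W]
    {F : A → V →L[ℝ] W} (hF : ContDiff ℝ ∞ F) {a : ℝ → A} {a' : A} {s : ℝ}
    (ha : HasDerivAt a a' s) (w : V) :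
    HasDerivAt (fun t => F (a t) w) (fderiv ℝ F (a s) a' w) s := by
  have h1 : HasFDerivAt F (fderiv ℝ F (a s)) (a s) :=
    (hF.differentiable (by simp) _).hasFDerivAt
  have h2 := h1.comp_hasDerivAt s ha
  have h3 : HasFDerivAt (fun L : V →L[ℝ] W => L w) (ContinuousLinearMap.apply ℝ W w) (F (a s)) :=
    (ContinuousLinearMap.apply ℝ W w).hasFDerivAt
  exact h3.comp_hasDerivAt s h2

theorem exists_linear_projection {V : Type*} [AddCommGroup V] [Module ℝ V] (S : Submodule ℝ V) :
    ∃ π : V →ₗ[ℝ] V, (∀ ξ, π ξ ∈ S) ∧ ∀ ξ ∈ S, π ξ = ξ := by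
  obtain ⟨f, hf⟩ := S.subtype.exists_leftInverse_of_injective (by simp)
  refine ⟨S.subtype ∘ₗ f, fun ξ => (f ξ).2, fun ξ hξ => ?_⟩
  exact congrArg Subtype.val (LinearMap.congr_fun hf ⟨ξ, hξ⟩)

/-! ### Tangent spaces of the orbits of a representation -/

section OrbitTangent

variable {p q : ℕ} {V : Type*} [NormedAddCommGroup V] [NormedSpace ℝ V]
  {F : (Model p q →L[ℝ] Model p q) → (V →L[ℝ] V)}

/-- The tangent space at `w` of the orbit through `w` of the stabiliser of the line spanned
by `ℓ`. -/
def orbitTangent (F : (Model p q →L[ℝ] Model p q) → (V →L[ℝ] V)) (ℓ : Model p q) (w : V) :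
    Submodule ℝ V :=
  (stabAlg ℓ).map ((ContinuousLinearMap.apply ℝ V w).comp (fderiv ℝ F 1) : _ →L[ℝ] V).toLinearMap

theorem mem_orbitTangent {ℓ : Model p q} {w d : V} :
    d ∈ orbitTangent F ℓ w ↔ ∃ X ∈ stabAlg ℓ, fderiv ℝ F 1 X w = d := Iff.rfl

theorem orbitTangent_le (ℓ : Model p q) (w : V) : orbitTangent F ℓ w ≤ orbitTangent F 0 w :=
  Submodule.map_mono (stabAlg_le ℓ)

/-- A linear choice of Lie algebra elements that produce given tangent vectors at `w`; linearity
makes the coordinates of `orbitChart` smooth. -/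
theorem exists_orbitTangent_section (F : (Model p q →L[ℝ] Model p q) → (V →L[ℝ] V))
    (ℓ : Model p q) (w : V) :
    ∃ σ : V →ₗ[ℝ] (Model p q →L[ℝ] Model p q), (∀ ξ, σ ξ ∈ stabAlg ℓ) ∧
      ∀ ξ ∈ orbitTangent F ℓ w, fderiv ℝ F 1 (σ ξ) w = ξ := by
  let g : stabAlg ℓ →ₗ[ℝ] V :=
    ((ContinuousLinearMap.apply ℝ V w).comp (fderiv ℝ F 1)).toLinearMap ∘ₗ (stabAlg ℓ).subtype
  obtain ⟨s, hs⟩ := g.rangeRestrict.exists_rightInverse_of_surjective g.range_rangeRestrict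
  obtain ⟨π, hπ, hπ'⟩ := exists_linear_projection g.range
  refine ⟨(stabAlg ℓ).subtype ∘ₗ s ∘ₗ π.codRestrict _ hπ, fun ξ => (s _).2, fun ξ hξ => ?_⟩
  have h1 : ξ ∈ g.range := by
    obtain ⟨X, hX, rfl⟩ := hξ
    exact ⟨⟨X, hX⟩, rfl⟩
  have h2 := congrArg Subtype.val (LinearMap.congr_fun hs (π.codRestrict _ hπ ξ))
  exact h2.trans (hπ' ξ h1)

variable (hF : ContDiff ℝ ∞ F)
  (hFm : ∀ a ∈ stab (0 : Model p q), ∀ b ∈ stab (0 : Model p q), F (a * b) = F a * F b)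

-- Right translation by `b = (a s)⁻¹` moves the curve to one through the identity, whose velocity
-- `a' * b` lies in the Lie algebra. The homomorphism property carries this back to the point `F (a
-- s) w`.
include hF hFm in
theorem mem_orbitTangent_of_hasDerivAt {ℓ : Model p q} {a : ℝ → Model p q →L[ℝ] Model p q}
    {a' : Model p q →L[ℝ] Model p q} {s : ℝ} (ha : HasDerivAt a a' s)
    (hmem : ∀ᶠ t in 𝓝 s, a t ∈ stab ℓ) {w d : V} (hd : HasDerivAt (fun t => F (a t) w) d s) :
    d ∈ orbitTangent F ℓ (F (a s) w) := by
  obtain ⟨b, hb, hab, hba⟩ := exists_inv_stab hmem.self_of_nhds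
  have hs : Filter.Tendsto (fun t : ℝ => t + s) (𝓝 0) (𝓝 s) := by
    have : ContinuousAt (fun t : ℝ => t + s) 0 := by fun_prop
    simpa [ContinuousAt] using this
  have h1 : HasDerivAt (fun t => a (t + s) * b) (a' * b) 0 := by
    have : HasDerivAt (fun t => a (t + s)) a' 0 := by
      refine HasDerivAt.comp_add_const 0 s ?_
      simpa using ha
    exact this.mul_const b
  have h2 : a' * b ∈ stabAlg ℓ := by
    refine mem_stabAlg_of_hasDerivAt h1 (by simpa using hab) ?_
    filter_upwards [hs.eventually hmem] with t ht using mul_mem_stab ht hb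
  have h3 : HasDerivAt (fun t => F (a (t + s) * b) (F (a s) w))
      (fderiv ℝ F 1 (a' * b) (F (a s) w)) 0 := by
    have h4 := hasDerivAt_clm_comp_apply hF h1 (F (a s) w)
    rwa [zero_add, hab] at h4
  have h5 : HasDerivAt (fun t => F (a (t + s)) w) d 0 := by
    refine HasDerivAt.comp_add_const (f := fun t => F (a t) w) 0 s ?_
    simpa using hd
  have h6 : (fun t => F (a (t + s)) w) =ᶠ[𝓝 0] fun t => F (a (t + s) * b) (F (a s) w) := by
    filter_upwards [hs.eventually hmem] with t ht
    have := hFm _ (stab_subset ℓ (mul_mem_stab ht hb)) _ (stab_subset ℓ hmem.self_of_nhds)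
    rw [mul_assoc, hba, mul_one] at this
    rw [this]; rfl
  exact ⟨_, h2, (h3.congr_of_eventuallyEq h6).unique h5⟩

theorem eventually_norm_smul_lt (X : Model p q →L[ℝ] Model p q) :
    ∀ᶠ s : ℝ in 𝓝 0, ‖s • X‖ < 1 := by
  have : ContinuousAt (fun s : ℝ => ‖s • X‖) 0 := by fun_prop
  exact this.eventually_lt continuousAt_const (by simp)

theorem hasDerivAt_cay_smul_zero (X : Model p q →L[ℝ] Model p q) :
    HasDerivAt (fun s : ℝ => cay (s • X)) X 0 := by
  have h1 : HasDerivAt (fun s : ℝ => s • X) X 0 := by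
    simpa using (hasDerivAt_id (0 : ℝ)).smul_const X
  have h2 : HasFDerivAt cay (ContinuousLinearMap.id ℝ (Model p q →L[ℝ] Model p q))
      ((0 : ℝ) • X) := by
    rw [zero_smul]; exact hasFDerivAt_cay_zero
  exact h2.comp_hasDerivAt (0 : ℝ) h1

-- Differentiating `cay (s • X) * a = a * (a⁻¹ * cay (s • X) * a)` at `s = 0` exchanges `X` at `a·v`
-- for the conjugate `a⁻¹ X a` at `v`.
include hF hFm in
theorem orbitTangent_apply_le {ℓ : Model p q} {a : Model p q →L[ℝ] Model p q} (ha : a ∈ stab ℓ)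
    (v : V) : orbitTangent F ℓ (F a v) ≤ (orbitTangent F ℓ v).map (F a).toLinearMap := by
  obtain ⟨b, hb, hab, hba⟩ := exists_inv_stab ha
  rintro d ⟨X, hX, rfl⟩
  have h0 := hasDerivAt_cay_smul_zero X
  have hev := eventually_norm_smul_lt X
  have hc : ∀ᶠ s : ℝ in 𝓝 0, cay (s • X) ∈ stab ℓ := by
    filter_upwards [hev] with s hs using cay_mem_stab hs (Submodule.smul_mem _ _ hX)
  have h1 : HasDerivAt (fun s : ℝ => b * cay (s • X) * a) (b * X * a) 0 :=
    (h0.const_mul b).mul_const a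
  have h2 : b * X * a ∈ stabAlg ℓ := by
    refine mem_stabAlg_of_hasDerivAt h1 (by simp [cay_zero, hba]) ?_
    filter_upwards [hc] with s hs using mul_mem_stab (mul_mem_stab hb hs) ha
  have hz : cay ((0 : ℝ) • X) = 1 := by rw [zero_smul, cay_zero]
  have h3 : HasDerivAt (fun s : ℝ => F (cay (s • X)) (F a v)) (fderiv ℝ F 1 X (F a v)) 0 := by
    have h4 := hasDerivAt_clm_comp_apply hF h0 (F a v)
    rwa [hz] at h4
  have h5 : HasDerivAt (fun s : ℝ => F a (F (b * cay (s • X) * a) v))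
      (F a (fderiv ℝ F 1 (b * X * a) v)) 0 := by
    have h4 := hasDerivAt_clm_comp_apply hF h1 v
    rw [hz, mul_one, hba] at h4
    exact (F a).hasFDerivAt.comp_hasDerivAt (0 : ℝ) h4
  refine ⟨fderiv ℝ F 1 (b * X * a) v, ⟨_, h2, rfl⟩, h5.unique (h3.congr_of_eventuallyEq ?_)⟩
  filter_upwards [hc] with s hs
  have hs0 := stab_subset ℓ hs
  have ha0 := stab_subset ℓ ha
  have hb0 := stab_subset ℓ hb
  change (F a * F (b * cay (s • X) * a)) v = (F (cay (s • X)) * F a) v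
  rw [← hFm _ ha0 _ (mul_mem_stab (mul_mem_stab hb0 hs0) ha0), ← hFm _ hs0 _ ha0, ← mul_assoc,
    ← mul_assoc, hab, one_mul]

include hF hFm in
theorem finrank_orbitTangent_le [FiniteDimensional ℝ V] {ℓ : Model p q}
    {a : Model p q →L[ℝ] Model p q} (ha : a ∈ stab ℓ) (v : V) :
    Module.finrank ℝ (orbitTangent F ℓ (F a v)) ≤ Module.finrank ℝ (orbitTangent F ℓ v) :=
  (Submodule.finrank_mono (orbitTangent_apply_le hF hFm ha v)).trans
    (Submodule.finrank_map_le _ _)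

end OrbitTangent

/-! ### Coordinates of `V` adapted to the `P`-orbit inside the `G`-orbit -/

section Slice

variable {p q : ℕ} {V : Type*} [NormedAddCommGroup V] [NormedSpace ℝ V]
  {F : (Model p q →L[ℝ] Model p q) → (V →L[ℝ] V)}

/-- A map adapted to the orbits of a representation near `v`: the components of `S`, `T`, `K` are
directions along the smaller orbit, along the larger orbit and transverse to both. -/
def orbitChart (F : (Model p q →L[ℝ] Model p q) → (V →L[ℝ] V)) (v : V)
    (S T : V →L[ℝ] (Model p q →L[ℝ] Model p q)) (K : V →L[ℝ] V) (ξ : V) : V :=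
  F (cay (S ξ)) (F (cay (T ξ)) (v + K ξ))

variable (hF : ContDiff ℝ ∞ F) (hF1 : F 1 = 1)
  (hFm : ∀ a ∈ stab (0 : Model p q), ∀ b ∈ stab (0 : Model p q), F (a * b) = F a * F b)
  {v : V} {S T : V →L[ℝ] (Model p q →L[ℝ] Model p q)} {K : V →L[ℝ] V}

include hF in
theorem contDiffAt_orbitChart {ξ : V} (hS : ‖S ξ‖ < 1) (hT : ‖T ξ‖ < 1) :
    ContDiffAt ℝ ∞ (orbitChart F v S T K) ξ := by
  have h1 : ContDiffAt ℝ ∞ (fun ξ => F (cay (S ξ))) ξ :=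
    hF.contDiffAt.comp ξ ((contDiffAt_cay hS).comp ξ S.contDiff.contDiffAt)
  have h2 : ContDiffAt ℝ ∞ (fun ξ => F (cay (T ξ))) ξ :=
    hF.contDiffAt.comp ξ ((contDiffAt_cay hT).comp ξ T.contDiff.contDiffAt)
  exact h1.clm_apply (h2.clm_apply (contDiffAt_const.add K.contDiff.contDiffAt))

include hF hF1 in
theorem hasFDerivAt_orbitChart_zero
    (h : ∀ ξ, fderiv ℝ F 1 (S ξ) v + fderiv ℝ F 1 (T ξ) v + K ξ = ξ) :
    HasFDerivAt (orbitChart F v S T K) (ContinuousLinearMap.id ℝ V) 0 := by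
  have hd : ∀ S : V →L[ℝ] (Model p q →L[ℝ] Model p q),
      HasFDerivAt (fun ξ => F (cay (S ξ))) ((fderiv ℝ F 1).comp S) 0 := by
    intro S
    have h1 : HasFDerivAt cay (ContinuousLinearMap.id ℝ (Model p q →L[ℝ] Model p q)) (S 0) := by
      rw [map_zero]; exact hasFDerivAt_cay_zero
    have h2 : HasFDerivAt F (fderiv ℝ F 1) (cay (S 0)) := by
      rw [map_zero, cay_zero]; exact (hF.differentiable (by simp) _).hasFDerivAt
    have h3 := h2.comp (0 : V) (h1.comp (0 : V) S.hasFDerivAt)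
    exact h3
  have h3 := (hd S).clm_apply ((hd T).clm_apply (K.hasFDerivAt.const_add v))
  refine h3.congr_fderiv ?_
  ext1 ξ
  simp only [map_zero, cay_zero, hF1, add_zero]
  have := h ξ
  simpa [add_comm, add_left_comm] using this

theorem eventually_norm_line_lt {X : V →L[ℝ] (Model p q →L[ℝ] Model p q)} {ξ : V} (a : V)
    (hX : ‖X ξ‖ < 1) : ∀ᶠ t : ℝ in 𝓝 0, ‖X (ξ + t • a)‖ < 1 := by
  have : ContinuousAt (fun t : ℝ => ‖X (ξ + t • a)‖) 0 := by fun_prop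
  exact this.eventually_lt continuousAt_const (by simpa using hX)

theorem hasDerivAt_line (ξ a : V) : HasDerivAt (fun t : ℝ => ξ + t • a) a 0 := by
  simpa using ((hasDerivAt_id (0 : ℝ)).smul_const a).const_add ξ

theorem differentiableAt_cay_line {X : V →L[ℝ] (Model p q →L[ℝ] Model p q)} {ξ : V} (a : V)
    (hX : ‖X ξ‖ < 1) : DifferentiableAt ℝ (fun t : ℝ => cay (X (ξ + t • a))) 0 := by
  have h1 : DifferentiableAt ℝ cay (X (ξ + (0 : ℝ) • a)) := by
    rw [zero_smul, add_zero]; exact (contDiffAt_cay hX).differentiableAt (by simp)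
  have h2 : DifferentiableAt ℝ (fun t : ℝ => X (ξ + t • a)) 0 := by fun_prop
  exact h1.comp (0 : ℝ) h2

include hF in
theorem hasDerivAt_orbitChart_line {ξ : V} (a : V) (hS : ‖S ξ‖ < 1) (hT : ‖T ξ‖ < 1) :
    HasDerivAt (fun t : ℝ => orbitChart F v S T K (ξ + t • a))
      (fderiv ℝ (orbitChart F v S T K) ξ a) 0 := by
  have h1 : HasFDerivAt (orbitChart F v S T K) (fderiv ℝ (orbitChart F v S T K) ξ)
      (ξ + (0 : ℝ) • a) := by
    rw [zero_smul, add_zero]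
    exact ((contDiffAt_orbitChart hF hS hT).differentiableAt (by simp)).hasFDerivAt
  exact h1.comp_hasDerivAt (0 : ℝ) (hasDerivAt_line ξ a)

-- When `K a = 0`, moving `ξ` along `a` changes only the two group elements, so the image curve
-- stays in one `G`-orbit.
include hF hFm in
theorem fderiv_orbitChart_mem (hSm : ∀ ξ, S ξ ∈ stabAlg 0) (hTm : ∀ ξ, T ξ ∈ stabAlg 0) {ξ a : V}
    (hS : ‖S ξ‖ < 1) (hT : ‖T ξ‖ < 1) (hK : K a = 0) :
    fderiv ℝ (orbitChart F v S T K) ξ a ∈ orbitTangent F 0 (orbitChart F v S T K ξ) := by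
  have h1 := hasDerivAt_orbitChart_line (v := v) (K := K) hF a hS hT
  have h2 := ((differentiableAt_cay_line a hS).mul (differentiableAt_cay_line a hT)).hasDerivAt
  have h3 : ∀ᶠ t : ℝ in 𝓝 0, cay (S (ξ + t • a)) ∈ stab 0 ∧ cay (T (ξ + t • a)) ∈ stab 0 := by
    filter_upwards [eventually_norm_line_lt a hS, eventually_norm_line_lt a hT] with t h1 h2
    exact ⟨cay_mem_stab h1 (hSm _), cay_mem_stab h2 (hTm _)⟩
  have h4 : ∀ t : ℝ, cay (S (ξ + t • a)) ∈ stab 0 ∧ cay (T (ξ + t • a)) ∈ stab 0 →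
      orbitChart F v S T K (ξ + t • a) =
        F (cay (S (ξ + t • a)) * cay (T (ξ + t • a))) (v + K ξ) := by
    intro t ht
    rw [hFm _ ht.1 _ ht.2, orbitChart, map_add K, map_smul K, hK, smul_zero, add_zero]
    rfl
  have h5 := mem_orbitTangent_of_hasDerivAt hF hFm h2
    (h3.mono fun t ht => mul_mem_stab ht.1 ht.2)
    (h1.congr_of_eventuallyEq (h3.mono fun t ht => (h4 t ht).symm))
  have h6 := h4 0 h3.self_of_nhds
  simp only [zero_smul, add_zero, Pi.mul_apply] at h5 h6
  rwa [h6]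

-- When also `T a = 0`, only the outermost group element varies, and it lies in the stabiliser of
-- the line. This is why the factor with `S` stands on the left in `orbitChart`.
include hF hFm in
theorem fderiv_orbitChart_mem_of_apply_eq_zero {ℓ : Model p q} (hSm : ∀ ξ, S ξ ∈ stabAlg ℓ)
    {ξ a : V} (hS : ‖S ξ‖ < 1) (hT : ‖T ξ‖ < 1) (hK : K a = 0) (hTa : T a = 0) :
    fderiv ℝ (orbitChart F v S T K) ξ a ∈ orbitTangent F ℓ (orbitChart F v S T K ξ) := by
  have h1 := hasDerivAt_orbitChart_line (v := v) (K := K) hF a hS hT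
  have h2 := (differentiableAt_cay_line a hS).hasDerivAt
  have h3 : ∀ᶠ t : ℝ in 𝓝 0, cay (S (ξ + t • a)) ∈ stab ℓ := by
    filter_upwards [eventually_norm_line_lt a hS] with t h1 using cay_mem_stab h1 (hSm _)
  have h4 : ∀ t : ℝ, orbitChart F v S T K (ξ + t • a) =
      F (cay (S (ξ + t • a))) (F (cay (T ξ)) (v + K ξ)) := by
    intro t
    rw [orbitChart, map_add K, map_add T, map_smul, map_smul, hK, hTa, smul_zero, add_zero,
      smul_zero, add_zero]
  have h5 := mem_orbitTangent_of_hasDerivAt hF hFm h2 h3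
    (h1.congr_of_eventuallyEq (Filter.Eventually.of_forall fun t => (h4 t).symm))
  simp only [zero_smul, add_zero] at h5
  exact h5

variable [FiniteDimensional ℝ V]

/-- With projections `ϖ` onto `T(G·v)` and `π` onto `T(P·v)`, the identity splits as `πϖ + (ϖ - πϖ)
+ (1 - ϖ)`. `S` and `T` lift the first two summands to the Lie algebra, `C` is the second summand
itself and `K` the third. -/
theorem exists_orbit_decomposition (F : (Model p q →L[ℝ] Model p q) → (V →L[ℝ] V)) (ℓ : Model p q)
    (v : V) : ∃ (S T : V →L[ℝ] (Model p q →L[ℝ] Model p q)) (C K : V →L[ℝ] V),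
      (∀ ξ, S ξ ∈ stabAlg ℓ) ∧ (∀ ξ, T ξ ∈ stabAlg 0) ∧
      (∀ ξ, fderiv ℝ F 1 (S ξ) v + fderiv ℝ F 1 (T ξ) v + K ξ = ξ) ∧
      (∀ ξ ∈ orbitTangent F 0 v, K ξ = 0) ∧
      (∀ ξ ∈ orbitTangent F ℓ v, C ξ = 0) ∧
      (∀ ξ, C ξ ∈ orbitTangent F 0 v) ∧ (∀ ξ, C (C ξ) = C ξ) ∧ (∀ ξ, C ξ = 0 → T ξ = 0) := by
  obtain ⟨σ, hσ, hσ'⟩ := exists_orbitTangent_section F ℓ v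
  obtain ⟨τ, hτ, hτ'⟩ := exists_orbitTangent_section F 0 v
  obtain ⟨π, hπ, hπ'⟩ := exists_linear_projection (orbitTangent F ℓ v)
  obtain ⟨ϖ, hϖ, hϖ'⟩ := exists_linear_projection (orbitTangent F 0 v)
  have hle := orbitTangent_le (F := F) ℓ v
  have hC : ∀ ξ, ϖ ξ - π (ϖ ξ) ∈ orbitTangent F 0 v := fun ξ =>
    Submodule.sub_mem _ (hϖ _) (hle (hπ _))
  refine ⟨(σ ∘ₗ π ∘ₗ ϖ).toContinuousLinearMap, (τ ∘ₗ (ϖ - π ∘ₗ ϖ)).toContinuousLinearMap,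
    (ϖ - π ∘ₗ ϖ).toContinuousLinearMap, (LinearMap.id - ϖ).toContinuousLinearMap,
    fun ξ => hσ _, fun ξ => hτ _, fun ξ => ?_, fun ξ hξ => ?_, fun ξ hξ => ?_, hC,
    fun ξ => ?_, fun ξ hξ => ?_⟩
  · have h1 := hσ' _ (hπ (ϖ ξ))
    have h2 := hτ' _ (hC ξ)
    simp only [LinearMap.coe_toContinuousLinearMap', LinearMap.comp_apply, LinearMap.sub_apply,
      LinearMap.id_apply]
    rw [h1, h2]; abel
  · simp [hϖ' ξ hξ]
  · simp [hϖ' ξ (hle hξ), hπ' ξ hξ]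
  · have h1 : ϖ (ϖ ξ - π (ϖ ξ)) = ϖ ξ - π (ϖ ξ) := hϖ' _ (hC ξ)
    have h2 : π (π (ϖ ξ)) = π (ϖ ξ) := hπ' _ (hπ _)
    simp only [LinearMap.coe_toContinuousLinearMap', LinearMap.comp_apply, LinearMap.sub_apply]
    rw [h1, map_sub, h2]; abel
  · have h1 : ϖ ξ - π (ϖ ξ) = 0 := hξ
    simp [h1]

-- On the orbit, `z` is constant along the paths `cay (t • X) * a`, hence locally constant as a
-- function of the group element. The group is a subset of a second countable space, so countably
-- many such neighbourhoods cover it.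
omit [FiniteDimensional ℝ V] in
include hF hFm in
theorem countable_image_orbit {ℓ : Model p q} {W : Set V} {z : V → V} (hW : IsOpen W)
    (hz : ContDiffOn ℝ ∞ z W) (h0 : ∀ a ∈ stab ℓ, F a v ∈ W → ∀ d ∈ orbitTangent F ℓ (F a v),
      fderiv ℝ z (F a v) d = 0) :
    {x | ∃ a ∈ stab ℓ, F a v ∈ W ∧ z (F a v) = x}.Countable := by
  have hFc : Continuous F := hF.continuous
  set s : Set (Model p q →L[ℝ] Model p q) := {a | a ∈ stab ℓ ∧ F a v ∈ W} with hs
  have hloc : ∀ a ∈ s, {b | b ∈ stab ℓ → z (F b v) = z (F a v)} ∈ 𝓝[s] a := by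
    rintro a ⟨ha, haW⟩
    obtain ⟨b, hb, hab, hba⟩ := exists_inv_stab ha
    have h1 : ∀ᶠ X in 𝓝 (0 : Model p q →L[ℝ] Model p q), F (cay X * a) v ∈ W := by
      have h2 : ContinuousAt (fun X : Model p q →L[ℝ] Model p q => F (cay X * a) v) 0 := by
        have : ContinuousAt (cay (A := Model p q →L[ℝ] Model p q)) 0 :=
          (contDiffAt_cay (by simp)).continuousAt
        exact (hFc.continuousAt.comp (this.mul continuousAt_const)).clm_apply continuousAt_const
      exact h2.eventually (hW.mem_nhds (by simpa [cay_zero] using haW))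
    -- This `r` keeps the whole path `F (cay (t • X) * a) v`, `0 ≤ t ≤ 1`, in `W` when `‖X‖ < r`.
    obtain ⟨r, hr, hrW⟩ := Metric.eventually_nhds_iff.1 h1
    have h2 : Filter.Tendsto (fun c => c * b) (𝓝 a) (𝓝 1) := by
      have : ContinuousAt (fun c => c * b) a := by fun_prop
      simpa [ContinuousAt, hab] using this
    refine nhdsWithin_le_nhds ?_
    filter_upwards [h2.eventually (eventually_exists_cay_eq ℓ (lt_min hr one_pos))] with c hc hcm
    obtain ⟨X, hX, hXr, hXc⟩ := hc (mul_mem_stab hcm hb)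
    have hca : c = cay X * a := by rw [hXc, mul_assoc, hba, mul_one]
    have hlt : ∀ t ∈ Icc (0 : ℝ) 1, ‖t • X‖ < min r 1 := by
      intro t ht
      rw [norm_smul, Real.norm_of_nonneg ht.1]
      exact (mul_le_of_le_one_left (norm_nonneg _) ht.2).trans_lt hXr
    have hmem : ∀ t ∈ Icc (0 : ℝ) 1, F (cay (t • X) * a) v ∈ W := fun t ht =>
      hrW (by simpa using (hlt t ht).trans_le (min_le_left _ _))
    have hd : ∀ t ∈ Icc (0 : ℝ) 1, HasDerivAt (fun t : ℝ => z (F (cay (t • X) * a) v)) 0 t := by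
      intro t ht
      have h3 : DifferentiableAt ℝ (fun t : ℝ => cay (t • X) * a) t := by
        refine DifferentiableAt.mul_const ?_ a
        have h4 : DifferentiableAt ℝ cay (t • X) :=
          (contDiffAt_cay ((hlt t ht).trans_le (min_le_right _ _))).differentiableAt (by simp)
        have h5 : DifferentiableAt ℝ (fun t : ℝ => t • X) t := by fun_prop
        exact h4.comp t h5
      have h4 := hasDerivAt_clm_comp_apply hF h3.hasDerivAt v
      have h5 : ∀ᶠ u in 𝓝 t, cay (u • X) * a ∈ stab ℓ := by
        have h6 : ContinuousAt (fun u : ℝ => ‖u • X‖) t := by fun_prop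
        filter_upwards [h6.eventually_lt continuousAt_const
          ((hlt t ht).trans_le (min_le_right _ _))] with u hu
        exact mul_mem_stab (cay_mem_stab hu (Submodule.smul_mem _ _ hX)) ha
      have h6 := mem_orbitTangent_of_hasDerivAt hF hFm h3.hasDerivAt h5 h4
      have h7 := h0 _ h5.self_of_nhds (hmem t ht) _ h6
      have h8 : HasFDerivAt z (fderiv ℝ z (F (cay (t • X) * a) v)) (F (cay (t • X) * a) v) :=
        ((hz.contDiffAt (hW.mem_nhds (hmem t ht))).differentiableAt (by simp)).hasFDerivAt
      have h9 := h8.comp_hasDerivAt t h4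
      rwa [h7] at h9
    have hconst := constant_of_has_deriv_right_zero
      (fun t ht => (hd t ht).continuousAt.continuousWithinAt)
      (fun t ht => (hd t (Ico_subset_Icc_self ht)).hasDerivWithinAt) 1 (right_mem_Icc.2 zero_le_one)
    simpa [cay_zero, ← hca] using hconst
  obtain ⟨t, hts, htc, hcov⟩ := TopologicalSpace.countable_cover_nhdsWithin hloc
  refine (htc.image fun a => z (F a v)).mono ?_
  rintro _ ⟨a, ha, haW, rfl⟩
  obtain ⟨b, hb, hab⟩ := mem_iUnion₂.1 (hcov ⟨ha, haW⟩)
  exact ⟨b, hb, (hab ha).symm⟩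

include hF hF1 hFm in
/-- The orbits through `v` of `O(p+1, q+1)` and of the stabiliser of the line spanned by `ℓ`, near
`v`, in terms of a function `y` transverse to the first and a function `z` that is
locally constant on the second. -/
theorem exists_orbit_slice (ℓ : Model p q) (v : V) :
    ∃ (C : V →L[ℝ] V) (W : Set V) (y z : V → V), IsOpen W ∧ v ∈ W ∧ ContDiffOn ℝ ∞ y W ∧
      ContDiffOn ℝ ∞ z W ∧ y v = 0 ∧ z v = 0 ∧ (∀ w ∈ W, C (z w) = z w) ∧
      HasFDerivAt z C v ∧ (∀ ξ ∈ orbitTangent F ℓ v, C ξ = 0) ∧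
      (∀ ξ, C ξ ∈ orbitTangent F 0 v) ∧ (∀ ξ, C (C ξ) = C ξ) ∧
      (∀ a ∈ stab (0 : Model p q), F a v ∈ W → ∀ d ∈ orbitTangent F 0 (F a v),
        fderiv ℝ y (F a v) d = 0) ∧
      {x | ∃ a ∈ stab ℓ, F a v ∈ W ∧ z (F a v) = x}.Countable ∧
      ∀ w ∈ W, y w = 0 → z w = 0 → ∃ a ∈ stab ℓ, F a v = w := by
  obtain ⟨S, T, C, K, hS, hT, hsum, hK, hC, hC0, hCC, hCT⟩ := exists_orbit_decomposition F ℓ v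
  set D : Set V := {ξ | ‖S ξ‖ < 1} ∩ {ξ | ‖T ξ‖ < 1} with hD
  have hDo : IsOpen D := (isOpen_lt (by fun_prop) (by fun_prop)).inter
    (isOpen_lt (by fun_prop) (by fun_prop))
  have h0D : (0 : V) ∈ D := by simp [hD]
  set Ψ := orbitChart F v S T K with hΨ
  have hΨD : ContDiffOn ℝ ∞ Ψ D := fun ξ hξ =>
    (contDiffAt_orbitChart hF hξ.1 hξ.2).contDiffWithinAt
  obtain ⟨h, h0, hsD, hh, hsymm⟩ := exists_smooth_openPartialHomeomorph hDo hΨD h0D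
    (ContinuousLinearEquiv.refl ℝ V) (hasFDerivAt_orbitChart_zero hF hF1 hsum)
  have hΨ0 : Ψ 0 = v := by simp [hΨ, orbitChart, cay_zero, hF1]
  have hv : v ∈ h.target := by rw [← hΨ0, ← hh]; exact h.map_source h0
  have hsv : h.symm v = 0 := by rw [← hΨ0, ← hh]; exact h.left_inv h0
  have hsd : ∀ w ∈ h.target, HasFDerivAt h.symm (fderiv ℝ h.symm w) w := fun w hw =>
    ((hsymm.contDiffAt (h.open_target.mem_nhds hw)).differentiableAt (by simp)).hasFDerivAt
  have hinv : ∀ w ∈ h.target, ∀ a, fderiv ℝ h.symm w (fderiv ℝ Ψ (h.symm w) a) = a := by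
    intro w hw a
    have hx := h.map_target hw
    have h1 : HasFDerivAt Ψ (fderiv ℝ Ψ (h.symm w)) (h.symm w) :=
      ((hΨD.contDiffAt (hDo.mem_nhds (hsD hx))).differentiableAt (by simp)).hasFDerivAt
    have h2 : HasFDerivAt h.symm (fderiv ℝ h.symm w) (Ψ (h.symm w)) := by
      rw [← hh, h.right_inv hw]; exact hsd w hw
    have h3 := h2.comp (h.symm w) h1
    have h4 : HasFDerivAt (h.symm ∘ Ψ) (ContinuousLinearMap.id ℝ V) (h.symm w) := by
      refine (hasFDerivAt_id _).congr_of_eventuallyEq ?_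
      filter_upwards [h.open_source.mem_nhds hx] with ξ hξ
      rw [Function.comp_apply, ← hh, h.left_inv hξ]; rfl
    exact DFunLike.congr_fun (h3.unique h4) a
  have hΨs : ∀ w ∈ h.target, Ψ (h.symm w) = w := fun w hw => by rw [← hh, h.right_inv hw]
  -- The derivative of the chart maps the fixed space `T_v` injectively into the tangent space of
  -- the orbit. At points of the orbit of `v` the latter has no larger dimension, so the map is
  -- onto, and the inverse chart sends orbit tangents back into `T_v`.
  have htan : ∀ (ℓ' : Model p q), (∀ w ∈ h.target, ∀ a ∈ orbitTangent F ℓ' v,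
      fderiv ℝ Ψ (h.symm w) a ∈ orbitTangent F ℓ' w) → ∀ a ∈ stab ℓ', F a v ∈ h.target →
      ∀ d ∈ orbitTangent F ℓ' (F a v), fderiv ℝ h.symm (F a v) d ∈ orbitTangent F ℓ' v := by
    intro ℓ' hmem a ha hw d hd
    have hle : (orbitTangent F ℓ' v).map (fderiv ℝ Ψ (h.symm (F a v))).toLinearMap ≤
        orbitTangent F ℓ' (F a v) := by
      rintro _ ⟨b, hb, rfl⟩
      exact hmem _ hw b hb
    have hinj : Function.Injective (fderiv ℝ Ψ (h.symm (F a v))).toLinearMap :=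
      Function.LeftInverse.injective (hinv _ hw)
    have heq := Submodule.eq_of_le_of_finrank_le hle (by
      rw [← LinearEquiv.finrank_eq (Submodule.equivMapOfInjective _ hinj _)]
      exact finrank_orbitTangent_le hF hFm ha v)
    rw [← heq] at hd
    obtain ⟨b, hb, rfl⟩ := hd
    exact (hinv _ hw b).symm ▸ hb
  have htan0 := htan 0 fun w hw a ha => by
    have h1 := hsD (h.map_target hw)
    have h2 := fderiv_orbitChart_mem (v := v) hF hFm (fun ξ => stabAlg_le ℓ (hS ξ)) hT h1.1 h1.2
      (hK a ha)
    rwa [← hΨ, hΨs w hw] at h2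
  have htanℓ := htan ℓ fun w hw a ha => by
    have h1 := hsD (h.map_target hw)
    have h2 := fderiv_orbitChart_mem_of_apply_eq_zero (v := v) hF hFm hS h1.1 h1.2
      (hK a (orbitTangent_le ℓ v ha)) (hCT a (hC a ha))
    rwa [← hΨ, hΨs w hw] at h2
  -- `y` and `z` are the `K`- and `C`-components of the inverse chart.
  refine ⟨C, h.target, fun w => K (h.symm w), fun w => C (h.symm w), h.open_target, hv,
    K.contDiff.comp_contDiffOn hsymm, C.contDiff.comp_contDiffOn hsymm, by simp [hsv],
    by simp [hsv], fun w hw => hCC _, ?_, hC, hC0, hCC, ?_, ?_, ?_⟩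
  · have h1 := C.hasFDerivAt.comp v (hsd v hv)
    refine h1.congr_fderiv ?_
    ext1 ξ
    have h2 := hinv v hv ξ
    rw [hsv, (hasFDerivAt_orbitChart_zero hF hF1 hsum).fderiv] at h2
    exact congrArg C h2
  · intro a ha hw d hd
    have h1 := K.hasFDerivAt.comp (F a v) (hsd _ hw)
    have h2 : fderiv ℝ (fun w => K (h.symm w)) (F a v) = _ := h1.fderiv
    rw [h2]
    exact hK _ (htan0 a ha hw d hd)
  · refine countable_image_orbit hF hFm h.open_target (C.contDiff.comp_contDiffOn hsymm) ?_
    intro a ha hw d hd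
    have h1 := C.hasFDerivAt.comp (F a v) (hsd _ hw)
    rw [h1.fderiv]
    exact hC _ (htanℓ a ha hw d hd)
  · intro w hw hy hz
    dsimp only at hy hz
    have h1 := hsD (h.map_target hw)
    refine ⟨_, cay_mem_stab h1.1 (hS _), ?_⟩
    have h2 := hΨs w hw
    simp only [hΨ, orbitChart] at h2
    -- With both transverse components zero, the chart reduces to `F (cay (S ξ)) v`.
    rw [hCT _ hz, hy, cay_zero, hF1, add_zero] at h2
    exact h2

end Slice

/-! ### Slice charts from a submersion with countably many relevant levels -/

section Submersions

/-- Concatenation of coordinate vectors. -/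
def appendCoords {n m k : ℕ} (h : m + k = n) :
    (Fin m → ℝ) × (Fin k → ℝ) →ₗ[ℝ] EuclideanSpace ℝ (Fin n) where
  toFun a := WithLp.toLp 2 fun i =>
    if hi : (i : ℕ) < m then a.1 ⟨i, hi⟩ else a.2 ⟨i - m, by omega⟩
  map_add' a b := by
    ext i; by_cases hi : (i : ℕ) < m <;> simp [hi]
  map_smul' r a := by
    ext i; by_cases hi : (i : ℕ) < m <;> simp [hi]

theorem appendCoords_eq_zero_iff {n m k : ℕ} (h : m + k = n) (a : Fin m → ℝ) (b : Fin k → ℝ) :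
    (∀ i : Fin n, m ≤ (i : ℕ) → appendCoords h (a, b) i = 0) ↔ b = 0 := by
  constructor
  · intro H
    funext j
    have := H ⟨m + j, by omega⟩ (by simp)
    simpa [appendCoords] using this
  · rintro rfl i hi
    simp [appendCoords, not_lt.2 hi]

theorem appendCoords_injective {n m k : ℕ} (h : m + k = n) :
    Function.Injective (appendCoords h) := by
  rw [injective_iff_map_eq_zero]
  rintro ⟨a, b⟩ hab
  have hb : b = 0 := (appendCoords_eq_zero_iff h a b).1 fun i _ => by rw [hab]; rfl
  have ha : a = 0 := by
    funext j
    have := congrArg (fun v : EuclideanSpace ℝ (Fin n) => v ⟨j, by omega⟩) hab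
    simpa [appendCoords] using this
  rw [ha, hb]; rfl

variable {V : Type*} [NormedAddCommGroup V] [NormedSpace ℝ V] [FiniteDimensional ℝ V] {n : ℕ}

/-- As `z` has values in the range of its derivative `Z`, it is a submersion onto that space at
`c₀`. Together with a projection onto the kernel of `Z` it gives a local chart, in which the zero
set is a coordinate subspace. -/
theorem exists_submersion_chart {z : EuclideanSpace ℝ (Fin n) → V}
    {D : Set (EuclideanSpace ℝ (Fin n))} (hD : IsOpen D) (hz : ContDiffOn ℝ ∞ z D)
    {c₀ : EuclideanSpace ℝ (Fin n)} (hc₀ : c₀ ∈ D) {Z : EuclideanSpace ℝ (Fin n) →L[ℝ] V}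
    (hZ : HasFDerivAt z Z c₀) (hz0 : z c₀ = 0) (hR : ∀ c ∈ D, z c ∈ Z.range) :
    ∃ (h : OpenPartialHomeomorph (EuclideanSpace ℝ (Fin n)) (EuclideanSpace ℝ (Fin n))) (r : ℝ),
      c₀ ∈ h.source ∧ h.source ⊆ D ∧ h c₀ = 0 ∧ h.target = Metric.ball 0 r ∧
      ContDiffOn ℝ ∞ h h.source ∧ ContDiffOn ℝ ∞ h.symm h.target ∧
      ∀ c ∈ h.source, z c = 0 ↔
        ∀ i : Fin n, n - Module.finrank ℝ Z.range ≤ (i : ℕ) → h c i = 0 := by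
  set k := Module.finrank ℝ Z.range with hk
  have hrank : k + Module.finrank ℝ Z.ker = n := by
    have := LinearMap.finrank_range_add_finrank_ker Z.toLinearMap
    rwa [finrank_euclideanSpace_fin] at this
  set m := n - k with hm
  have hmk : m + k = n := by omega
  have hker : Module.finrank ℝ Z.ker = Module.finrank ℝ (Fin m → ℝ) := by
    rw [Module.finrank_fin_fun]; omega
  let e₁ : Z.ker ≃ₗ[ℝ] (Fin m → ℝ) := LinearEquiv.ofFinrankEq _ _ hker
  let e₂ : Z.range ≃ₗ[ℝ] (Fin k → ℝ) := LinearEquiv.ofFinrankEq _ _ (by rw [Module.finrank_fin_fun])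
  obtain ⟨π, hπ⟩ := (Submodule.subtype Z.ker).exists_leftInverse_of_injective (by simp)
  obtain ⟨ϖ, hϖ⟩ := (Submodule.subtype Z.range).exists_leftInverse_of_injective (by simp)
  have hϖ0 : ∀ y ∈ Z.range, ϖ y = 0 → y = 0 := by
    intro y hy h0
    have : ϖ y = ⟨y, hy⟩ := LinearMap.congr_fun hϖ ⟨y, hy⟩
    rw [this] at h0
    exact congrArg Subtype.val h0
  let A : EuclideanSpace ℝ (Fin n) →L[ℝ] (Fin m → ℝ) := (e₁.toLinearMap ∘ₗ π).toContinuousLinearMap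
  let B : V →L[ℝ] (Fin k → ℝ) := (e₂.toLinearMap ∘ₗ ϖ).toContinuousLinearMap
  let J : (Fin m → ℝ) × (Fin k → ℝ) →L[ℝ] EuclideanSpace ℝ (Fin n) :=
    (appendCoords hmk).toContinuousLinearMap
  let φ : EuclideanSpace ℝ (Fin n) → EuclideanSpace ℝ (Fin n) := fun c => J (A (c - c₀), B (z c))
  let φ' : EuclideanSpace ℝ (Fin n) →L[ℝ] EuclideanSpace ℝ (Fin n) := J.comp (A.prod (B.comp Z))
  have hB0 : ∀ y ∈ Z.range, B y = 0 ↔ y = 0 := fun y hy =>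
    ⟨fun h => hϖ0 y hy (e₂.map_eq_zero_iff.1 h), fun h => by rw [h, map_zero]⟩
  -- `B` is injective on the range of `Z` and `A` on its kernel.
  have hinj : Function.Injective φ' := by
    rw [injective_iff_map_eq_zero]
    intro ξ hξ
    have h1 : (A ξ, B (Z ξ)) = 0 := (appendCoords_injective hmk) (hξ.trans (map_zero _).symm)
    have h2 : Z ξ = 0 := (hB0 _ ⟨ξ, rfl⟩).1 (congrArg Prod.snd h1)
    have h3 : π ξ = 0 := e₁.map_eq_zero_iff.1 (congrArg Prod.fst h1)
    have h4 : π ξ = ⟨ξ, h2⟩ := LinearMap.congr_fun hπ ⟨ξ, h2⟩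
    rw [h4] at h3
    exact congrArg Subtype.val h3
  let L : EuclideanSpace ℝ (Fin n) ≃L[ℝ] EuclideanSpace ℝ (Fin n) :=
    (LinearEquiv.ofInjectiveEndo φ'.toLinearMap hinj).toContinuousLinearEquiv
  have hφd : HasFDerivAt φ (L : EuclideanSpace ℝ (Fin n) →L[ℝ] EuclideanSpace ℝ (Fin n)) c₀ := by
    have hL : (L : EuclideanSpace ℝ (Fin n) →L[ℝ] EuclideanSpace ℝ (Fin n)) = φ' := by
      ext1 ξ; rfl
    rw [hL]
    have h1 : HasFDerivAt (fun c => A (c - c₀)) A c₀ := 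
      A.hasFDerivAt.comp c₀ ((hasFDerivAt_id c₀).sub_const c₀)
    exact J.hasFDerivAt.comp c₀ (h1.prodMk (B.hasFDerivAt.comp c₀ hZ))
  have hφs : ContDiffOn ℝ ∞ φ D :=
    J.contDiff.comp_contDiffOn ((A.contDiff.comp (contDiff_id.sub contDiff_const)).contDiffOn.prodMk
      (B.contDiff.comp_contDiffOn hz))
  obtain ⟨h, h1, h2, h3, h4⟩ := exists_smooth_openPartialHomeomorph hD hφs hc₀ L hφd
  have hφ0 : h c₀ = 0 := by
    rw [h3]; simp only [φ, sub_self, map_zero, hz0]; exact map_zero J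
  -- The target is shrunk to a ball so that it contains the radial segments of its points.
  obtain ⟨r, hr, hball⟩ := Metric.isOpen_iff.1 h.open_target 0 (hφ0 ▸ h.map_source h1)
  let h' := (h.symm.restrOpen (Metric.ball 0 r) Metric.isOpen_ball).symm
  have ht : h'.target = Metric.ball 0 r := inter_eq_right.2 hball
  have hs : h'.source ⊆ h.source := fun c hc => by
    have := h'.map_source hc
    rw [ht] at this
    have h5 := h.map_target (hball this)
    rwa [show h.symm (h' c) = c from h'.left_inv hc] at h5
  have hh' : (h' : EuclideanSpace ℝ (Fin n) → EuclideanSpace ℝ (Fin n)) = φ := h3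
  refine ⟨h', r, ?_, hs.trans h2, hφ0, ht, ?_, ?_, ?_⟩
  · have h5 : (0 : EuclideanSpace ℝ (Fin n)) ∈ h'.target := by rw [ht]; simpa using hr
    have h6 := h'.map_target h5
    have h7 : h'.symm 0 = c₀ := by
      change h.symm 0 = c₀
      rw [← hφ0]; exact h.left_inv h1
    rwa [h7] at h6
  · rw [hh']; exact hφs.mono (hs.trans h2)
  · exact h4.mono (by rw [ht]; exact hball)
  · intro c hc
    rw [← hB0 _ (hR c (h2 (hs hc))), hh']
    exact (appendCoords_eq_zero_iff hmk _ _).symm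

theorem eq_of_continuousOn_of_countable {V : Type*} [NormedAddCommGroup V] {γ : ℝ → V}
    (hγ : ContinuousOn γ (Icc 0 1)) {S : Set V} (hS : S.Countable) (hm : MapsTo γ (Icc 0 1) S)
    {t : ℝ} (ht : t ∈ Icc (0 : ℝ) 1) : γ t = γ 0 := by
  have h1 : IsPreconnected (γ '' Icc 0 1) := isPreconnected_Icc.image _ hγ
  exact hS.isTotallyDisconnected _ (image_subset_iff.2 hm) h1 ⟨t, ht, rfl⟩
    ⟨0, left_mem_Icc.2 zero_le_one, rfl⟩

/-- Along a curve in `N` from `x` the function `z` is continuous with values in a countable set,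
hence zero throughout. Conversely, a point of the coordinate slice is reached by the radial segment,
on which `z = 0` and which therefore lies in `N`. -/
theorem exists_slice_chart {M : Type*} [TopologicalSpace M]
    [ChartedSpace (EuclideanSpace ℝ (Fin n)) M] [IsManifold (𝓡 n) ∞ M] {N : Set M} {x : M}
    {ch : OpenPartialHomeomorph M (EuclideanSpace ℝ (Fin n))}
    (hch : ch ∈ IsManifold.maximalAtlas (𝓡 n) ∞ M) (hx : x ∈ ch.source)
    {z : EuclideanSpace ℝ (Fin n) → V} {D : Set (EuclideanSpace ℝ (Fin n))} (hD : IsOpen D)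
    (hDt : D ⊆ ch.target) (hxD : ch x ∈ D) (hz : ContDiffOn ℝ ∞ z D)
    {Z : EuclideanSpace ℝ (Fin n) →L[ℝ] V} (hZ : HasFDerivAt z Z (ch x)) (hz0 : z (ch x) = 0)
    (hR : ∀ c ∈ D, z c ∈ Z.range)
    (hcount : {y | ∃ c ∈ D, ch.symm c ∈ N ∧ z c = y}.Countable)
    (hN : ∀ c ∈ D, z c = 0 → ch.symm c ∈ N) :
    ∃ e ∈ IsManifold.maximalAtlas (𝓡 n) ∞ M, x ∈ e.source ∧ e x = 0 ∧
      e '' smoothPathComponent n x (e.source ∩ N) = e.target ∩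
        {v : EuclideanSpace ℝ (Fin n) |
          ∀ i : Fin n, n - Module.finrank ℝ Z.range ≤ (i : ℕ) → v i = 0} := by
  obtain ⟨h, r, hc₀, hsD, hh0, ht, hsm, hsm', hzero⟩ :=
    exists_submersion_chart hD hz hxD hZ hz0 hR
  let e := ch.trans h
  have hes : ∀ y, y ∈ e.source ↔ y ∈ ch.source ∧ ch y ∈ h.source := fun y => by
    simp [e]
  have het : e.target = Metric.ball 0 r := by
    rw [← ht]
    ext c
    simp only [e, OpenPartialHomeomorph.trans_target, mem_inter_iff, mem_preimage,
      and_iff_left_iff_imp]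
    exact fun hc => hDt (hsD (h.map_target hc))
  have hea : ∀ y, e y = h (ch y) := fun y => rfl
  have hesy : ∀ c, e.symm c = ch.symm (h.symm c) := fun c => rfl
  have hchs := contMDiffOn_of_mem_maximalAtlas hch
  have hchs' := contMDiffOn_symm_of_mem_maximalAtlas hch
  have he1 : ContMDiffOn (𝓡 n) (𝓡 n) ∞ e e.source :=
    hsm.contMDiffOn.comp (hchs.mono fun y hy => ((hes y).1 hy).1) fun y hy => ((hes y).1 hy).2
  have he2 : ContMDiffOn (𝓡 n) (𝓡 n) ∞ e.symm e.target :=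
    hchs'.comp (hsm'.contMDiffOn.mono (by rw [het, ht]))
      fun c hc => hDt (hsD (h.map_target (by rwa [ht, ← het])))
  have hzs : ∀ y ∈ e.source, z (ch y) = 0 ↔
      ∀ i : Fin n, n - Module.finrank ℝ Z.range ≤ (i : ℕ) → e y i = 0 := fun y hy =>
    hzero _ ((hes y).1 hy).2
  have hxe : x ∈ e.source := (hes x).2 ⟨hx, hc₀⟩
  refine ⟨e, e.mem_maximalAtlas_of_contMDiffOn he1 he2, hxe, hh0, ?_⟩
  apply Subset.antisymm
  · rintro _ ⟨y, ⟨γ, hγ, hγN, hγ0, hγ1⟩, rfl⟩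
    have h01 : (1 : ℝ) ∈ Icc (0 : ℝ) 1 := right_mem_Icc.2 zero_le_one
    have hy : y ∈ e.source := hγ1 ▸ (hγN h01).1
    refine ⟨e.map_source hy, (hzs y hy).1 ?_⟩
    have h1 : ContinuousOn (fun t => z (ch (γ t))) (Icc 0 1) := by
      refine hz.continuousOn.comp (ch.continuousOn.comp hγ.continuousOn ?_) ?_
      · exact fun t ht => ((hes _).1 (hγN ht).1).1
      · exact fun t ht => hsD ((hes _).1 (hγN ht).1).2
    have h2 := eq_of_continuousOn_of_countable h1 hcount (fun t ht => ?_) h01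
    · simpa only [hγ0, hγ1, hz0] using h2
    · have h3 := (hes _).1 (hγN ht).1
      exact ⟨_, hsD h3.2, by rw [ch.left_inv h3.1]; exact (hγN ht).2, rfl⟩
  · rintro c ⟨hc, hc0⟩
    have hball : ∀ t ∈ Icc (0 : ℝ) 1, t • c ∈ e.target := by
      intro t ht'
      rw [het, mem_ball_zero_iff] at hc ⊢
      rw [norm_smul, Real.norm_of_nonneg ht'.1]
      exact (mul_le_of_le_one_left (norm_nonneg _) ht'.2).trans_lt hc
    refine ⟨e.symm c, ⟨fun t => e.symm (t • c), ?_, fun t ht' => ?_, ?_, ?_⟩, e.right_inv hc⟩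
    · exact he2.comp (t := e.target) (contMDiffOn_iff_contDiffOn.2 (by fun_prop)) hball
    · have h1 := e.map_target (hball t ht')
      refine ⟨h1, ?_⟩
      have h2 := (hzs _ h1).2 fun i hi => by
        rw [e.right_inv (hball t ht')]
        simp [hc0 i hi]
      have h3 := (hes _).1 h1
      have h4 := hN _ (hsD h3.2) h2
      rwa [ch.left_inv h3.1] at h4
    · simp only [zero_smul]
      have h1 : e x = 0 := hh0
      rw [← h1]
      exact e.left_inv hxe
    · simp only [one_smul]

end Submersions

/-! ### Levi-Civita connection and symmetry of the Ricci tensor in coordinates -/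

section CoordinateGeometry

variable {n : ℕ}

/-- `G` is the matrix of a smooth semi-Riemannian metric on an open subset of `ℝⁿ`. -/
structure IsMetricOn (G : EuclideanSpace ℝ (Fin n) → Matrix (Fin n) (Fin n) ℝ)
    (O : Set (EuclideanSpace ℝ (Fin n))) : Prop where
  isOpen : IsOpen O
  smooth : ∀ i j, ContDiffOn ℝ ∞ (fun y => G y i j) O
  symm : ∀ y ∈ O, ∀ i j, G y i j = G y j i
  det_ne_zero : ∀ y ∈ O, (G y).det ≠ 0

section PartialDerivatives

variable {O : Set (EuclideanSpace ℝ (Fin n))} {f h : EuclideanSpace ℝ (Fin n) → ℝ}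
  {y : EuclideanSpace ℝ (Fin n)}

theorem contDiffOn_pd (hO : IsOpen O) (hf : ContDiffOn ℝ ∞ f O) (i : Fin n) :
    ContDiffOn ℝ ∞ (pd i f) O :=
  (hf.fderiv_of_isOpen hO (by simp)).clm_apply contDiffOn_const

theorem differentiableAt_of_contDiffOn (hO : IsOpen O) (hf : ContDiffOn ℝ ∞ f O) (hy : y ∈ O) :
    DifferentiableAt ℝ f y :=
  (hf.contDiffAt (hO.mem_nhds hy)).differentiableAt (by simp)

theorem pd_congr (hO : IsOpen O) (hfh : ∀ z ∈ O, f z = h z) (hy : y ∈ O) (i : Fin n) :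
    pd i f y = pd i h y := by
  have : f =ᶠ[𝓝 y] h := Filter.eventually_of_mem (hO.mem_nhds hy) hfh
  rw [pd, pd, this.fderiv_eq]

theorem pd_const_mul (hf : DifferentiableAt ℝ f y) (r : ℝ) (i : Fin n) :
    pd i (fun z => r * f z) y = r * pd i f y := by
  rw [pd, fderiv_const_mul hf]; rfl

theorem pd_mul (hf : DifferentiableAt ℝ f y) (hh : DifferentiableAt ℝ h y) (i : Fin n) :
    pd i (fun z => f z * h z) y = pd i f y * h y + f y * pd i h y := by
  rw [pd, fderiv_fun_mul hf hh]
  simp [pd]; ring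

theorem pd_const (r : ℝ) (i : Fin n) : pd i (fun _ => r) y = 0 := by
  simp [pd]

theorem pd_sum {ι : Type*} (s : Finset ι) {f : ι → EuclideanSpace ℝ (Fin n) → ℝ}
    (hf : ∀ a ∈ s, DifferentiableAt ℝ (f a) y) (i : Fin n) :
    pd i (fun z => ∑ a ∈ s, f a z) y = ∑ a ∈ s, pd i (f a) y := by
  rw [pd, fderiv_fun_sum hf]; simp [pd]

theorem pd_comm (hO : IsOpen O) (hf : ContDiffOn ℝ ∞ f O) (hy : y ∈ O) (i j : Fin n) :
    pd i (pd j f) y = pd j (pd i f) y := by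
  have h1 : ContDiffAt ℝ ∞ f y := hf.contDiffAt (hO.mem_nhds hy)
  have h2 : DifferentiableAt ℝ (fderiv ℝ f) y :=
    ((hf.fderiv_of_isOpen hO (m := ∞) (by simp)).contDiffAt (hO.mem_nhds hy)).differentiableAt
      (by simp)
  have h3 : ∀ i j, pd i (pd j f) y = fderiv ℝ (fderiv ℝ f) y (EuclideanSpace.single i 1)
      (EuclideanSpace.single j 1) := by
    intro i j
    have h4 : HasFDerivAt (pd j f) _ y :=
      h2.hasFDerivAt.clm_apply (hasFDerivAt_const (EuclideanSpace.single j (1 : ℝ)) y)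
    rw [pd, h4.fderiv]
    simp
  rw [h3, h3]
  exact (h1.isSymmSndFDerivAt (by
    rw [minSmoothness_of_isRCLikeNormedField]; exact WithTop.coe_le_coe.2 le_top)).eq _ _

end PartialDerivatives

variable {G : EuclideanSpace ℝ (Fin n) → Matrix (Fin n) (Fin n) ℝ}
  {O : Set (EuclideanSpace ℝ (Fin n))} (hG : IsMetricOn G O) {y : EuclideanSpace ℝ (Fin n)}

include hG

theorem IsMetricOn.isUnit_det (hy : y ∈ O) : IsUnit (G y).det :=
  isUnit_iff_ne_zero.2 (hG.det_ne_zero y hy)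

omit hG in
theorem contDiffOn_matrix_det {m : ℕ} {A : EuclideanSpace ℝ (Fin n) → Matrix (Fin m) (Fin m) ℝ}
    (hA : ∀ i j, ContDiffOn ℝ ∞ (fun y => A y i j) O) :
    ContDiffOn ℝ ∞ (fun y => (A y).det) O := by
  simp only [Matrix.det_apply']
  exact ContDiffOn.sum fun σ _ => contDiffOn_const.mul (contDiffOn_prod fun i _ => hA _ _)

theorem IsMetricOn.contDiffOn_inv (i j : Fin n) : ContDiffOn ℝ ∞ (fun y => (G y)⁻¹ i j) O := by
  have h1 : ContDiffOn ℝ ∞ (fun y => (G y).adjugate i j) O := by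
    simp only [Matrix.adjugate_apply]
    refine contDiffOn_matrix_det fun a b => ?_
    by_cases ha : a = j
    · subst ha; simp only [Matrix.updateRow_self]; exact contDiffOn_const
    · simp only [Matrix.updateRow_ne ha]; exact hG.smooth a b
  have h2 := ((contDiffOn_matrix_det hG.smooth).inv hG.det_ne_zero).mul h1
  refine h2.congr fun y hy => ?_
  simp [Matrix.inv_def]

theorem IsMetricOn.contDiffOn_christoffel (k i j : Fin n) :
    ContDiffOn ℝ ∞ (christoffel G k i j) O := by
  refine contDiffOn_const.mul (ContDiffOn.sum fun l _ => (hG.contDiffOn_inv k l).mul ?_)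
  exact ((contDiffOn_pd hG.isOpen (hG.smooth _ _) _).add
    (contDiffOn_pd hG.isOpen (hG.smooth _ _) _)).sub (contDiffOn_pd hG.isOpen (hG.smooth _ _) _)

theorem IsMetricOn.contDiffOn_riemann (l k i j : Fin n) :
    ContDiffOn ℝ ∞ (riemann G l k i j) O := by
  refine ((contDiffOn_pd hG.isOpen (hG.contDiffOn_christoffel _ _ _) _).sub
    (contDiffOn_pd hG.isOpen (hG.contDiffOn_christoffel _ _ _) _)).add
    (ContDiffOn.sum fun m _ => ?_)
  exact ((hG.contDiffOn_christoffel _ _ _).mul (hG.contDiffOn_christoffel _ _ _)).sub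
    ((hG.contDiffOn_christoffel _ _ _).mul (hG.contDiffOn_christoffel _ _ _))

theorem IsMetricOn.contDiffOn_ricci (j k : Fin n) : ContDiffOn ℝ ∞ (ricci G j k) O :=
  ContDiffOn.sum fun _ _ => hG.contDiffOn_riemann _ _ _ _

theorem IsMetricOn.contDiffOn_schouten (i j : Fin n) : ContDiffOn ℝ ∞ (schouten G i j) O := by
  have h : ContDiffOn ℝ ∞ (scal G) O := ContDiffOn.sum fun i _ => ContDiffOn.sum fun j _ =>
    (hG.contDiffOn_inv i j).mul (hG.contDiffOn_ricci i j)
  exact contDiffOn_const.mul ((hG.contDiffOn_ricci i j).sub ((h.div_const _).mul (hG.smooth i j)))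

theorem IsMetricOn.pd_symm (hy : y ∈ O) (k i j : Fin n) :
    pd k (fun z => G z i j) y = pd k (fun z => G z j i) y :=
  pd_congr hG.isOpen (fun z hz => hG.symm z hz i j) hy k

theorem IsMetricOn.inv_symm (hy : y ∈ O) (i j : Fin n) : (G y)⁻¹ i j = (G y)⁻¹ j i := by
  have h : (G y).transpose = G y := by ext i j; exact hG.symm y hy j i
  have h2 : ((G y)⁻¹).transpose = (G y)⁻¹ := by rw [Matrix.transpose_nonsing_inv, h]
  exact congrFun (congrFun h2 j) i

theorem IsMetricOn.christoffel_symm (hy : y ∈ O) (k i j : Fin n) :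
    christoffel G k i j y = christoffel G k j i y := by
  unfold christoffel
  congr 1
  refine Finset.sum_congr rfl fun l _ => ?_
  rw [hG.pd_symm hy l i j]
  ring

theorem IsMetricOn.sum_mul_christoffel (hy : y ∈ O) (k i j : Fin n) :
    ∑ l, G y k l * christoffel G l i j y = (1 / 2 : ℝ) *
      (pd i (fun z => G z j k) y + pd j (fun z => G z i k) y - pd k (fun z => G z i j) y) := by
  have h1 : ∀ a : Fin n → ℝ, ∑ l, G y k l * ((1 / 2 : ℝ) * ∑ m, (G y)⁻¹ l m * a m) =
      (1 / 2 : ℝ) * a k := by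
    intro a
    have h2 : (G y).mulVec ((G y)⁻¹.mulVec a) = a := by
      rw [Matrix.mulVec_mulVec, Matrix.mul_nonsing_inv _ (hG.isUnit_det hy), Matrix.one_mulVec]
    have h3 := congrFun h2 k
    simp only [Matrix.mulVec, dotProduct] at h3
    rw [← h3, Finset.mul_sum]
    exact Finset.sum_congr rfl fun l _ => by ring
  exact h1 fun m => pd i (fun z => G z j m) y + pd j (fun z => G z i m) y - pd m (fun z => G z i j) y

/-- This is `∇g = 0` in coordinates. -/
theorem IsMetricOn.pd_eq (hy : y ∈ O) (i j k : Fin n) :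
    pd i (fun z => G z j k) y = ∑ l, G y k l * christoffel G l i j y +
      ∑ l, G y j l * christoffel G l i k y := by
  rw [hG.sum_mul_christoffel hy, hG.sum_mul_christoffel hy, hG.pd_symm hy i k j]
  ring

/-- In the contraction the other two derivative terms cancel by the symmetry of the inverse metric;
what remains is half the logarithmic derivative of the determinant. -/
theorem IsMetricOn.sum_christoffel (hy : y ∈ O) (k : Fin n) :
    ∑ i, christoffel G i i k y =
      (1 / 2 : ℝ) * ∑ i, ∑ l, (G y)⁻¹ i l * pd k (fun z => G z i l) y := by
  simp only [christoffel, ← Finset.mul_sum]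
  congr 1
  have h1 : ∑ i, ∑ l, (G y)⁻¹ i l * pd i (fun z => G z k l) y =
      ∑ i, ∑ l, (G y)⁻¹ i l * pd l (fun z => G z i k) y := by
    rw [Finset.sum_comm]
    refine Finset.sum_congr rfl fun i _ => Finset.sum_congr rfl fun l _ => ?_
    rw [hG.inv_symm hy l i, hG.pd_symm hy l k i]
  simp only [mul_sub, mul_add, Finset.sum_sub_distrib, Finset.sum_add_distrib]
  rw [h1]; ring

/-- Differentiate `G⁻¹ G = 1`. -/
theorem IsMetricOn.pd_inv (hy : y ∈ O) (i : Fin n) :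
    (Matrix.of fun a b => pd i (fun z => (G z)⁻¹ a b) y) =
      -((G y)⁻¹ * (Matrix.of fun a b => pd i (fun z => G z a b) y) * (G y)⁻¹) := by
  set dG := Matrix.of fun a b => pd i (fun z => G z a b) y with hdG
  set dGi := Matrix.of fun a b => pd i (fun z => (G z)⁻¹ a b) y with hdGi
  have h1 : dGi * G y + (G y)⁻¹ * dG = 0 := by
    ext a c
    have h2 : ∀ b, DifferentiableAt ℝ (fun z => (G z)⁻¹ a b) y := fun b =>
      differentiableAt_of_contDiffOn hG.isOpen (hG.contDiffOn_inv a b) hy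
    have h3 : ∀ b, DifferentiableAt ℝ (fun z => G z b c) y := fun b =>
      differentiableAt_of_contDiffOn hG.isOpen (hG.smooth b c) hy
    have h4 : pd i (fun z => ∑ b, (G z)⁻¹ a b * G z b c) y =
        ∑ b, (pd i (fun z => (G z)⁻¹ a b) y * G y b c + (G y)⁻¹ a b * pd i (fun z => G z b c) y) := by
      rw [pd_sum _ fun b _ => (h2 b).fun_mul (h3 b)]
      exact Finset.sum_congr rfl fun b _ => pd_mul (h2 b) (h3 b) i
    have h5 : pd i (fun z => ∑ b, (G z)⁻¹ a b * G z b c) y = 0 := by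
      rw [pd_congr (h := fun _ => (1 : Matrix (Fin n) (Fin n) ℝ) a c) hG.isOpen ?_ hy, pd_const]
      intro z hz
      rw [← Matrix.nonsing_inv_mul _ (hG.isUnit_det hz), Matrix.mul_apply]
    rw [h5] at h4
    rw [Matrix.add_apply, Matrix.mul_apply, Matrix.mul_apply, ← Finset.sum_add_distrib]
    exact h4.symm
  have h2 := congrArg (· * (G y)⁻¹) (eq_neg_of_add_eq_zero_left h1)
  simpa only [Matrix.mul_nonsing_inv_cancel_right _ _ (hG.isUnit_det hy), Matrix.neg_mul] using h2

/-- The contracted Christoffel symbols form the exact form `d log |det g|^{1/2}`, hence a closed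
one. In the computation the first-order part is symmetric by cyclicity of the trace, the
second-order part because partial derivatives commute. -/
theorem IsMetricOn.pd_sum_christoffel_comm (hy : y ∈ O) (j k : Fin n) :
    ∑ i, pd j (christoffel G i i k) y = ∑ i, pd k (christoffel G i i j) y := by
  set D : Fin n → Matrix (Fin n) (Fin n) ℝ := fun i =>
    Matrix.of fun a b => pd i (fun z => G z a b) y with hD
  have h1 : ∀ j k, ∑ i, pd j (christoffel G i i k) y = (1 / 2 : ℝ) *
      (-((G y)⁻¹ * D j * (G y)⁻¹ * D k).trace +
        ∑ i, ∑ l, (G y)⁻¹ i l * pd j (pd k (fun z => G z i l)) y) := by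
    intro j k
    have d1 : ∀ i l, DifferentiableAt ℝ (fun z => (G z)⁻¹ i l) y := fun i l =>
      differentiableAt_of_contDiffOn hG.isOpen (hG.contDiffOn_inv i l) hy
    have d2 : ∀ i l, DifferentiableAt ℝ (pd k (fun z => G z i l)) y := fun i l =>
      differentiableAt_of_contDiffOn hG.isOpen (contDiffOn_pd hG.isOpen (hG.smooth i l) k) hy
    rw [← pd_sum _ fun i _ =>
        differentiableAt_of_contDiffOn hG.isOpen (hG.contDiffOn_christoffel i i k) hy,
      pd_congr hG.isOpen (fun z hz => hG.sum_christoffel hz k) hy,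
      pd_const_mul (DifferentiableAt.fun_sum fun i _ => DifferentiableAt.fun_sum fun l _ =>
        (d1 i l).fun_mul (d2 i l)),
      pd_sum _ fun i _ => DifferentiableAt.fun_sum fun l _ => (d1 i l).fun_mul (d2 i l)]
    congr 1
    have h2 : ∀ i, pd j (fun z => ∑ l, (G z)⁻¹ i l * pd k (fun z => G z i l) z) y =
        ∑ l, (pd j (fun z => (G z)⁻¹ i l) y * D k l i +
          (G y)⁻¹ i l * pd j (pd k (fun z => G z i l)) y) := by
      intro i
      rw [pd_sum _ fun l _ => (d1 i l).fun_mul (d2 i l)]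
      refine Finset.sum_congr rfl fun l _ => ?_
      rw [pd_mul (d1 i l) (d2 i l), hG.pd_symm hy k i l]; rfl
    have h3 := hG.pd_inv hy j
    simp only [h2, Finset.sum_add_distrib]
    congr 1
    rw [← Matrix.trace_neg, ← Matrix.neg_mul, ← h3, Matrix.trace]
    exact Finset.sum_congr rfl fun i _ => by rw [Matrix.diag_apply, Matrix.mul_apply]; rfl
  rw [h1, h1]
  congr 2
  · rw [Matrix.mul_assoc, Matrix.trace_mul_comm, ← Matrix.mul_assoc]
  · refine Finset.sum_congr rfl fun i _ => Finset.sum_congr rfl fun l _ => ?_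
    rw [pd_comm hG.isOpen (hG.smooth i l) hy]

/-- Apart from the term `∂_j Γ^i_{ik}`, symmetry is visible from that of the Christoffel symbols. It
is needed because the tractor connection preserves the tractor metric only for a symmetric Schouten
tensor. -/
theorem IsMetricOn.ricci_symm (hy : y ∈ O) (j k : Fin n) : ricci G j k y = ricci G k j y := by
  have h1 : ∀ j k, ricci G j k y = ∑ i, pd i (christoffel G i j k) y -
      ∑ i, pd j (christoffel G i i k) y +
      (∑ i, ∑ m, christoffel G i i m y * christoffel G m j k y -
        ∑ i, ∑ m, christoffel G i j m y * christoffel G m i k y) := by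
    intro j k
    simp only [ricci, riemann, Finset.sum_sub_distrib, Finset.sum_add_distrib]
  rw [h1, h1, hG.pd_sum_christoffel_comm hy j k]
  congr 2
  · exact Finset.sum_congr rfl fun i _ =>
      pd_congr hG.isOpen (fun z hz => hG.christoffel_symm hz i j k) hy i
  · simp only [hG.christoffel_symm hy _ j k]
  · rw [Finset.sum_comm]
    refine Finset.sum_congr rfl fun i _ => Finset.sum_congr rfl fun m _ => ?_
    rw [hG.christoffel_symm hy m j i, hG.christoffel_symm hy i m k]
    ring

theorem IsMetricOn.schouten_symm (hy : y ∈ O) (i j : Fin n) :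
    schouten G i j y = schouten G j i y := by
  rw [schouten, schouten, hG.ricci_symm hy i j, hG.symm y hy i j]

end CoordinateGeometry

/-! ### Linear differential equations and transport along short segments -/

section LinearODE

theorem eventually_norm_sub_lt {E F : Type*} [TopologicalSpace E] [SeminormedAddCommGroup F]
    {f : E → F} {c : E} (hf : ContinuousAt f c) {ε : ℝ} (hε : 0 < ε) :
    ∀ᶠ y in 𝓝 c, ‖f y - f c‖ < ε :=
  (hf.sub continuousAt_const).norm.eventually_lt continuousAt_const (by simpa using hε)

variable {T : Type*} [NormedAddCommGroup T] [NormedSpace ℝ T] [CompleteSpace T]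

/-- On the unit ball around the identity operators have norm at most `2`, so `‖A t‖ ≤ 1/2` bounds
the speed by `1` and the Picard-Lindelöf solution exists on all of `[0,1]`. -/
theorem exists_linear_flow {A : ℝ → T →L[ℝ] T} (hA : ContinuousOn A (Icc 0 1)) {K : ℝ}
    (hK2 : K ≤ 1 / 2) (hK : ∀ t ∈ Icc (0 : ℝ) 1, ‖A t‖ ≤ K) :
    ∃ Φ : ℝ → T →L[ℝ] T, Φ 0 = 1 ∧
      ∀ t ∈ Icc (0 : ℝ) 1, HasDerivWithinAt Φ (A t * Φ t) (Icc 0 1) t := by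
  have h1 : ‖(1 : T →L[ℝ] T)‖ ≤ 1 := ContinuousLinearMap.norm_id_le
  have hP : IsPicardLindelof (fun t X => A t * X) (⟨0, by simp⟩ : Icc (0 : ℝ) 1)
      (1 : T →L[ℝ] T) 1 0 1 1 := by
    refine ⟨fun t ht => ?_, fun X _ => hA.mul continuousOn_const, fun t ht X hX => ?_, by simp⟩
    · refine LipschitzOnWith.of_dist_le_mul fun X _ Y _ => ?_
      rw [dist_eq_norm, dist_eq_norm, ← mul_sub]
      refine (norm_mul_le _ _).trans (mul_le_mul_of_nonneg_right ?_ (norm_nonneg _))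
      exact (hK t ht).trans (by simp; linarith)
    · have h2 : ‖X‖ ≤ 2 := by
        rw [Metric.mem_closedBall, dist_eq_norm] at hX
        calc ‖X‖ = ‖(X - 1) + 1‖ := by simp
          _ ≤ ‖X - 1‖ + ‖(1 : T →L[ℝ] T)‖ := norm_add_le _ _
          _ ≤ 2 := by norm_num at hX; linarith
      have h3 := hK t ht
      calc ‖A t * X‖ ≤ ‖A t‖ * ‖X‖ := norm_mul_le _ _
        _ ≤ 1 / 2 * 2 := mul_le_mul (h3.trans hK2) h2 (norm_nonneg _) (by norm_num)
        _ = ((1 : NNReal) : ℝ) := by norm_num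
  obtain ⟨Φ, h0, hd⟩ := hP.exists_eq_forall_mem_Icc_hasDerivWithinAt₀
  exact ⟨Φ, h0, hd⟩

-- The maximum `m` of `‖Φ t - 1‖` satisfies `m ≤ K (m + 1)`, hence `m ≤ 2K` as `K ≤ 1/2`.
omit [CompleteSpace T] in
theorem norm_linear_flow_sub_one_le {A Φ : ℝ → T →L[ℝ] T} {K : ℝ}
    (hK2 : K ≤ 1 / 2) (hK : ∀ t ∈ Icc (0 : ℝ) 1, ‖A t‖ ≤ K) (h0 : Φ 0 = 1)
    (hd : ∀ t ∈ Icc (0 : ℝ) 1, HasDerivWithinAt Φ (A t * Φ t) (Icc 0 1) t) :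
    ∀ t ∈ Icc (0 : ℝ) 1, ‖Φ t - 1‖ ≤ 2 * K := by
  have h1 : ‖(1 : T →L[ℝ] T)‖ ≤ 1 := ContinuousLinearMap.norm_id_le
  have hc : ContinuousOn (fun t => ‖Φ t - 1‖) (Icc 0 1) := fun t ht =>
    ((hd t ht).continuousWithinAt.sub continuousWithinAt_const).norm
  obtain ⟨s, hs, hmax⟩ := isCompact_Icc.exists_isMaxOn ⟨0, by simp⟩ hc
  set m := ‖Φ s - 1‖ with hm
  have hK0 : 0 ≤ K := (norm_nonneg _).trans (hK s hs)
  have hm0 : 0 ≤ m := norm_nonneg _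
  have hb : ∀ t ∈ Icc (0 : ℝ) 1, ‖A t * Φ t‖ ≤ K * (m + 1) := by
    intro t ht
    have h2 : ‖Φ t‖ ≤ m + 1 :=
      calc ‖Φ t‖ = ‖(Φ t - 1) + 1‖ := by simp
        _ ≤ ‖Φ t - 1‖ + ‖(1 : T →L[ℝ] T)‖ := norm_add_le _ _
        _ ≤ m + 1 := add_le_add (hmax ht) h1
    exact (norm_mul_le _ _).trans (mul_le_mul (hK t ht) h2 (norm_nonneg _) hK0)
  have h3 := (convex_Icc (0 : ℝ) 1).norm_image_sub_le_of_norm_hasDerivWithin_le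
    (fun t ht => hd t ht) hb (left_mem_Icc.2 zero_le_one) hs
  rw [h0, ← hm, sub_zero, Real.norm_of_nonneg hs.1] at h3
  have h4 : m ≤ K * (m + 1) := h3.trans (mul_le_of_le_one_right (by positivity) hs.2)
  intro t ht
  refine (hmax ht).trans ?_
  nlinarith

-- The derivative of `Φ t - t • B` is `(A t - B) + A t * (Φ t - 1)`, of norm at most `δ + K · 2K`.
omit [CompleteSpace T] in
theorem norm_linear_flow_sub_le {A Φ : ℝ → T →L[ℝ] T} {K δ : ℝ} {B : T →L[ℝ] T}
    (hK2 : K ≤ 1 / 2) (hK : ∀ t ∈ Icc (0 : ℝ) 1, ‖A t‖ ≤ K) (h0 : Φ 0 = 1)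
    (hd : ∀ t ∈ Icc (0 : ℝ) 1, HasDerivWithinAt Φ (A t * Φ t) (Icc 0 1) t)
    (hB : ∀ t ∈ Icc (0 : ℝ) 1, ‖A t - B‖ ≤ δ) : ‖Φ 1 - 1 - B‖ ≤ δ + 2 * K ^ 2 := by
  have h1 := norm_linear_flow_sub_one_le hK2 hK h0 hd
  have h2 : ∀ t ∈ Icc (0 : ℝ) 1, HasDerivWithinAt (fun t => Φ t - t • B) (A t * Φ t - B)
      (Icc 0 1) t := by
    intro t ht
    have := (hasDerivWithinAt_id t (Icc 0 1)).smul_const B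
    rw [one_smul] at this
    exact (hd t ht).sub this
  have h3 : ∀ t ∈ Icc (0 : ℝ) 1, ‖A t * Φ t - B‖ ≤ δ + 2 * K ^ 2 := by
    intro t ht
    have hK0 : 0 ≤ K := (norm_nonneg _).trans (hK t ht)
    calc ‖A t * Φ t - B‖ = ‖(A t - B) + A t * (Φ t - 1)‖ := by congr 1; noncomm_ring
      _ ≤ ‖A t - B‖ + ‖A t * (Φ t - 1)‖ := norm_add_le _ _
      _ ≤ δ + K * (2 * K) := add_le_add (hB t ht) ((norm_mul_le _ _).trans
          (mul_le_mul (hK t ht) (h1 t ht) (norm_nonneg _) hK0))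
      _ = δ + 2 * K ^ 2 := by ring
  have h4 := (convex_Icc (0 : ℝ) 1).norm_image_sub_le_of_norm_hasDerivWithin_le
    h2 h3 (left_mem_Icc.2 zero_le_one) (right_mem_Icc.2 zero_le_one)
  simp only [h0, one_smul, zero_smul, sub_zero, norm_one, mul_one] at h4
  rwa [sub_right_comm] at h4

variable {E : Type*} [NormedAddCommGroup E] [NormedSpace ℝ E]

/-- Parallel transport along short line segments for the connection `d + Γ`, and its derivative
with respect to the end point. -/
theorem exists_transport_family {Γ : E → E →L[ℝ] T →L[ℝ] T} {O : Set E} (hO : IsOpen O)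
    (hΓ : ContinuousOn Γ O) {c : E} (hc : c ∈ O) :
    ∃ (r : ℝ) (Φ : E → ℝ → T →L[ℝ] T), 0 < r ∧ HasFDerivAt (fun h => Φ h 1) (-Γ c) 0 ∧
      Φ 0 1 = 1 ∧ ∀ h, ‖h‖ < r → (∀ t ∈ Icc (0 : ℝ) 1, c + t • h ∈ O) ∧ Φ h 0 = 1 ∧
        ∀ t ∈ Icc (0 : ℝ) 1, HasDerivWithinAt (Φ h) (-Γ (c + t • h) h * Φ h t) (Icc 0 1) t := by
  have hcont : ContinuousAt Γ c := hΓ.continuousAt (hO.mem_nhds hc)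
  have hsmall : ∀ ε > 0, ∃ ρ > 0, ∀ h, ‖h‖ < ρ → ∀ t ∈ Icc (0 : ℝ) 1,
      c + t • h ∈ O ∧ ‖Γ (c + t • h) - Γ c‖ ≤ ε := by
    intro ε hε
    obtain ⟨ρ, hρ, H⟩ := Metric.eventually_nhds_iff.1
      ((hO.eventually_mem hc).and (eventually_norm_sub_lt (F := E →L[ℝ] T →L[ℝ] T) hcont hε))
    refine ⟨ρ, hρ, fun h hh t ht => ?_⟩
    have := H (y := c + t • h) (by
      rw [dist_self_add_left, norm_smul, Real.norm_of_nonneg ht.1]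
      exact (mul_le_of_le_one_left (norm_nonneg _) ht.2).trans_lt hh)
    exact ⟨this.1, this.2.le⟩
  obtain ⟨r₁, hr₁, H₁⟩ := hsmall 1 one_pos
  set b := ‖Γ c‖ + 1 with hb
  have hb0 : 0 < b := by positivity
  have hΓb : ∀ h, ‖h‖ < r₁ → ∀ t ∈ Icc (0 : ℝ) 1, ‖-Γ (c + t • h) h‖ ≤ b * ‖h‖ := by
    intro h hh t ht
    rw [norm_neg]
    refine (Γ (c + t • h)).le_of_opNorm_le ?_ h
    exact (norm_le_insert' (Γ (c + t • h)) (Γ c)).trans (add_le_add le_rfl (H₁ h hh t ht).2)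
  -- This radius ensures `b * ‖h‖ ≤ 1/2`, the smallness required by the flow estimates.
  set r := min r₁ (1 / (2 * b)) with hr
  have hrpos : 0 < r := lt_min hr₁ (by positivity)
  have hKb : ∀ h : E, ‖h‖ < r → b * ‖h‖ ≤ 1 / 2 := by
    intro h hh
    have := (hh.trans_le (min_le_right _ _)).le
    rw [le_div_iff₀ (by positivity)] at this
    linarith
  have hex : ∀ h : E, ∃ Φ : ℝ → T →L[ℝ] T, ‖h‖ < r → Φ 0 = 1 ∧
      ∀ t ∈ Icc (0 : ℝ) 1, HasDerivWithinAt Φ (-Γ (c + t • h) h * Φ t) (Icc 0 1) t := by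
    intro h
    by_cases hh : ‖h‖ < r
    · have hh1 := hh.trans_le (min_le_left _ _)
      have hA : ContinuousOn (fun t : ℝ => -Γ (c + t • h) h) (Icc 0 1) :=
        ((hΓ.comp (by fun_prop) fun t ht => (H₁ h hh1 t ht).1).clm_apply continuousOn_const).neg
      obtain ⟨Φ, hΦ⟩ := exists_linear_flow hA (hKb h hh) (hΓb h hh1)
      exact ⟨Φ, fun _ => hΦ⟩
    · exact ⟨0, fun h' => absurd h' hh⟩
  choose Φ hΦ using hex
  have hΦ0 : Φ 0 1 = 1 := by
    have h0 : ‖(0 : E)‖ < r := by simpa using hrpos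
    have h1 := norm_linear_flow_sub_one_le (hKb 0 h0) (hΓb 0 (by simpa using hr₁)) (hΦ 0 h0).1
      (hΦ 0 h0).2 1 (right_mem_Icc.2 zero_le_one)
    rw [norm_zero, mul_zero, mul_zero] at h1
    exact sub_eq_zero.1 (norm_le_zero_iff.1 h1)
  refine ⟨r, Φ, hrpos, ?_, hΦ0, fun h hh =>
    ⟨fun t ht => (H₁ h (hh.trans_le (min_le_left _ _)) t ht).1, hΦ h hh⟩⟩
  refine HasFDerivAt.of_isLittleO (Asymptotics.isLittleO_iff.2 fun ε hε => ?_)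
  obtain ⟨ρ, hρ, H⟩ := hsmall (ε / 2) (by positivity)
  -- The flow estimate with `K = b * ‖h‖` gives the error `ε/2 ‖h‖ + 2 b² ‖h‖²`; the bound `‖h‖ ≤ ε
  -- / (4 b²)` makes the second term at most `ε/2 ‖h‖`.
  have hpos : 0 < min r (min ρ (ε / (4 * b ^ 2))) := lt_min hrpos (lt_min hρ (by positivity))
  filter_upwards [Metric.ball_mem_nhds (0 : E) hpos] with h hh
  rw [mem_ball_zero_iff] at hh
  have hhr := hh.trans_le (min_le_left _ _)
  have hhρ := hh.trans_le ((min_le_right _ _).trans (min_le_left _ _))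
  have hhε := (hh.trans_le ((min_le_right _ _).trans (min_le_right _ _))).le
  have h1 := norm_linear_flow_sub_le (δ := ε / 2 * ‖h‖) (B := -Γ c h) (hKb h hhr)
    (hΓb h (hhr.trans_le (min_le_left _ _))) (hΦ h hhr).1 (hΦ h hhr).2 (fun t ht => by
      rw [← neg_sub', norm_neg, ← sub_apply]
      exact ContinuousLinearMap.le_of_opNorm_le _ (H h hhρ t ht).2 h)
  rw [hΦ0, sub_zero]
  refine h1.trans ?_
  rw [le_div_iff₀ (by positivity)] at hhε
  nlinarith [norm_nonneg h]

end LinearODE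

/-! ### The tractor connection in coordinates and its compatibility with the metric -/

section CoordinateTractors

variable {n : ℕ}

/-- The values of tractors in coordinates. -/
abbrev CoordTractor (n : ℕ) : Type := ℝ × EuclideanSpace ℝ (Fin n) × ℝ

/-- The tractor metric in coordinates, for the metric with components `A`. -/
def coordMetric (A : Matrix (Fin n) (Fin n) ℝ) (T T' : CoordTractor n) : ℝ :=
  T.1 * T'.2.2 + T'.1 * T.2.2 + ∑ i, ∑ j, A i j * T.2.1 i * T'.2.1 j

/-- The normal conformal tractor connection in coordinates is `d + tractorChristoffel`. -/
def tractorChristoffel (G : EuclideanSpace ℝ (Fin n) → Matrix (Fin n) (Fin n) ℝ)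
    (c : EuclideanSpace ℝ (Fin n)) :
    EuclideanSpace ℝ (Fin n) →L[ℝ] CoordTractor n →L[ℝ] CoordTractor n :=
  (LinearMap.mk₂ ℝ (fun (h : EuclideanSpace ℝ (Fin n)) (T : CoordTractor n) =>
    ((-∑ i, ∑ j, schouten G i j c * h i * T.2.1 j,
      WithLp.toLp 2 fun k => ∑ i, ∑ j, christoffel G k i j c * h i * T.2.1 j
        + T.1 * h k + T.2.2 * ∑ l, ∑ i, (G c)⁻¹ k l * schouten G l i c * h i,
      -∑ i, ∑ j, G c i j * h i * T.2.1 j) : CoordTractor n))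
    (by
      intro h h' T
      ext <;> simp [mul_add, add_mul, Finset.sum_add_distrib] <;> ring)
    (by
      intro r h T
      ext <;> simp [Finset.mul_sum, mul_add, mul_left_comm, mul_assoc])
    (by
      intro h T T'
      ext <;> simp [mul_add, add_mul, Finset.sum_add_distrib] <;> ring)
    (by
      intro r h T
      ext <;> simp [Finset.mul_sum, mul_add, mul_left_comm, mul_assoc])).toContinuousBilinearMap

theorem tractorChristoffel_apply (G : EuclideanSpace ℝ (Fin n) → Matrix (Fin n) (Fin n) ℝ)
    (c h : EuclideanSpace ℝ (Fin n)) (T : CoordTractor n) :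
    tractorChristoffel G c h T = (-∑ i, ∑ j, schouten G i j c * h i * T.2.1 j,
      WithLp.toLp 2 fun k => ∑ i, ∑ j, christoffel G k i j c * h i * T.2.1 j
        + T.1 * h k + T.2.2 * ∑ l, ∑ i, (G c)⁻¹ k l * schouten G l i c * h i,
      -∑ i, ∑ j, G c i j * h i * T.2.1 j) := rfl

/-- The equation `∇_h s₋ = h`: the canonical line moves in every direction. The transversality of
`f` to the `P`-orbits rests on it. -/
theorem tractorChristoffel_apply_sMinus
    (G : EuclideanSpace ℝ (Fin n) → Matrix (Fin n) (Fin n) ℝ) (c h : EuclideanSpace ℝ (Fin n)) :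
    tractorChristoffel G c h ((1, 0, 0) : CoordTractor n) = (0, h, 0) := by
  rw [tractorChristoffel_apply]
  ext <;> simp

variable {G : EuclideanSpace ℝ (Fin n) → Matrix (Fin n) (Fin n) ℝ}
  {O : Set (EuclideanSpace ℝ (Fin n))} (hG : IsMetricOn G O)

include hG in
theorem IsMetricOn.contDiffOn_tractorChristoffel : ContDiffOn ℝ ∞ (tractorChristoffel G) O := by
  rw [contDiffOn_clm_apply]
  intro h
  rw [contDiffOn_clm_apply]
  intro T
  simp only [tractorChristoffel_apply]
  have hs : ∀ i j, ContDiffOn ℝ ∞ (schouten G i j) O := hG.contDiffOn_schouten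
  have hc : ∀ k i j, ContDiffOn ℝ ∞ (christoffel G k i j) O := hG.contDiffOn_christoffel
  have hi : ∀ i j, ContDiffOn ℝ ∞ (fun y => (G y)⁻¹ i j) O := hG.contDiffOn_inv
  have hg : ∀ i j, ContDiffOn ℝ ∞ (fun y => G y i j) O := hG.smooth
  refine ContDiffOn.prodMk ?_ (ContDiffOn.prodMk ?_ ?_)
  · exact (ContDiffOn.sum fun i _ => ContDiffOn.sum fun j _ =>
      ((hs i j).mul contDiffOn_const).mul contDiffOn_const).neg
  · rw [contDiffOn_euclidean]
    intro k
    refine ContDiffOn.add (ContDiffOn.add ?_ contDiffOn_const) (contDiffOn_const.mul ?_)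
    · exact ContDiffOn.sum fun i _ => ContDiffOn.sum fun j _ =>
        ((hc k i j).mul contDiffOn_const).mul contDiffOn_const
    · exact ContDiffOn.sum fun l _ => ContDiffOn.sum fun i _ =>
        ((hi k l).mul (hs l i)).mul contDiffOn_const
  · exact (ContDiffOn.sum fun i _ => ContDiffOn.sum fun j _ =>
      ((hg i j).mul contDiffOn_const).mul contDiffOn_const).neg

theorem fderiv_apply_eq_sum_pd (f : EuclideanSpace ℝ (Fin n) → ℝ) (c h : EuclideanSpace ℝ (Fin n)) :
    fderiv ℝ f c h = ∑ i, h i * pd i f c := by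
  conv_lhs => rw [← (EuclideanSpace.basisFun (Fin n) ℝ).sum_repr h]
  simp [pd]

theorem sum_mul_eq_dotProduct {m : ℕ} (A : Matrix (Fin m) (Fin m) ℝ) (u w : Fin m → ℝ) :
    ∑ i, ∑ j, A i j * u i * w j = dotProduct u (A.mulVec w) := by
  simp only [dotProduct, Matrix.mulVec, Finset.mul_sum]
  exact Finset.sum_congr rfl fun i _ => Finset.sum_congr rfl fun j _ => by ring

theorem coordMetric_eq (A : Matrix (Fin n) (Fin n) ℝ) (T T' : CoordTractor n) :
    coordMetric A T T' = T.1 * T'.2.2 + T'.1 * T.2.2 + dotProduct T.2.1 (A.mulVec T'.2.1) := by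
  rw [coordMetric, sum_mul_eq_dotProduct]

-- The Christoffel terms give the derivative of `g` by `∇g = 0`. The terms in which `P` or `g`
-- couples the slots cancel in pairs, by symmetry of `P` and `g`.
include hG in
theorem IsMetricOn.fderiv_coordMetric {c : EuclideanSpace ℝ (Fin n)} (hc : c ∈ O)
    (h : EuclideanSpace ℝ (Fin n)) (T T' : CoordTractor n) :
    ∑ i, ∑ j, fderiv ℝ (fun z => G z i j) c h * T.2.1 i * T'.2.1 j =
      coordMetric (G c) (tractorChristoffel G c h T) T' +
        coordMetric (G c) T (tractorChristoffel G c h T') := by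
  set C : Matrix (Fin n) (Fin n) ℝ := Matrix.of fun k j => ∑ i, christoffel G k i j c * h i with hC
  set P : Matrix (Fin n) (Fin n) ℝ := Matrix.of fun i j => schouten G i j c with hP
  have hGt : (G c).transpose = G c := by ext i j; exact hG.symm c hc j i
  have hPt : P.transpose = P := by ext i j; exact hG.schouten_symm hc j i
  have hΓ : ∀ T : CoordTractor n, tractorChristoffel G c h T =
      (-dotProduct h (P.mulVec T.2.1), WithLp.toLp 2 (C.mulVec T.2.1 + T.1 • (h : Fin n → ℝ)
        + T.2.2 • (G c)⁻¹.mulVec (P.mulVec h)), -dotProduct h ((G c).mulVec T.2.1)) := by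
    intro T
    rw [tractorChristoffel_apply]
    refine Prod.ext ?_ (Prod.ext ?_ ?_)
    · exact congrArg Neg.neg (sum_mul_eq_dotProduct P h T.2.1)
    · refine congrArg (WithLp.toLp 2) (funext fun k => ?_)
      simp only [Pi.add_apply, Pi.smul_apply, smul_eq_mul]
      congr 1
      · congr 1
        rw [Finset.sum_comm]
        simp only [Matrix.mulVec, dotProduct, hC, Matrix.of_apply, Finset.sum_mul]
      · congr 1
        simp only [Matrix.mulVec, dotProduct, hP, Matrix.of_apply, Finset.mul_sum, mul_assoc]
    · exact congrArg Neg.neg (sum_mul_eq_dotProduct (G c) h T.2.1)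
  have hdG : ∀ i j, fderiv ℝ (fun z => G z i j) c h = (C.transpose * G c + G c * C) i j := by
    intro i j
    rw [fderiv_apply_eq_sum_pd]
    simp only [hG.pd_eq hc, Matrix.add_apply, Matrix.mul_apply, Matrix.transpose_apply, hC,
      Matrix.of_apply, mul_add, Finset.sum_add_distrib, Finset.mul_sum, Finset.sum_mul]
    congr 1
    · rw [Finset.sum_comm]
      refine Finset.sum_congr rfl fun l _ => Finset.sum_congr rfl fun a _ => ?_
      rw [hG.symm c hc l j]; ring
    · rw [Finset.sum_comm]
      exact Finset.sum_congr rfl fun l _ => Finset.sum_congr rfl fun a _ => by ring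
  have hsymm : ∀ (A : Matrix (Fin n) (Fin n) ℝ) (u w : Fin n → ℝ),
      dotProduct (A.mulVec u) w = dotProduct u (A.transpose.mulVec w) := by
    intro A u w
    rw [Matrix.mulVec_transpose, dotProduct_comm, Matrix.dotProduct_mulVec, dotProduct_comm]
  have hinv : ∀ u w : Fin n → ℝ, dotProduct u ((G c).mulVec ((G c)⁻¹.mulVec w)) = dotProduct u w := by
    intro u w
    rw [Matrix.mulVec_mulVec, Matrix.mul_nonsing_inv _ (hG.isUnit_det hc), Matrix.one_mulVec]
  have hsym : ∀ (A : Matrix (Fin n) (Fin n) ℝ), A.transpose = A → ∀ u w : Fin n → ℝ,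
      dotProduct u (A.mulVec w) = dotProduct w (A.mulVec u) := by
    intro A hA u w
    rw [dotProduct_comm, hsymm, hA]
  have hGit : (G c)⁻¹.transpose = (G c)⁻¹ := by rw [Matrix.transpose_nonsing_inv, hGt]
  have hinv' : ∀ u w : Fin n → ℝ,
      dotProduct ((G c)⁻¹.mulVec w) ((G c).mulVec u) = dotProduct u w := by
    intro u w
    rw [hsymm, hGit, Matrix.mulVec_mulVec, Matrix.nonsing_inv_mul _ (hG.isUnit_det hc),
      Matrix.one_mulVec, dotProduct_comm]
  simp only [hdG]
  rw [sum_mul_eq_dotProduct, hΓ, hΓ, coordMetric_eq, coordMetric_eq]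
  simp only [add_dotProduct, Matrix.mulVec_add, dotProduct_add, Matrix.add_mulVec, smul_dotProduct,
    Matrix.mulVec_smul, dotProduct_smul, hinv, hinv', ← Matrix.mulVec_mulVec, smul_eq_mul]
  rw [hsymm C, hsym P hPt T'.2.1 h, hsym P hPt T.2.1 h, hsym (G c) hGt T.2.1 h]
  ring

end CoordinateTractors

/-! ### Square roots near the identity and congruence of bilinear forms -/

section SquareRoot

theorem exists_smooth_mul_self {A : Type*} [NormedRing A] [NormedAlgebra ℝ A] [CompleteSpace A] :
    ∃ h : OpenPartialHomeomorph A A, 1 ∈ h.source ∧ (∀ a, h a = a * a) ∧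
      ContDiffOn ℝ ∞ h.symm h.target := by
  have h1 : HasFDerivAt (fun a : A => a * a)
      ((ContinuousLinearEquiv.smulLeft (Units.mk0 (2 : ℝ) two_ne_zero) : A ≃L[ℝ] A) :
        A →L[ℝ] A) 1 := by
    refine ((hasFDerivAt_id (𝕜 := ℝ) (1 : A)).mul' (hasFDerivAt_id (1 : A))).congr_fderiv ?_
    refine ContinuousLinearMap.ext fun a => ?_
    refine Eq.trans ?_ (two_smul ℝ a).symm
    simp
  obtain ⟨h, h2, -, h3, h4⟩ := exists_smooth_openPartialHomeomorph isOpen_univ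
    (contDiff_id.mul contDiff_id).contDiffOn (mem_univ 1) _ h1
  exact ⟨h, h2, fun a => congrFun h3 a, h4⟩

variable {X E : Type*} [NormedAddCommGroup X] [NormedSpace ℝ X] [NormedAddCommGroup E]
  [NormedSpace ℝ E] [CompleteSpace E]

/-- Smooth families of symmetric bilinear forms are smoothly congruent to a constant one. -/
theorem exists_smooth_congruence {b : X → E →L[ℝ] E →L[ℝ] ℝ} {O : Set X} (hO : IsOpen O)
    (hb : ContDiffOn ℝ ∞ b O) (hsymm : ∀ c ∈ O, ∀ u w, b c u w = b c w u) {c₀ : X} (hc₀ : c₀ ∈ O)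
    (J : E ≃L[ℝ] (E →L[ℝ] ℝ)) (hJ : ∀ u, J u = b c₀ u) :
    ∃ (U : Set X) (S : X → E →L[ℝ] E), IsOpen U ∧ U ⊆ O ∧ c₀ ∈ U ∧ ContDiffOn ℝ ∞ S U ∧
      S c₀ = 1 ∧ (∀ c ∈ U, IsUnit (S c)) ∧
      ∀ c ∈ U, ∀ u w, b c₀ (S c u) (S c w) = b c u w := by
  obtain ⟨h, h1, hsq, hsm⟩ := exists_smooth_mul_self (A := E →L[ℝ] E)
  -- `B c` represents the form at `c` by the form at `c₀`; the congruence is its square root near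
  -- `1`.
  let B : X → E →L[ℝ] E := fun c => (J.symm : (E →L[ℝ] ℝ) →L[ℝ] E).comp (b c)
  have hB : ∀ c u w, b c₀ (B c u) w = b c u w := by
    intro c u w
    rw [← hJ]
    change J (J.symm (b c u)) w = _
    rw [J.apply_symm_apply]
  let adj : (E →L[ℝ] E) → (E →L[ℝ] E) := fun A =>
    (J.symm : (E →L[ℝ] ℝ) →L[ℝ] E).comp
      (((ContinuousLinearMap.compL ℝ E E ℝ).flip A).comp (J : E →L[ℝ] E →L[ℝ] ℝ))
  have hadjc : Continuous adj := by fun_prop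
  have hadj : ∀ A u w, b c₀ (adj A u) w = b c₀ u (A w) := by
    intro A u w
    rw [← hJ, ← hJ]
    change J (J.symm ((J u).comp A)) w = _
    rw [J.apply_symm_apply]; rfl
  have hext : ∀ A A' : E →L[ℝ] E, (∀ u w, b c₀ (A u) w = b c₀ (A' u) w) → A = A' := by
    intro A A' H
    ext1 u
    apply J.injective
    ext1 w
    rw [hJ, hJ, H]
  have hB1 : B c₀ = 1 := hext _ _ fun u w => hB c₀ u w
  have hadj1 : adj 1 = 1 := hext _ _ fun u w => hadj 1 u w
  have hBs : ContDiffOn ℝ ∞ B O := contDiffOn_const.clm_comp hb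
  have hh1 : h 1 = 1 := by rw [hsq, one_mul]
  have hs1 : h.symm 1 = 1 := by
    have := h.left_inv h1
    rwa [hh1] at this
  have h1t : (1 : E →L[ℝ] E) ∈ h.target := hh1 ▸ h.map_source h1
  set U₁ := O ∩ B ⁻¹' h.target with hU₁
  have hU₁o : IsOpen U₁ := hBs.continuousOn.isOpen_inter_preimage hO h.open_target
  have hS : ContDiffOn ℝ ∞ (fun c => h.symm (B c)) U₁ :=
    hsm.comp (hBs.mono inter_subset_left) fun c hc => hc.2
  -- The adjoint of the root must also lie where squaring is injective.
  set W : Set (E →L[ℝ] E) := adj ⁻¹' h.source ∩ {A | IsUnit A} with hW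
  have hWo : IsOpen W := (h.open_source.preimage hadjc).inter Units.isOpen
  refine ⟨U₁ ∩ (fun c => h.symm (B c)) ⁻¹' W, fun c => h.symm (B c),
    hS.continuousOn.isOpen_inter_preimage hU₁o hWo, fun c hc => hc.1.1, ?_, hS.mono inter_subset_left,
    by simp only [hB1, hs1], fun c hc => hc.2.2, ?_⟩
  · refine ⟨⟨hc₀, ?_⟩, ?_⟩
    · simpa only [mem_preimage, hB1] using h1t
    · simp only [mem_preimage, hB1, hs1]
      refine ⟨?_, isUnit_one⟩
      simpa only [mem_preimage, hadj1] using h1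
  · intro c hc u w
    obtain ⟨⟨hcO, hct⟩, hcW, -⟩ := hc
    set A := h.symm (B c) with hA
    have hAA : A * A = B c := by rw [← hsq, hA, h.right_inv hct]
    have hA' : adj A * adj A = B c := by
      refine hext _ _ fun u w => ?_
      rw [hB, mul_apply_eq_comp, hadj, hadj, ← mul_apply_eq_comp, hAA, hsymm c₀ hc₀, hB,
        hsymm c hcO]
    -- Both `A` and its adjoint are square roots of `B c` in the domain of injectivity.
    -- Self-adjointness then moves one factor `A` across the form.
    have hself : adj A = A := h.injOn hcW (h.map_target hct) (by rw [hsq, hsq, hA', hAA])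
    calc b c₀ (A u) (A w) = b c₀ (adj A (A u)) w := (hadj A (A u) w).symm
      _ = b c₀ ((A * A) u) w := by rw [hself]; rfl
      _ = b c u w := by rw [hAA, hB]

end SquareRoot

/-- Bootstrapping: the derivative of `f` is a smooth expression in `f`, so class `C^m` implies class
`C^{m+1}`. -/
theorem contDiffOn_of_linear_ode {E V : Type*} [NormedAddCommGroup E] [NormedSpace ℝ E]
    [NormedAddCommGroup V] [NormedSpace ℝ V] {f : E → V} {U : Set E} (hU : IsOpen U)
    {D : E → V →L[ℝ] E →L[ℝ] V} (hD : ContDiffOn ℝ ∞ D U)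
    (hf : ∀ c ∈ U, HasFDerivAt f (D c (f c)) c) : ContDiffOn ℝ ∞ f U := by
  rw [contDiffOn_infty]
  intro m
  induction m with
  | zero =>
    rw [Nat.cast_zero, contDiffOn_zero]
    exact fun c hc => (hf c hc).continuousAt.continuousWithinAt
  | succ m ih =>
    rw [Nat.cast_add, Nat.cast_one, contDiffOn_succ_iff_fderiv_of_isOpen hU]
    refine ⟨fun c hc => (hf c hc).differentiableAt.differentiableWithinAt, by simp, ?_⟩
    exact ((hD.of_le (by exact_mod_cast le_top)).clm_apply ih).congr fun c hc => (hf c hc).fderiv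

/-! ### Smooth orthonormal frame fields adapted to the canonical line -/

section FrameField

variable {n p q : ℕ} {G : EuclideanSpace ℝ (Fin n) → Matrix (Fin n) (Fin n) ℝ}
  {O : Set (EuclideanSpace ℝ (Fin n))} (hG : IsMetricOn G O)

/-- The bilinear form with a given matrix. -/
def matrixForm (A : Matrix (Fin n) (Fin n) ℝ) :
    EuclideanSpace ℝ (Fin n) →L[ℝ] EuclideanSpace ℝ (Fin n) →L[ℝ] ℝ :=
  (LinearMap.mk₂ ℝ (fun u w : EuclideanSpace ℝ (Fin n) => ∑ i, ∑ j, A i j * u i * w j)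
    (by intro u v w; simp [mul_add, add_mul, Finset.sum_add_distrib])
    (by intro r u w; simp [Finset.mul_sum, mul_left_comm, mul_assoc])
    (by intro u v w; simp [mul_add, Finset.sum_add_distrib])
    (by intro r u w; simp [Finset.mul_sum, mul_left_comm])).toContinuousBilinearMap

theorem matrixForm_apply (A : Matrix (Fin n) (Fin n) ℝ) (u w : EuclideanSpace ℝ (Fin n)) :
    matrixForm A u w = ∑ i, ∑ j, A i j * u i * w j := rfl

theorem exists_equiv_matrixForm {A : Matrix (Fin n) (Fin n) ℝ} (hA : IsUnit A.det)
    (hs : A.transpose = A) :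
    ∃ J : EuclideanSpace ℝ (Fin n) ≃L[ℝ] (EuclideanSpace ℝ (Fin n) →L[ℝ] ℝ),
      ∀ u, J u = matrixForm A u := by
  have hinj : Function.Injective (matrixForm A).toLinearMap := by
    rw [injective_iff_map_eq_zero]
    intro u hu
    have h1 : ∀ w : Fin n → ℝ, dotProduct w (A.mulVec u) = 0 := by
      intro w
      have h2 : matrixForm A u (WithLp.toLp 2 w) = 0 := DFunLike.congr_fun hu _
      rw [matrixForm_apply, sum_mul_eq_dotProduct, Matrix.dotProduct_mulVec, ← Matrix.mulVec_transpose,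
        hs, dotProduct_comm] at h2
      exact h2
    have h3 : A.mulVec u = 0 := by
      have := h1 (A.mulVec u)
      exact dotProduct_self_eq_zero.1 this
    have h4 : (u : Fin n → ℝ) = 0 := by
      rw [← Matrix.one_mulVec (u : Fin n → ℝ), ← Matrix.nonsing_inv_mul A hA, ← Matrix.mulVec_mulVec,
        h3, Matrix.mulVec_zero]
    ext i
    exact congrFun h4 i
  have hrank : Module.finrank ℝ (EuclideanSpace ℝ (Fin n)) =
      Module.finrank ℝ (EuclideanSpace ℝ (Fin n) →L[ℝ] ℝ) := by
    rw [← LinearEquiv.finrank_eq (LinearMap.toContinuousLinearMap (𝕜 := ℝ)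
      (E := EuclideanSpace ℝ (Fin n)) (F' := ℝ))]
    exact (Subspace.dual_finrank_eq (K := ℝ) (V := EuclideanSpace ℝ (Fin n))).symm
  exact ⟨((matrixForm A).toLinearMap.linearEquivOfInjective hinj hrank).toContinuousLinearEquiv,
    fun u => rfl⟩

/-- The endomorphism `1 ⊕ A ⊕ 1` of coordinate tractors. -/
def tractorExtend (A : EuclideanSpace ℝ (Fin n) →L[ℝ] EuclideanSpace ℝ (Fin n)) :
    CoordTractor n →L[ℝ] CoordTractor n :=
  (ContinuousLinearMap.id ℝ ℝ).prodMap (A.prodMap (ContinuousLinearMap.id ℝ ℝ))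

theorem tractorExtend_apply (A : EuclideanSpace ℝ (Fin n) →L[ℝ] EuclideanSpace ℝ (Fin n))
    (T : CoordTractor n) : tractorExtend A T = (T.1, A T.2.1, T.2.2) := rfl

theorem contDiffOn_tractorExtend {X : Type*} [NormedAddCommGroup X] [NormedSpace ℝ X]
    {S : X → EuclideanSpace ℝ (Fin n) →L[ℝ] EuclideanSpace ℝ (Fin n)} {U : Set X}
    (hS : ContDiffOn ℝ ∞ S U) : ContDiffOn ℝ ∞ (fun c => tractorExtend (S c)) U := by
  rw [contDiffOn_clm_apply]
  intro T
  simp only [tractorExtend_apply]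
  exact contDiffOn_const.prodMk ((hS.clm_apply contDiffOn_const).prodMk contDiffOn_const)

/-- A smooth field `u` of orthonormal tractor frames in coordinates, with inverse `ui`, that maps a
fixed line to the canonical one. -/
structure IsFrameField (G : EuclideanSpace ℝ (Fin n) → Matrix (Fin n) (Fin n) ℝ)
    (U : Set (EuclideanSpace ℝ (Fin n)))
    (u : EuclideanSpace ℝ (Fin n) → Model p q →L[ℝ] CoordTractor n)
    (ui : EuclideanSpace ℝ (Fin n) → CoordTractor n →L[ℝ] Model p q) (w : Model p q) : Prop where
  isMetricOn : IsMetricOn G U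
  contDiffOn : ContDiffOn ℝ ∞ u U
  contDiffOn_inv : ContDiffOn ℝ ∞ ui U
  inv_apply : ∀ c ∈ U, ∀ v, ui c (u c v) = v
  apply_inv : ∀ c ∈ U, ∀ T, u c (ui c T) = T
  isometry : ∀ c ∈ U, ∀ v w, coordMetric (G c) (u c v) (u c w) = modelForm p q v w
  inv_sMinus : ∀ c ∈ U, ui c (1, 0, 0) = w

theorem IsMetricOn.mono (hG : IsMetricOn G O) {U : Set (EuclideanSpace ℝ (Fin n))}
    (hU : IsOpen U) (hUO : U ⊆ O) : IsMetricOn G U :=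
  ⟨hU, fun i j => (hG.smooth i j).mono hUO, fun y hy => hG.symm y (hUO hy),
    fun y hy => hG.det_ne_zero y (hUO hy)⟩

-- The frame `u₀` is corrected by `1 ⊕ S⁻¹ ⊕ 1`, where `S` turns the metric at `c₀` into the one at
-- `c`. This fixes `s₋`, so the preimage of `s₋` does not depend on the point.
include hG in
theorem IsMetricOn.exists_frameField {c₀ : EuclideanSpace ℝ (Fin n)} (hc₀ : c₀ ∈ O)
    (u₀ : Model p q ≃L[ℝ] CoordTractor n)
    (hu₀ : ∀ v w, coordMetric (G c₀) (u₀ v) (u₀ w) = modelForm p q v w) :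
    ∃ (U : Set (EuclideanSpace ℝ (Fin n)))
      (u : EuclideanSpace ℝ (Fin n) → Model p q →L[ℝ] CoordTractor n)
      (ui : EuclideanSpace ℝ (Fin n) → CoordTractor n →L[ℝ] Model p q),
      U ⊆ O ∧ c₀ ∈ U ∧ IsFrameField G U u ui (u₀.symm (1, 0, 0)) ∧ ∀ v, u c₀ v = u₀ v := by
  have hGt : (G c₀).transpose = G c₀ := by ext i j; exact hG.symm c₀ hc₀ j i
  obtain ⟨J, hJ⟩ := exists_equiv_matrixForm (hG.isUnit_det hc₀) hGt
  have hb : ContDiffOn ℝ ∞ (fun c => matrixForm (G c)) O := by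
    rw [contDiffOn_clm_apply]
    intro u
    rw [contDiffOn_clm_apply]
    intro w
    simp only [matrixForm_apply]
    exact ContDiffOn.sum fun i _ => ContDiffOn.sum fun j _ =>
      ((hG.smooth i j).mul contDiffOn_const).mul contDiffOn_const
  obtain ⟨U, S, hUo, hUO, hc₀U, hS, hS1, hSu, hSb⟩ := exists_smooth_congruence hG.isOpen hb
    (fun c hc u w => by
      simp only [matrixForm_apply]
      rw [Finset.sum_comm]
      refine Finset.sum_congr rfl fun i _ => Finset.sum_congr rfl fun j _ => ?_
      rw [hG.symm c hc]; ring) hc₀ J hJ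
  have hSi : ContDiffOn ℝ ∞ (fun c => Ring.inverse (S c)) U := by
    intro c hc
    obtain ⟨s, hs⟩ := hSu c hc
    refine ContDiffAt.comp_contDiffWithinAt (g := Ring.inverse) c ?_ (hS c hc)
    rw [← hs]
    exact contDiffAt_ringInverse ℝ s
  have h1 : ∀ c ∈ U, ∀ y, Ring.inverse (S c) (S c y) = y := fun c hc y =>
    DFunLike.congr_fun (Ring.inverse_mul_cancel _ (hSu c hc)) y
  have h2 : ∀ c ∈ U, ∀ y, S c (Ring.inverse (S c) y) = y := fun c hc y =>
    DFunLike.congr_fun (Ring.mul_inverse_cancel _ (hSu c hc)) y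
  refine ⟨U, fun c => (tractorExtend (Ring.inverse (S c))).comp (u₀ : Model p q →L[ℝ] CoordTractor n),
    fun c => (u₀.symm : CoordTractor n →L[ℝ] Model p q).comp (tractorExtend (S c)), hUO, hc₀U,
    ⟨hG.mono hUo hUO, (contDiffOn_tractorExtend hSi).clm_comp contDiffOn_const,
      contDiffOn_const.clm_comp (contDiffOn_tractorExtend hS), fun c hc v => ?_, fun c hc T => ?_,
      fun c hc v w => ?_, fun c hc => ?_⟩, fun v => ?_⟩
  · simp [tractorExtend_apply, h2 c hc]
  · simp [tractorExtend_apply, h1 c hc]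
  · rw [← hu₀]
    have h3 := hSb c hc (Ring.inverse (S c) (u₀ v).2.1) (Ring.inverse (S c) (u₀ w).2.1)
    rw [h2 c hc, h2 c hc, matrixForm_apply, matrixForm_apply] at h3
    simp only [ContinuousLinearMap.comp_apply, ContinuousLinearEquiv.coe_coe, tractorExtend_apply,
      coordMetric]
    rw [h3]
  · simp [tractorExtend_apply]
  · simp [tractorExtend_apply, hS1]

variable {U : Set (EuclideanSpace ℝ (Fin n))}
  {u : EuclideanSpace ℝ (Fin n) → Model p q →L[ℝ] CoordTractor n}
  {ui : EuclideanSpace ℝ (Fin n) → CoordTractor n →L[ℝ] Model p q} {w₀ : Model p q}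

/-- Minus the connection form of the tractor connection with respect to a frame field. -/
def frameForm (G : EuclideanSpace ℝ (Fin n) → Matrix (Fin n) (Fin n) ℝ)
    (u : EuclideanSpace ℝ (Fin n) → Model p q →L[ℝ] CoordTractor n)
    (ui : EuclideanSpace ℝ (Fin n) → CoordTractor n →L[ℝ] Model p q)
    (c : EuclideanSpace ℝ (Fin n)) :
    EuclideanSpace ℝ (Fin n) →L[ℝ] Model p q →L[ℝ] Model p q :=
  LinearMap.toContinuousLinearMap
    { toFun := fun h => (fderiv ℝ ui c h).comp (u c) -
        (ui c).comp ((tractorChristoffel G c h).comp (u c))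
      map_add' := fun h h' => by
        ext1 v
        simp only [map_add, ContinuousLinearMap.comp_apply, add_apply, sub_apply]
        abel
      map_smul' := fun r h => by
        ext1 v
        simp [smul_sub] }

theorem frameForm_apply (c h : EuclideanSpace ℝ (Fin n)) (v : Model p q) :
    frameForm G u ui c h v = fderiv ℝ ui c h (u c v) -
      ui c (tractorChristoffel G c h (u c v)) := rfl

theorem IsFrameField.contDiffOn_frameForm (hu : IsFrameField G U u ui w₀) :
    ContDiffOn ℝ ∞ (frameForm G u ui) U := by
  rw [contDiffOn_clm_apply]
  intro h
  have h1 : ContDiffOn ℝ ∞ (fun c => fderiv ℝ ui c h) U :=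
    (hu.contDiffOn_inv.fderiv_of_isOpen hu.isMetricOn.isOpen (by simp)).clm_apply contDiffOn_const
  have h2 : ContDiffOn ℝ ∞ (fun c => tractorChristoffel G c h) U :=
    hu.isMetricOn.contDiffOn_tractorChristoffel.clm_apply contDiffOn_const
  exact (h1.clm_comp hu.contDiffOn).sub
    (hu.contDiffOn_inv.clm_comp (h2.clm_comp hu.contDiffOn))

/-- The frame field has a constant preimage of `s₋`, so the derivative term vanishes and only `∇_h
s₋ = h` remains. -/
theorem IsFrameField.frameForm_apply_of_eq_smul (hu : IsFrameField G U u ui w₀)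
    {c : EuclideanSpace ℝ (Fin n)} (hc : c ∈ U) {v : Model p q} {r : ℝ}
    (hv : u c v = r • ((1, 0, 0) : CoordTractor n)) (h : EuclideanSpace ℝ (Fin n)) :
    frameForm G u ui c h v = -(r • ui c ((0, h, 0) : CoordTractor n)) := by
  have hd : HasFDerivAt ui (fderiv ℝ ui c) c :=
    ((hu.contDiffOn_inv.contDiffAt (hu.isMetricOn.isOpen.mem_nhds hc)).differentiableAt
      (by simp)).hasFDerivAt
  have h1 := hd.clm_apply (hasFDerivAt_const ((1, 0, 0) : CoordTractor n) c)
  have h2 : HasFDerivAt (fun c => ui c ((1, 0, 0) : CoordTractor n))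
      (0 : EuclideanSpace ℝ (Fin n) →L[ℝ] Model p q) c :=
    (hasFDerivAt_const w₀ c).congr_of_eventuallyEq
      (Filter.eventually_of_mem (hu.isMetricOn.isOpen.mem_nhds hc) hu.inv_sMinus)
  have h3 := DFunLike.congr_fun (h1.unique h2) h
  simp at h3
  rw [frameForm_apply, hv, map_smul, map_smul, map_smul, h3, tractorChristoffel_apply_sMinus]
  simp

end FrameField

/-! ### Parallel transport expressed in a frame field -/

section Transition

variable {n p q : ℕ} {G : EuclideanSpace ℝ (Fin n) → Matrix (Fin n) (Fin n) ℝ}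
  {O : Set (EuclideanSpace ℝ (Fin n))}

/-- By `fderiv_coordMetric` the product of two transported tractors has derivative zero along the
segment. -/
theorem IsMetricOn.coordMetric_transport (hG : IsMetricOn G O) {c h : EuclideanSpace ℝ (Fin n)}
    (hcO : ∀ t ∈ Icc (0 : ℝ) 1, c + t • h ∈ O) {Φ : ℝ → CoordTractor n →L[ℝ] CoordTractor n}
    (h0 : Φ 0 = 1) (hΦ : ∀ t ∈ Icc (0 : ℝ) 1,
      HasDerivWithinAt Φ (-tractorChristoffel G (c + t • h) h * Φ t) (Icc 0 1) t)
    (T T' : CoordTractor n) :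
    coordMetric (G (c + h)) (Φ 1 T) (Φ 1 T') = coordMetric (G c) T T' := by
  have hap : ∀ T : CoordTractor n, ∀ t ∈ Icc (0 : ℝ) 1, HasDerivWithinAt (fun t => Φ t T)
      (-tractorChristoffel G (c + t • h) h (Φ t T)) (Icc 0 1) t := by
    intro T t ht
    have h1 : HasFDerivAt (fun L : CoordTractor n →L[ℝ] CoordTractor n => L T)
        (ContinuousLinearMap.apply ℝ (CoordTractor n) T) (Φ t) :=
      (ContinuousLinearMap.apply ℝ (CoordTractor n) T).hasFDerivAt
    exact h1.comp_hasDerivWithinAt t (hΦ t ht)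
  have hd : ∀ t ∈ Icc (0 : ℝ) 1, HasDerivWithinAt
      (fun t => coordMetric (G (c + t • h)) (Φ t T) (Φ t T')) 0 (Icc 0 1) t := by
    intro t ht
    have hfst : ∀ T, HasDerivWithinAt (fun t => (Φ t T).1)
        (-tractorChristoffel G (c + t • h) h (Φ t T)).1 (Icc 0 1) t := fun T =>
      (ContinuousLinearMap.fst ℝ ℝ (EuclideanSpace ℝ (Fin n) × ℝ)).hasFDerivAt.comp_hasDerivWithinAt
        t (hap T t ht)
    have hsnd : ∀ T, HasDerivWithinAt (fun t => (Φ t T).2.2)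
        (-tractorChristoffel G (c + t • h) h (Φ t T)).2.2 (Icc 0 1) t := fun T =>
      ((ContinuousLinearMap.snd ℝ (EuclideanSpace ℝ (Fin n)) ℝ).comp
        (ContinuousLinearMap.snd ℝ ℝ _)).hasFDerivAt.comp_hasDerivWithinAt t (hap T t ht)
    have hmid : ∀ T i, HasDerivWithinAt (fun t => (Φ t T).2.1 i)
        ((-tractorChristoffel G (c + t • h) h (Φ t T)).2.1 i) (Icc 0 1) t := fun T i =>
      ((EuclideanSpace.proj i : EuclideanSpace ℝ (Fin n) →L[ℝ] ℝ).comp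
        ((ContinuousLinearMap.fst ℝ (EuclideanSpace ℝ (Fin n)) ℝ).comp
          (ContinuousLinearMap.snd ℝ ℝ _))).hasFDerivAt.comp_hasDerivWithinAt t (hap T t ht)
    have hline : HasDerivWithinAt (fun t : ℝ => c + t • h) h (Icc 0 1) t := by
      simpa using (((hasDerivAt_id t).smul_const h).const_add c).hasDerivWithinAt
    have hGd : ∀ i j, HasDerivWithinAt (fun t : ℝ => G (c + t • h) i j)
        (fderiv ℝ (fun z => G z i j) (c + t • h) h) (Icc 0 1) t := by
      intro i j
      have h1 : HasFDerivAt (fun z => G z i j) (fderiv ℝ (fun z => G z i j) (c + t • h))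
          (c + t • h) :=
        (differentiableAt_of_contDiffOn hG.isOpen (hG.smooth i j) (hcO t ht)).hasFDerivAt
      exact h1.comp_hasDerivWithinAt t hline
    have hall := (((hfst T).mul (hsnd T')).add ((hfst T').mul (hsnd T))).add
      (HasDerivWithinAt.fun_sum fun i (_ : i ∈ Finset.univ) =>
        HasDerivWithinAt.fun_sum fun j (_ : j ∈ Finset.univ) =>
          ((hGd i j).fun_mul (hmid T i)).fun_mul (hmid T' j))
    refine hall.congr_deriv ?_
    have hcompat := hG.fderiv_coordMetric (hcO t ht) h (Φ t T) (Φ t T')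
    simp only [add_mul, Finset.sum_add_distrib]
    rw [hcompat, coordMetric, coordMetric]
    simp only [Prod.fst_neg, Prod.snd_neg, PiLp.neg_apply, neg_mul, mul_neg, Finset.sum_neg_distrib]
    ring
  have h1 := constant_of_derivWithin_zero (fun t ht => (hd t ht).differentiableWithinAt)
    (fun t ht => (hd t (Ico_subset_Icc_self ht)).derivWithin
      (uniqueDiffOn_Icc one_pos t (Ico_subset_Icc_self ht))) 1 (right_mem_Icc.2 zero_le_one)
  simpa [h0] using h1

variable {U : Set (EuclideanSpace ℝ (Fin n))}
  {u : EuclideanSpace ℝ (Fin n) → Model p q →L[ℝ] CoordTractor n}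
  {ui : EuclideanSpace ℝ (Fin n) → CoordTractor n →L[ℝ] Model p q} {w₀ : Model p q}

/-- The matrix of the parallel transport `A` from `c` to `c + h` with respect to the frames. -/
def transition (u : EuclideanSpace ℝ (Fin n) → Model p q →L[ℝ] CoordTractor n)
    (ui : EuclideanSpace ℝ (Fin n) → CoordTractor n →L[ℝ] Model p q)
    (A : EuclideanSpace ℝ (Fin n) → CoordTractor n →L[ℝ] CoordTractor n)
    (c h : EuclideanSpace ℝ (Fin n)) : Model p q →L[ℝ] Model p q :=
  (ui (c + h)).comp ((A h).comp (u c))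

theorem IsFrameField.transition_mem_stab (hu : IsFrameField G U u ui w₀)
    {A : EuclideanSpace ℝ (Fin n) → CoordTractor n →L[ℝ] CoordTractor n}
    {c h : EuclideanSpace ℝ (Fin n)} (hc : c ∈ U) (hch : c + h ∈ U)
    (hA : ∀ T T', coordMetric (G (c + h)) (A h T) (A h T') = coordMetric (G c) T T') :
    transition u ui A c h ∈ stab 0 := by
  refine ⟨fun v w => ?_, by simp⟩
  rw [← hu.isometry _ hch]
  simp only [transition, ContinuousLinearMap.comp_apply]
  rw [hu.apply_inv _ hch, hu.apply_inv _ hch, hA, hu.isometry c hc]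

theorem IsFrameField.transition_zero (hu : IsFrameField G U u ui w₀)
    {A : EuclideanSpace ℝ (Fin n) → CoordTractor n →L[ℝ] CoordTractor n}
    {c : EuclideanSpace ℝ (Fin n)} (hc : c ∈ U) (hA : A 0 = 1) : transition u ui A c 0 = 1 := by
  ext1 v
  simp only [transition, add_zero, hA]
  exact hu.inv_apply c hc v

theorem IsFrameField.hasFDerivAt_transition (hu : IsFrameField G U u ui w₀)
    {A : EuclideanSpace ℝ (Fin n) → CoordTractor n →L[ℝ] CoordTractor n}
    {c : EuclideanSpace ℝ (Fin n)} (hc : c ∈ U) (hA : HasFDerivAt A (-tractorChristoffel G c) 0)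
    (hA0 : A 0 = 1) : HasFDerivAt (transition u ui A c) (frameForm G u ui c) 0 := by
  have hd : HasFDerivAt ui (fderiv ℝ ui c) (c + 0) := by
    rw [add_zero]
    exact ((hu.contDiffOn_inv.contDiffAt (hu.isMetricOn.isOpen.mem_nhds hc)).differentiableAt
      (by simp)).hasFDerivAt
  have h1 : HasFDerivAt (fun h => ui (c + h)) (fderiv ℝ ui c) 0 :=
    HasFDerivAt.comp (g := ui) (0 : EuclideanSpace ℝ (Fin n)) hd
      ((hasFDerivAt_id (0 : EuclideanSpace ℝ (Fin n))).const_add c)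
  have h2 := h1.clm_comp (hA.clm_comp (hasFDerivAt_const (u c) 0))
  refine h2.congr_fderiv ?_
  ext h v : 2
  rw [frameForm_apply]
  simp [hA0]
  abel

/-- The form is the derivative at zero displacement of the transition matrices, which are
isometries. -/
theorem IsFrameField.frameForm_mem_stabAlg (hu : IsFrameField G U u ui w₀)
    {c : EuclideanSpace ℝ (Fin n)} (hc : c ∈ U) (h : EuclideanSpace ℝ (Fin n)) :
    frameForm G u ui c h ∈ stabAlg 0 := by
  obtain ⟨r, Φ, hr, hΦd, hΦ0, hΦ⟩ := exists_transport_family hu.isMetricOn.isOpen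
    hu.isMetricOn.contDiffOn_tractorChristoffel.continuousOn hc
  have h1 := hu.hasFDerivAt_transition hc hΦd hΦ0
  have h2 : HasDerivAt (fun s : ℝ => transition u ui (fun h => Φ h 1) c (s • h))
      (frameForm G u ui c h) 0 := by
    have h3 : HasDerivAt (fun s : ℝ => s • h) h 0 := by
      have := (hasDerivAt_id (0 : ℝ)).smul_const h
      rwa [one_smul] at this
    refine HasFDerivAt.comp_hasDerivAt (l := transition u ui (fun h => Φ h 1) c) (0 : ℝ) ?_ h3
    rwa [zero_smul]
  refine mem_stabAlg_of_hasDerivAt h2 (by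
    simp only [zero_smul]; exact hu.transition_zero hc hΦ0) ?_
  have h4 : ∀ᶠ s : ℝ in 𝓝 0, ‖s • h‖ < r := by
    have : ContinuousAt (fun s : ℝ => ‖s • h‖) 0 := by fun_prop
    exact this.eventually_lt continuousAt_const (by simpa using hr)
  filter_upwards [h4] with s hs
  obtain ⟨h5, h6, h7⟩ := hΦ _ hs
  have h8 := h5 1 (right_mem_Icc.2 zero_le_one)
  rw [one_smul] at h8
  exact hu.transition_mem_stab hc h8
    (hu.isMetricOn.coordMetric_transport h5 h6 h7)

end Transition

/-! ### From coordinate tractors to tractors on the manifold -/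

section LocalTractors

variable {n p q : ℕ} {M : Type*} [TopologicalSpace M]
  [ChartedSpace (EuclideanSpace ℝ (Fin n)) M] [IsManifold (𝓡 n) ∞ M]

theorem SemiRiemannianMetric.symm (g : SemiRiemannianMetric n p q M) (x : M)
    (v w : TangentSpace (𝓡 n) x) : g.val x v w = g.val x w v := by
  obtain ⟨b, hb⟩ := g.signature x
  have h : (g.val x).toLinearMap₁₂ = (g.val x).toLinearMap₁₂.flip := by
    refine b.ext fun i => b.ext fun j => ?_
    have h1 := hb i j
    have h2 := hb j i
    rw [← Matrix.diagonal_transpose, Matrix.transpose_apply] at h2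
    exact h1.trans h2.symm
  exact LinearMap.congr_fun₂ h v w

theorem SemiRiemannianMetric.nondegenerate (g : SemiRiemannianMetric n p q M) (x : M)
    {v : TangentSpace (𝓡 n) x} (h : ∀ w, g.val x v w = 0) : v = 0 := by
  obtain ⟨b, hb⟩ := g.signature x
  have h0 : ∀ j, b.repr v j = 0 := by
    intro j
    have h1 := h (b j)
    rw [← b.sum_repr v, map_sum, sum_apply] at h1
    simp only [map_smul, smul_apply, hb, smul_eq_mul, Matrix.diagonal_apply, mul_ite, mul_zero,
      Finset.sum_ite_eq', Finset.mem_univ, if_true] at h1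
    rcases j with j | j <;> simpa using h1
  exact b.repr.map_eq_zero_iff.1 (Finsupp.ext h0)

/-- The chart around `x₀` induces coordinates of tractors at `x`. -/
def toCoord (x₀ x : M) : Tractor n x →L[ℝ] CoordTractor n :=
  tractorExtend (tangentCoordChange (𝓡 n) x x₀ x)

/-- The tractor at `x` with given coordinates in the chart around `x₀`. -/
def ofCoord (x₀ x : M) : CoordTractor n →L[ℝ] Tractor n x :=
  tractorExtend (tangentCoordChange (𝓡 n) x₀ x x)

theorem tangentCoordChange_inverse {x₁ x₂ x : M} (h₁ : x ∈ (extChartAt (𝓡 n) x₁).source)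
    (h₂ : x ∈ (extChartAt (𝓡 n) x₂).source) (v : EuclideanSpace ℝ (Fin n)) :
    tangentCoordChange (𝓡 n) x₁ x₂ x (tangentCoordChange (𝓡 n) x₂ x₁ x v) = v := by
  rw [tangentCoordChange_comp ⟨⟨h₂, h₁⟩, h₂⟩, tangentCoordChange_self h₂]

theorem toCoord_ofCoord {x₀ x : M} (hx : x ∈ (extChartAt (𝓡 n) x₀).source)
    (T : CoordTractor n) : toCoord x₀ x (ofCoord x₀ x T) = T := by
  simp only [toCoord, ofCoord, tractorExtend_apply,
    tangentCoordChange_inverse (mem_extChartAt_source x) hx]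

theorem ofCoord_toCoord {x₀ x : M} (hx : x ∈ (extChartAt (𝓡 n) x₀).source)
    (T : Tractor n x) : ofCoord x₀ x (toCoord x₀ x T) = T := by
  simp only [toCoord, ofCoord, tractorExtend_apply,
    tangentCoordChange_inverse hx (mem_extChartAt_source x)]

theorem toCoord_sMinus (x₀ x : M) : toCoord x₀ x (sMinus n x) = (1, 0, 0) := by
  simp [toCoord, sMinus, tractorExtend_apply]

theorem ofCoord_sMinus (x₀ x : M) : ofCoord x₀ x (1, 0, 0) = sMinus n x := by
  simp [ofCoord, sMinus, tractorExtend_apply]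

/-- The point with given coordinates in the chart around `x₀`. -/
abbrev chartPoint (x₀ : M) (c : EuclideanSpace ℝ (Fin n)) : M := (extChartAt (𝓡 n) x₀).symm c

variable (g : SemiRiemannianMetric n p q M)

theorem sum_chartComponents (x₀ : M) (c v w : EuclideanSpace ℝ (Fin n)) :
    ∑ i, ∑ j, chartComponents g.val x₀ c i j * v i * w j =
      g.val (chartPoint x₀ c)
        (tangentCoordChange (𝓡 n) x₀ (chartPoint x₀ c) (chartPoint x₀ c) v)
        (tangentCoordChange (𝓡 n) x₀ (chartPoint x₀ c) (chartPoint x₀ c) w) := by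
  set A : EuclideanSpace ℝ (Fin n) →L[ℝ] EuclideanSpace ℝ (Fin n) :=
    tangentCoordChange (𝓡 n) x₀ (chartPoint x₀ c) (chartPoint x₀ c) with hA
  have key : ∀ (b : EuclideanSpace ℝ (Fin n) →L[ℝ] EuclideanSpace ℝ (Fin n) →L[ℝ] ℝ),
      ∑ i, ∑ j, b (A (EuclideanSpace.single i 1)) (A (EuclideanSpace.single j 1)) * v i * w j =
        b (A v) (A w) := by
    intro b
    conv_rhs => rw [← (EuclideanSpace.basisFun (Fin n) ℝ).sum_repr v,
      ← (EuclideanSpace.basisFun (Fin n) ℝ).sum_repr w]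
    simp only [map_sum, map_smul, sum_apply, smul_apply, smul_eq_mul, Finset.mul_sum,
      EuclideanSpace.basisFun_apply, EuclideanSpace.basisFun_repr]
    rw [Finset.sum_comm]
    exact Finset.sum_congr rfl fun i _ => Finset.sum_congr rfl fun j _ => by ring
  exact key (g.val (chartPoint x₀ c))

theorem tractorMetric_ofCoord (x₀ : M) (c : EuclideanSpace ℝ (Fin n)) (T T' : CoordTractor n) :
    tractorMetric g (chartPoint x₀ c) (ofCoord x₀ _ T) (ofCoord x₀ _ T') =
      coordMetric (chartComponents g.val x₀ c) T T' := by
  rw [coordMetric, sum_chartComponents]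
  rfl

theorem isMetricOn_chartComponents (x₀ : M) :
    IsMetricOn (chartComponents g.val x₀) (extChartAt (𝓡 n) x₀).target where
  isOpen := isOpen_extChartAt_target x₀
  smooth := g.smooth x₀
  symm := fun y _ i j => g.symm _ _ _
  det_ne_zero := by
    intro y hy hdet
    obtain ⟨v, hv, hv0⟩ := Matrix.exists_mulVec_eq_zero_iff.2 hdet
    have hsrc : chartPoint x₀ y ∈ (extChartAt (𝓡 n) x₀).source :=
      (extChartAt (𝓡 n) x₀).map_target hy
    have h1 : ∀ w : EuclideanSpace ℝ (Fin n),
        ∑ i, ∑ j, chartComponents g.val x₀ y i j * w i * v j = 0 := fun w => by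
      rw [sum_mul_eq_dotProduct, hv0, dotProduct_zero]
    set A : EuclideanSpace ℝ (Fin n) →L[ℝ] EuclideanSpace ℝ (Fin n) :=
      tangentCoordChange (𝓡 n) x₀ (chartPoint x₀ y) (chartPoint x₀ y) with hA
    have h2 : A (WithLp.toLp 2 v) = 0 := by
      refine g.nondegenerate (chartPoint x₀ y) fun w => ?_
      refine (g.symm _ _ _).trans ?_
      have h3 := h1 (tangentCoordChange (𝓡 n) (chartPoint x₀ y) x₀ (chartPoint x₀ y) w)
      rw [sum_chartComponents g x₀ y _ (WithLp.toLp 2 v)] at h3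
      exact (congrArg (fun z : EuclideanSpace ℝ (Fin n) => g.val (chartPoint x₀ y) z
        (A (WithLp.toLp 2 v))) (tangentCoordChange_inverse hsrc
          (mem_extChartAt_source _) w)).symm.trans h3
    have h4 := tangentCoordChange_inverse (mem_extChartAt_source (I := 𝓡 n) _) hsrc
      (WithLp.toLp 2 v : EuclideanSpace ℝ (Fin n))
    rw [← hA, h2, map_zero] at h4
    exact hv (by simpa using (congrArg WithLp.ofLp h4).symm)

variable {g} {x₀ : M} {U : Set (EuclideanSpace ℝ (Fin n))}
  {u : EuclideanSpace ℝ (Fin n) → Model p q →L[ℝ] CoordTractor n}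
  {ui : EuclideanSpace ℝ (Fin n) → CoordTractor n →L[ℝ] Model p q} {w₀ : Model p q}

/-- The frame of the tractor bundle given by a frame field in coordinates. -/
def IsFrameField.frame (hu : IsFrameField (chartComponents g.val x₀) U u ui w₀)
    (hU : U ⊆ (extChartAt (𝓡 n) x₀).target) {c : EuclideanSpace ℝ (Fin n)} (hc : c ∈ U) :
    Frame g (chartPoint x₀ c) where
  toEquiv := ContinuousLinearEquiv.equivOfInverse ((ofCoord x₀ (chartPoint x₀ c)).comp (u c))
    ((ui c).comp (toCoord x₀ (chartPoint x₀ c)))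
    (fun v => by
      simp only [ContinuousLinearMap.comp_apply]
      rw [toCoord_ofCoord ((extChartAt (𝓡 n) x₀).map_target (hU hc)), hu.inv_apply c hc])
    (fun T => by
      simp only [ContinuousLinearMap.comp_apply]
      rw [hu.apply_inv c hc, ofCoord_toCoord ((extChartAt (𝓡 n) x₀).map_target (hU hc))])
  isometry := fun v w =>
    (tractorMetric_ofCoord g x₀ c (u c v) (u c w)).trans (hu.isometry c hc v w)

theorem IsFrameField.frame_apply (hu : IsFrameField (chartComponents g.val x₀) U u ui w₀)
    (hU : U ⊆ (extChartAt (𝓡 n) x₀).target) {c : EuclideanSpace ℝ (Fin n)} (hc : c ∈ U)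
    (v : Model p q) : (hu.frame hU hc).toEquiv v = ofCoord x₀ (chartPoint x₀ c) (u c v) := rfl

/-- The chart around `x₀` contains the whole segment, so it serves at every time. -/
theorem isParallelAlong_ofCoord {c h : EuclideanSpace ℝ (Fin n)}
    (hc : ∀ t ∈ Icc (0 : ℝ) 1, c + t • h ∈ (extChartAt (𝓡 n) x₀).target)
    {S : ℝ → CoordTractor n} (hS : ∀ t ∈ Icc (0 : ℝ) 1, HasDerivWithinAt S
      (-tractorChristoffel (chartComponents g.val x₀) (c + t • h) h (S t)) (Icc 0 1) t) :
    IsParallelAlong g (fun t => chartPoint x₀ (c + t • h))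
      (fun t => ofCoord x₀ (chartPoint x₀ (c + t • h)) (S t)) := by
  intro t ht
  have hsrc : ∀ s ∈ Icc (0 : ℝ) 1, chartPoint x₀ (c + s • h) ∈ (extChartAt (𝓡 n) x₀).source :=
    fun s hs => (extChartAt (𝓡 n) x₀).map_target (hc s hs)
  refine ⟨x₀, by simpa only [extChartAt_source] using hsrc t ht, ?_⟩
  have hcoord : ∀ s ∈ Icc (0 : ℝ) 1,
      extChartAt (𝓡 n) x₀ (chartPoint x₀ (c + s • h)) = c + s • h :=
    fun s hs => (extChartAt (𝓡 n) x₀).right_inv (hc s hs)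
  have hvec : ∀ s ∈ Icc (0 : ℝ) 1, tangentCoordChange (𝓡 n) (chartPoint x₀ (c + s • h)) x₀
      (chartPoint x₀ (c + s • h)) (ofCoord x₀ (chartPoint x₀ (c + s • h)) (S s)).2.1 =
        (S s).2.1 := fun s hs =>
    tangentCoordChange_inverse (mem_extChartAt_source _) (hsrc s hs) _
  have hline : HasDerivWithinAt (fun t : ℝ => c + t • h) h (Icc 0 1) t := by
    have := (((hasDerivAt_id t).smul_const h).const_add c).hasDerivWithinAt (s := Icc 0 1)
    rwa [one_smul] at this
  have hder : derivWithin (fun s => extChartAt (𝓡 n) x₀ (chartPoint x₀ (c + s • h)))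
      (Icc 0 1) t = h :=
    (hline.congr (fun s hs => hcoord s hs) (hcoord t ht)).derivWithin
      (uniqueDiffOn_Icc one_pos t ht)
  have h1 : HasDerivWithinAt (fun s => (S s).1) _ (Icc 0 1) t :=
    (ContinuousLinearMap.fst ℝ ℝ (EuclideanSpace ℝ (Fin n) × ℝ)).hasFDerivAt.comp_hasDerivWithinAt
      t (hS t ht)
  have h2 : HasDerivWithinAt (fun s => (S s).2.1) _ (Icc 0 1) t :=
    ((ContinuousLinearMap.fst ℝ (EuclideanSpace ℝ (Fin n)) ℝ).comp
      (ContinuousLinearMap.snd ℝ ℝ _)).hasFDerivAt.comp_hasDerivWithinAt t (hS t ht)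
  have h3 : HasDerivWithinAt (fun s => (S s).2.2) _ (Icc 0 1) t :=
    ((ContinuousLinearMap.snd ℝ (EuclideanSpace ℝ (Fin n)) ℝ).comp
      (ContinuousLinearMap.snd ℝ ℝ _)).hasFDerivAt.comp_hasDerivWithinAt t (hS t ht)
  dsimp only
  rw [hcoord t ht, hvec t ht, hder]
  refine ⟨h1.congr_deriv ?_, (h2.congr (fun s hs => hvec s hs) (hvec t ht)).congr_deriv ?_,
    h3.congr_deriv ?_⟩
  · simp [tractorChristoffel_apply]
  · ext k
    simp [tractorChristoffel_apply, ofCoord, tractorExtend_apply]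
    ring
  · simp [tractorChristoffel_apply]

end LocalTractors

/-! ### The parallel section as a smooth map in a frame field -/

section LocalSection

variable {n p q : ℕ} {M : Type*} [TopologicalSpace M]
  [ChartedSpace (EuclideanSpace ℝ (Fin n)) M] [IsManifold (𝓡 n) ∞ M]
  {g : SemiRiemannianMetric n p q M} {x₀ : M} {U : Set (EuclideanSpace ℝ (Fin n))}
  {u : EuclideanSpace ℝ (Fin n) → Model p q →L[ℝ] CoordTractor n}
  {ui : EuclideanSpace ℝ (Fin n) → CoordTractor n →L[ℝ] Model p q} {w₀ : Model p q}

/-- All fibres `Tractor n x` are the same type, so tractors at two points can be compared once the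
points are shown to be equal. -/
theorem ofCoord_congr (x₀ : M) {x y : M} (h : x = y) (T : CoordTractor n) :
    (ofCoord x₀ x T : CoordTractor n) = ofCoord x₀ y T := by
  subst h; rfl

/-- Writing the transport as `u(c + h) ∘ b ∘ u(c)⁻¹` exhibits the parallel frame as `u(c + h)` acted
on by `b`, a form to which equivariance applies. -/
theorem IsFrameField.isParallelTransport
    (hu : IsFrameField (chartComponents g.val x₀) U u ui w₀)
    (hU : U ⊆ (extChartAt (𝓡 n) x₀).target) {c h : EuclideanSpace ℝ (Fin n)}
    (hc : c ∈ U) (hch : c + h ∈ U) (hseg : ∀ t ∈ Icc (0 : ℝ) 1, c + t • h ∈ U)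
    {Φ : EuclideanSpace ℝ (Fin n) → ℝ → CoordTractor n →L[ℝ] CoordTractor n} (h0 : Φ h 0 = 1)
    (hΦ : ∀ t ∈ Icc (0 : ℝ) 1, HasDerivWithinAt (Φ h)
      (-tractorChristoffel (chartComponents g.val x₀) (c + t • h) h * Φ h t) (Icc 0 1) t)
    (b : orthogonalGroup p q) (hb : ((b : Model p q ≃L[ℝ] Model p q) : Model p q →L[ℝ] Model p q) =
      transition u ui (fun h => Φ h 1) c h) :
    IsParallelTransport g (chartPoint x₀ c) (chartPoint x₀ (c + h))
      ((hu.frame hU hc).toEquiv.symm.trans ((b : Model p q ≃L[ℝ] Model p q).trans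
        (hu.frame hU hch).toEquiv)) := by
  refine IsParallelTransport.smooth _ _ (fun t => chartPoint x₀ (c + t • h)) _ ?_
    (by simp) (by simp) fun v => ?_
  · refine (contMDiffOn_extChartAt_symm x₀).comp (t := (extChartAt (𝓡 n) x₀).target) ?_
      fun t ht => hU (hseg t ht)
    have : ContDiff ℝ ∞ fun t : ℝ => c + t • h := by fun_prop
    exact this.contMDiff.contMDiffOn
  · refine ⟨fun t => ofCoord x₀ (chartPoint x₀ (c + t • h))
      (Φ h t (toCoord x₀ (chartPoint x₀ c) v)),
      isParallelAlong_ofCoord (fun t ht => hU (hseg t ht)) fun t ht => ?_, ?_, ?_⟩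
    · exact ((ContinuousLinearMap.apply ℝ (CoordTractor n)
        (toCoord x₀ (chartPoint x₀ c) v)).hasFDerivAt).comp_hasDerivWithinAt t (hΦ t ht)
    · have h1 := ofCoord_toCoord ((extChartAt (𝓡 n) x₀).map_target (hU hc)) v
      have h2 : toCoord x₀ (chartPoint x₀ c) v = Φ h 0 (toCoord x₀ (chartPoint x₀ c) v) := by
        rw [h0]; rfl
      rw [h2] at h1
      have h3 : chartPoint x₀ (c + (0 : ℝ) • h) = chartPoint x₀ c := by simp
      exact Eq.trans (α := CoordTractor n) (ofCoord_congr x₀ h3 _) h1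
    · have h1 : (b : Model p q ≃L[ℝ] Model p q) (ui c (toCoord x₀ (chartPoint x₀ c) v)) =
          transition u ui (fun h => Φ h 1) c h (ui c (toCoord x₀ (chartPoint x₀ c) v)) :=
        DFunLike.congr_fun hb _
      have h2 : u (c + h) ((b : Model p q ≃L[ℝ] Model p q)
          (ui c (toCoord x₀ (chartPoint x₀ c) v))) = Φ h 1 (toCoord x₀ (chartPoint x₀ c) v) := by
        rw [h1]
        simp only [transition, ContinuousLinearMap.comp_apply]
        rw [hu.apply_inv _ hch, hu.apply_inv _ hc]
      have h3 : chartPoint x₀ (c + (1 : ℝ) • h) = chartPoint x₀ (c + h) := by rw [one_smul]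
      have h4 := congrArg (ofCoord x₀ (chartPoint x₀ (c + h))) h2
      exact Eq.trans (α := CoordTractor n) (ofCoord_congr x₀ h3 _) h4.symm

variable {V : Type*} [NormedAddCommGroup V] [NormedSpace ℝ V]
  {ρ : Representation ℝ (orthogonalGroup p q) V}

open Classical in
/-- The coordinate expression of a parallel section with respect to a frame field. -/
def IsFrameField.localSection (hu : IsFrameField (chartComponents g.val x₀) U u ui w₀)
    (hU : U ⊆ (extChartAt (𝓡 n) x₀).target) (ψ : ParallelSection g ρ)
    (c : EuclideanSpace ℝ (Fin n)) : V :=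
  if hc : c ∈ U then ψ.toFun _ (hu.frame hU hc) else 0

theorem IsFrameField.localSection_of_mem
    (hu : IsFrameField (chartComponents g.val x₀) U u ui w₀)
    (hU : U ⊆ (extChartAt (𝓡 n) x₀).target) (ψ : ParallelSection g ρ)
    {c : EuclideanSpace ℝ (Fin n)} (hc : c ∈ U) :
    hu.localSection hU ψ c = ψ.toFun _ (hu.frame hU hc) := dif_pos hc

variable {F : (Model p q →L[ℝ] Model p q) → V →L[ℝ] V}

/-- The parallel frame that starts at `u(c)` ends at `u(c + h)·b`, with `b` the transition matrix.
Constancy of the section along it and equivariance give `f(c) = ρ(b⁻¹) f(c + h)`. -/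
theorem IsFrameField.exists_localSection_add
    (hu : IsFrameField (chartComponents g.val x₀) U u ui w₀)
    (hU : U ⊆ (extChartAt (𝓡 n) x₀).target) (ψ : ParallelSection g ρ)
    (hF : ∀ (a : orthogonalGroup p q) (v : V),
      F ((a : Model p q ≃L[ℝ] Model p q) : Model p q →L[ℝ] Model p q) v = ρ a v)
    {c : EuclideanSpace ℝ (Fin n)} (hc : c ∈ U) :
    ∃ (r : ℝ) (a : EuclideanSpace ℝ (Fin n) → Model p q →L[ℝ] Model p q), 0 < r ∧
      HasFDerivAt a (frameForm (chartComponents g.val x₀) u ui c) 0 ∧ a 0 = 1 ∧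
      ∀ h, ‖h‖ < r → c + h ∈ U ∧ a h ∈ stab 0 ∧
        hu.localSection hU ψ (c + h) = F (a h) (hu.localSection hU ψ c) := by
  obtain ⟨r, Φ, hr, hΦd, hΦ0, hΦ⟩ := exists_transport_family hu.isMetricOn.isOpen
    hu.isMetricOn.contDiffOn_tractorChristoffel.continuousOn hc
  refine ⟨r, transition u ui (fun h => Φ h 1) c, hr, hu.hasFDerivAt_transition hc hΦd hΦ0,
    hu.transition_zero hc hΦ0, fun h hh => ?_⟩
  obtain ⟨hseg, h0, hd⟩ := hΦ h hh
  have hch : c + h ∈ U := by simpa using hseg 1 (right_mem_Icc.2 zero_le_one)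
  have hstab := hu.transition_mem_stab (A := fun h => Φ h 1) hc hch
    (hu.isMetricOn.coordMetric_transport hseg h0 hd)
  refine ⟨hch, hstab, ?_⟩
  obtain ⟨b, hb⟩ := exists_orthogonalGroup hstab
  have h1 := ψ.parallel _ _ _ (hu.isParallelTransport hU hc hch hseg h0 hd b hb) (hu.frame hU hc)
    ((hu.frame hU hch).act b) (fun w => by simp [Frame.act])
  rw [ψ.equivariant] at h1
  rw [hu.localSection_of_mem hU ψ hc, hu.localSection_of_mem hU ψ hch, ← hb, hF, ← h1,
    ← Module.End.mul_apply, ← map_mul, mul_inv_cancel, map_one, Module.End.one_apply]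

/-- Differentiating `f(c + h) = F (a h) f(c)` at `h = 0` gives a differential equation linear in
`f`. It yields both smoothness and the position of `df` relative to the orbits. -/
theorem IsFrameField.hasFDerivAt_localSection
    (hu : IsFrameField (chartComponents g.val x₀) U u ui w₀)
    (hU : U ⊆ (extChartAt (𝓡 n) x₀).target) (ψ : ParallelSection g ρ)
    (hF : ∀ (a : orthogonalGroup p q) (v : V),
      F ((a : Model p q ≃L[ℝ] Model p q) : Model p q →L[ℝ] Model p q) v = ρ a v)
    (hFd : ContDiff ℝ ∞ F) {c : EuclideanSpace ℝ (Fin n)} (hc : c ∈ U) :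
    HasFDerivAt (hu.localSection hU ψ)
      (((fderiv ℝ F 1).comp (frameForm (chartComponents g.val x₀) u ui c)).flip
        (hu.localSection hU ψ c)) c := by
  obtain ⟨r, a, hr, ha, ha0, H⟩ := hu.exists_localSection_add hU ψ hF hc
  have h1 : HasFDerivAt F (fderiv ℝ F 1) (a 0) := by
    rw [ha0]; exact (hFd.differentiable (by simp) _).hasFDerivAt
  have h2 := h1.comp (0 : EuclideanSpace ℝ (Fin n)) ha
  have h3 := ((ContinuousLinearMap.apply ℝ V (hu.localSection hU ψ c)).hasFDerivAt
    (x := F (a 0))).comp (0 : EuclideanSpace ℝ (Fin n)) h2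
  have h4 : HasFDerivAt (fun h => hu.localSection hU ψ (c + h))
      (((fderiv ℝ F 1).comp (frameForm (chartComponents g.val x₀) u ui c)).flip
        (hu.localSection hU ψ c)) 0 := by
    refine HasFDerivAt.congr_of_eventuallyEq (f := fun h => F (a h) (hu.localSection hU ψ c)) h3 ?_
    filter_upwards [Metric.ball_mem_nhds (0 : EuclideanSpace ℝ (Fin n)) hr] with h hh
    exact (H h (by simpa using hh)).2.2
  have h5 : HasFDerivAt (fun y : EuclideanSpace ℝ (Fin n) => y - c)
      (ContinuousLinearMap.id ℝ _) c := (hasFDerivAt_id c).sub_const c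
  have h6 : HasFDerivAt (fun h => hu.localSection hU ψ (c + h))
      (((fderiv ℝ F 1).comp (frameForm (chartComponents g.val x₀) u ui c)).flip
        (hu.localSection hU ψ c)) (c - c) := by rwa [sub_self]
  have h7 := HasFDerivAt.comp (f := fun y => y - c) c h6 h5
  rw [ContinuousLinearMap.comp_id] at h7
  refine h7.congr_of_eventuallyEq (Filter.Eventually.of_forall fun y => ?_)
  simp

theorem contDiffOn_flip_comp {X A V W : Type*} [NormedAddCommGroup X] [NormedSpace ℝ X]
    [NormedAddCommGroup A] [NormedSpace ℝ A] [NormedAddCommGroup V] [NormedSpace ℝ V]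
    [NormedAddCommGroup W] [NormedSpace ℝ W] {L : X → X →L[ℝ] A} {U : Set X}
    (hL : ContDiffOn ℝ ∞ L U) (T : A →L[ℝ] V →L[ℝ] W) :
    ContDiffOn ℝ ∞ (fun c => (T.comp (L c)).flip) U := by
  have h1 : ContDiffOn ℝ ∞ (fun c => T.comp (L c)) U := contDiffOn_const.clm_comp hL
  exact ContDiff.comp_contDiffOn (F := X →L[ℝ] V →L[ℝ] W) (G := V →L[ℝ] X →L[ℝ] W)
    (LinearIsometryEquiv.contDiff (E := X →L[ℝ] V →L[ℝ] W) (F := V →L[ℝ] X →L[ℝ] W)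
      (ContinuousLinearMap.flipₗᵢ ℝ X V W)) h1

theorem IsFrameField.contDiffOn_localSection
    (hu : IsFrameField (chartComponents g.val x₀) U u ui w₀)
    (hU : U ⊆ (extChartAt (𝓡 n) x₀).target) (ψ : ParallelSection g ρ)
    (hF : ∀ (a : orthogonalGroup p q) (v : V),
      F ((a : Model p q ≃L[ℝ] Model p q) : Model p q →L[ℝ] Model p q) v = ρ a v)
    (hFd : ContDiff ℝ ∞ F) : ContDiffOn ℝ ∞ (hu.localSection hU ψ) U :=
  contDiffOn_of_linear_ode hu.isMetricOn.isOpen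
    (contDiffOn_flip_comp hu.contDiffOn_frameForm (fderiv ℝ F 1))
    fun _ hc => hu.hasFDerivAt_localSection hU ψ hF hFd hc

/-- The Cartan connection is surjective modulo the stabiliser of the line. -/
theorem IsFrameField.exists_sub_frameForm_mem_stabAlg
    (hu : IsFrameField (chartComponents g.val x₀) U u ui w₀) {ℓ : Model p q}
    {c : EuclideanSpace ℝ (Fin n)} (hc : c ∈ U) {r : ℝ} (hr : r ≠ 0)
    (hℓ : u c ℓ = r • ((1, 0, 0) : CoordTractor n)) {X : Model p q →L[ℝ] Model p q}
    (hX : X ∈ stabAlg 0) :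
    ∃ h, X - frameForm (chartComponents g.val x₀) u ui c h ∈ stabAlg ℓ := by
  set T : CoordTractor n := u c (X ℓ) with hT
  -- By `frameForm_apply_of_eq_smul` this vector cancels the tangent component of `u c (X ℓ)`.
  refine ⟨-(r⁻¹ • T.2.1), ?_⟩
  have h1 := Submodule.sub_mem _ hX (hu.frameForm_mem_stabAlg hc (-(r⁻¹ • T.2.1)))
  refine ⟨h1.1, ?_⟩
  -- Skewness makes `X ℓ` orthogonal to `ℓ`, which removes the `s₊`-component.
  have h2 : T.2.2 = 0 := by
    have h3 := hX.1 ℓ ℓ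
    rw [modelForm_comm ℓ (X ℓ), ← two_mul, ← hu.isometry c hc, ← hT, hℓ] at h3
    simpa [coordMetric, hr] using h3
  rw [sub_apply, hu.frameForm_apply_of_eq_smul hc hℓ, ← hu.inv_apply c hc (X ℓ), ← hT, ← map_smul,
    sub_neg_eq_add, ← map_add]
  have h4 : T + r • ((0, -(r⁻¹ • T.2.1), 0) : CoordTractor n) =
      (T.1 * r⁻¹) • u c ℓ := by
    rw [hℓ]
    refine Prod.ext ?_ (Prod.ext ?_ ?_)
    · simp [hr]
    · simp [smul_smul, hr]
    · simp [h2]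
  rw [h4, map_smul, hu.inv_apply c hc]
  exact Submodule.smul_mem _ _ (Submodule.mem_span_singleton_self ℓ)

end LocalSection

/-! ### Transitivity of the orthogonal group on lightlike vectors -/

section Witt

variable {p q : ℕ}

/-- The Cartan involution of `ℝ^{p+1,q+1}`. -/
def cartanInvolution (v : Model p q) : Model p q :=
  Sum.elim (fun i => -v (Sum.inl i)) (fun j => v (Sum.inr j))

theorem modelForm_cartanInvolution_left (v w : Model p q) :
    modelForm p q (cartanInvolution v) w =
      ∑ i, v (Sum.inl i) * w (Sum.inl i) + ∑ j, v (Sum.inr j) * w (Sum.inr j) := by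
  simp [modelForm, cartanInvolution]

theorem modelForm_cartanInvolution (v w : Model p q) :
    modelForm p q (cartanInvolution v) (cartanInvolution w) = modelForm p q v w := by
  simp [modelForm, cartanInvolution]

theorem modelForm_cartanInvolution_self_ne_zero {v : Model p q} (hv : v ≠ 0) :
    modelForm p q (cartanInvolution v) v ≠ 0 := by
  rw [modelForm_cartanInvolution_left, ← Fintype.sum_sum_type (fun i => v i * v i)]
  intro h
  refine hv (funext fun i => ?_)
  have := (Finset.sum_eq_zero_iff_of_nonneg (fun i _ => mul_self_nonneg (v i))).1 h i
    (Finset.mem_univ i)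
  exact mul_self_eq_zero.1 this

theorem cartanInvolution_add (v w : Model p q) :
    cartanInvolution (v + w) = cartanInvolution v + cartanInvolution w := by
  funext i
  rcases i with i | i <;> simp [cartanInvolution] ; ring

/-- The reflection in the hyperplane orthogonal to `d`. -/
def modelReflection (d : Model p q) : Model p q →L[ℝ] Model p q :=
  LinearMap.toContinuousLinearMap
    (LinearMap.id - ((2 / modelForm p q d d) • modelBilin p q d).smulRight d)

theorem modelReflection_apply (d v : Model p q) :
    modelReflection d v = v - (2 / modelForm p q d d * modelForm p q d v) • d := rfl

theorem modelReflection_mem_stab {d : Model p q} (hd : modelForm p q d d ≠ 0) :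
    modelReflection d ∈ stab 0 := by
  refine ⟨fun v w => ?_, by simp⟩
  simp only [modelReflection_apply, modelForm_sub_left, modelForm_sub_right, modelForm_smul_left,
    modelForm_smul_right]
  rw [modelForm_comm v d]
  field_simp
  ring

/-- The difference `v - w` has square `-2⟨v, w⟩ ≠ 0`, so the reflection in its orthogonal hyperplane
exists, and it exchanges `v` and `w`. -/
theorem exists_mem_stab_apply_eq_of_ne {v w : Model p q} (hv : modelForm p q v v = 0)
    (hw : modelForm p q w w = 0) (hvw : modelForm p q v w ≠ 0) : ∃ a ∈ stab 0, a v = w := by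
  have hd : modelForm p q (v - w) (v - w) = -2 * modelForm p q v w := by
    simp only [modelForm_sub_left, modelForm_sub_right, hv, hw, modelForm_comm w v]
    ring
  have hd0 : modelForm p q (v - w) (v - w) ≠ 0 := by
    rw [hd]; exact mul_ne_zero (by norm_num) hvw
  refine ⟨_, modelReflection_mem_stab hd0, ?_⟩
  rw [modelReflection_apply, hd, modelForm_sub_left, hv, modelForm_comm w v]
  have : 2 / (-2 * modelForm p q v w) * (0 - modelForm p q v w) = 1 := by field_simp; ring
  rw [this]
  simp

/-- The orthogonal group acts transitively on nonzero lightlike vectors. -/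
theorem exists_mem_stab_apply_eq {v w : Model p q} (hv0 : v ≠ 0) (hw0 : w ≠ 0)
    (hv : modelForm p q v v = 0) (hw : modelForm p q w w = 0) : ∃ a ∈ stab 0, a v = w := by
  by_cases hvw : modelForm p q v w = 0
  -- Orthogonal vectors are joined through a lightlike `z` orthogonal to neither. With `θ` the
  -- Cartan involution, for which `⟨θv, v⟩ > 0`, take `z = θv` if `⟨θv, w⟩ ≠ 0` and `z = θ(v + w)`
  -- otherwise.
  · obtain ⟨z, hz, hvz, hzw⟩ : ∃ z, modelForm p q z z = 0 ∧ modelForm p q v z ≠ 0 ∧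
        modelForm p q z w ≠ 0 := by
      have hs : modelForm p q (cartanInvolution w) v = modelForm p q (cartanInvolution v) w := by
        simp only [modelForm_cartanInvolution_left, mul_comm]
      by_cases hc : modelForm p q (cartanInvolution v) w = 0
      · refine ⟨cartanInvolution (v + w), ?_, ?_, ?_⟩
        · rw [modelForm_cartanInvolution]
          simp [modelForm_add_left, modelForm_add_right, hv, hw, hvw, modelForm_comm w v]
        · rw [modelForm_comm, cartanInvolution_add, modelForm_add_left, hs, hc, add_zero]
          exact modelForm_cartanInvolution_self_ne_zero hv0
        · rw [cartanInvolution_add, modelForm_add_left, hc, zero_add]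
          exact modelForm_cartanInvolution_self_ne_zero hw0
      · refine ⟨cartanInvolution v, ?_, ?_, hc⟩
        · rw [modelForm_cartanInvolution, hv]
        · rw [modelForm_comm]
          exact modelForm_cartanInvolution_self_ne_zero hv0
    obtain ⟨a, ha, rfl⟩ := exists_mem_stab_apply_eq_of_ne hv hz hvz
    obtain ⟨b, hb, rfl⟩ := exists_mem_stab_apply_eq_of_ne hz hw hzw
    exact ⟨b * a, mul_mem_stab hb ha, rfl⟩
  · exact exists_mem_stab_apply_eq_of_ne hv hw hvw

end Witt

/-! ### Existence of adapted frames, `P`-types and stabilisers -/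

section Frames

variable {n p q : ℕ} {M : Type*} [TopologicalSpace M]
  [ChartedSpace (EuclideanSpace ℝ (Fin n)) M] [IsManifold (𝓡 n) ∞ M]
  {g : SemiRiemannianMetric n p q M} {ℓ : Model p q} {x y : M}

theorem SemiRiemannianMetric.add_eq (g : SemiRiemannianMetric n p q M) (x : M) : p + q = n := by
  obtain ⟨b, -⟩ := g.signature x
  have h1 := Module.finrank_eq_card_basis b
  have h2 : Module.finrank ℝ (TangentSpace (𝓡 n) x) = n := finrank_euclideanSpace_fin
  rw [h2] at h1
  simpa using h1.symm

theorem exists_frame (g : SemiRiemannianMetric n p q M) (x : M) : Nonempty (Frame g x) := by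
  obtain ⟨b, hb⟩ := g.signature x
  let Y : Model p q →ₗ[ℝ] EuclideanSpace ℝ (Fin n) :=
    (b.equivFun.symm : _ →ₗ[ℝ] TangentSpace (𝓡 n) x) ∘ₗ
      LinearMap.funLeft ℝ ℝ (Sum.map Fin.succ Fin.succ)
  let e : Fin (p + 1) ⊕ Fin (q + 1) → Model p q →ₗ[ℝ] ℝ := fun i => LinearMap.proj i
  -- With `v₊`, `v₋` the first positive and negative coordinates, `α = v₊ + v₋` and `β = (v₊ -
  -- v₋)/2` give `2αβ = v₊² - v₋²`.
  let L : Model p q →ₗ[ℝ] Tractor n x :=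
    LinearMap.prod (e (Sum.inr 0) + e (Sum.inl 0))
      (LinearMap.prod Y ((1 / 2 : ℝ) • (e (Sum.inr 0) - e (Sum.inl 0))))
  have hY : ∀ v w : Model p q, g.val x (Y v) (Y w) =
      -(∑ i : Fin p, v (Sum.inl i.succ) * w (Sum.inl i.succ)) +
        ∑ j : Fin q, v (Sum.inr j.succ) * w (Sum.inr j.succ) := by
    intro v w
    have h1 : ∀ v : Model p q, (Y v : TangentSpace (𝓡 n) x) =
        ∑ k, v (Sum.map Fin.succ Fin.succ k) • b k := fun v => b.equivFun_symm_apply _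
    rw [h1 v, h1 w]
    simp only [map_sum, sum_apply, map_smul, smul_apply, hb, Matrix.diagonal_apply, smul_eq_mul]
    simp [Fintype.sum_sum_type, mul_comm]
  have hL : ∀ v w, tractorMetric g x (L v) (L w) = modelForm p q v w := by
    intro v w
    have h1 : tractorMetric g x (L v) (L w) =
        (v (Sum.inr 0) + v (Sum.inl 0)) * ((1 / 2) * (w (Sum.inr 0) - w (Sum.inl 0))) +
        (w (Sum.inr 0) + w (Sum.inl 0)) * ((1 / 2) * (v (Sum.inr 0) - v (Sum.inl 0))) +
        g.val x (Y v) (Y w) := rfl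
    rw [h1, hY, modelForm, Fin.sum_univ_succ, Fin.sum_univ_succ]
    ring
  have hinj : Function.Injective L := by
    rw [injective_iff_map_eq_zero]
    intro v hv
    refine modelForm_nondegenerate fun w => ?_
    rw [← hL, hv]
    have := tractorMetric_smul_left g x 0 (L w) (L w)
    rwa [zero_smul, zero_mul] at this
  have hrank : Module.finrank ℝ (Model p q) = Module.finrank ℝ (Tractor n x) := by
    have := g.add_eq x
    simp [Module.finrank_prod]
    omega
  exact ⟨⟨(L.linearEquivOfInjective hinj hrank).toContinuousLinearEquiv, hL⟩⟩

theorem Frame.modelForm_symm (u : Frame g x) (T T' : Tractor n x) :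
    modelForm p q (u.toEquiv.symm T) (u.toEquiv.symm T') = tractorMetric g x T T' := by
  rw [← u.isometry, u.toEquiv.apply_symm_apply, u.toEquiv.apply_symm_apply]

theorem tractorMetric_sMinus_right (g : SemiRiemannianMetric n p q M) (x : M) (T : Tractor n x) :
    tractorMetric g x T (sMinus n x) = T.2.2 := by
  have h : g.val x T.2.1 (sMinus n x).2.1 = 0 := (g.val x T.2.1).map_zero
  simp only [tractorMetric] at h ⊢
  rw [h]
  simp [sMinus]

theorem tractorMetric_sMinus_self (g : SemiRiemannianMetric n p q M) (x : M) :
    tractorMetric g x (sMinus n x) (sMinus n x) = 0 :=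
  tractorMetric_sMinus_right g x _

omit [TopologicalSpace M] [ChartedSpace (EuclideanSpace ℝ (Fin n)) M] [IsManifold (𝓡 n) ∞ M] in
theorem sMinus_ne_zero (x : M) : sMinus n x ≠ 0 := by
  simp [sMinus]

theorem Frame.IsAdapted.exists_eq_smul {u : Frame g x} (hu : u.IsAdapted ℓ) (hℓ : ℓ ≠ 0) :
    ∃ r : ℝ, r ≠ 0 ∧ u.toEquiv ℓ = r • sMinus n x := by
  obtain ⟨r, hr⟩ := Submodule.mem_span_singleton.1 hu
  refine ⟨r, ?_, hr.symm⟩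
  rintro rfl
  rw [zero_smul] at hr
  exact hℓ (u.toEquiv.map_eq_zero_iff.1 hr.symm)

/-- Any frame becomes adapted after an isometry that moves `ℓ` to the preimage of `s₋`. -/
theorem exists_isAdapted (g : SemiRiemannianMetric n p q M) (x : M) (hℓ : ℓ ≠ 0)
    (hℓℓ : modelForm p q ℓ ℓ = 0) : ∃ u : Frame g x, u.IsAdapted ℓ := by
  obtain ⟨u⟩ := exists_frame g x
  obtain ⟨a, ha, hal⟩ := exists_mem_stab_apply_eq hℓ (w := u.toEquiv.symm (sMinus n x))
    (fun h => sMinus_ne_zero x (u.toEquiv.symm.map_eq_zero_iff.1 h)) hℓℓ (by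
      rw [u.modelForm_symm, tractorMetric_sMinus_self])
  obtain ⟨b, hb⟩ := exists_orthogonalGroup ha
  refine ⟨u.act b, ?_⟩
  have h1 : (b : Model p q ≃L[ℝ] Model p q) ℓ = u.toEquiv.symm (sMinus n x) :=
    (DFunLike.congr_fun hb ℓ).trans hal
  have h2 : (u.act b).toEquiv ℓ = sMinus n x := by
    simp only [Frame.act, ContinuousLinearEquiv.trans_apply, h1,
      ContinuousLinearEquiv.apply_symm_apply]
  rw [Frame.IsAdapted, h2]
  exact Submodule.mem_span_singleton_self _

theorem Frame.exists_act_eq (u u' : Frame g x) : ∃ a : orthogonalGroup p q, u' = u.act a ∧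
    ∀ v, (a : Model p q ≃L[ℝ] Model p q) v = u.toEquiv.symm (u'.toEquiv v) := by
  refine ⟨⟨u'.toEquiv.trans u.toEquiv.symm, fun v w => ?_⟩, ?_, fun v => rfl⟩
  · simp only [ContinuousLinearEquiv.trans_apply]
    rw [u.modelForm_symm, u'.isometry]
  · obtain ⟨e, he⟩ := u'
    have h1 : e = (e.trans u.toEquiv.symm).trans u.toEquiv := by
      ext v : 2
      simp
    simp only [Frame.act]
    congr 1

variable {V : Type*} [NormedAddCommGroup V] [NormedSpace ℝ V]
  {ρ : Representation ℝ (orthogonalGroup p q) V} (ψ : ParallelSection g ρ)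

theorem representation_inv_apply_apply (a : orthogonalGroup p q) (v : V) : ρ a (ρ a⁻¹ v) = v := by
  rw [← Module.End.mul_apply, ← map_mul, mul_inv_cancel, map_one, Module.End.one_apply]

theorem coe_inv_mul (a : orthogonalGroup p q) :
    (((a⁻¹ : orthogonalGroup p q) : Model p q ≃L[ℝ] Model p q) : Model p q →L[ℝ] Model p q) *
      ((a : Model p q ≃L[ℝ] Model p q) : Model p q →L[ℝ] Model p q) = 1 :=
  ContinuousLinearMap.ext fun v => (a : Model p q ≃L[ℝ] Model p q).symm_apply_apply v

theorem coe_inv_mem_stab {a : orthogonalGroup p q}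
    (ha : ((a : Model p q ≃L[ℝ] Model p q) : Model p q →L[ℝ] Model p q) ∈ stab ℓ) :
    (((a⁻¹ : orthogonalGroup p q) : Model p q ≃L[ℝ] Model p q) : Model p q →L[ℝ] Model p q) ∈
      stab ℓ := by
  obtain ⟨b, hb, hab, -⟩ := exists_inv_stab ha
  have h1 : (((a⁻¹ : orthogonalGroup p q) : Model p q ≃L[ℝ] Model p q) :
      Model p q →L[ℝ] Model p q) = b := left_inv_eq_right_inv (coe_inv_mul a) hab
  rwa [h1]

/-- The adapted frames at `x` are exactly the `u·a` with `a` in the stabiliser of the line, and the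
section is equivariant. -/
theorem ParallelSection.pType_eq {F : (Model p q →L[ℝ] Model p q) → V →L[ℝ] V}
    (hF : ∀ (a : orthogonalGroup p q) (v : V),
      F ((a : Model p q ≃L[ℝ] Model p q) : Model p q →L[ℝ] Model p q) v = ρ a v)
    (hℓ : ℓ ≠ 0) {u : Frame g x} (hu : u.IsAdapted ℓ) :
    ψ.pType ℓ x = {v | ∃ a ∈ stab ℓ, F a (ψ.toFun x u) = v} := by
  obtain ⟨r, hr, hur⟩ := hu.exists_eq_smul hℓ
  have hs : u.toEquiv.symm (sMinus n x) = r⁻¹ • ℓ := by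
    rw [ContinuousLinearEquiv.symm_apply_eq, map_smul, hur, smul_smul, inv_mul_cancel₀ hr, one_smul]
  ext v
  constructor
  · rintro ⟨u', hu', rfl⟩
    obtain ⟨a, rfl, ha⟩ := u.exists_act_eq u'
    have h1 : ((a : Model p q ≃L[ℝ] Model p q) : Model p q →L[ℝ] Model p q) ∈ stab ℓ := by
      refine ⟨a.2, ?_⟩
      obtain ⟨s, -, hs'⟩ := hu'.exists_eq_smul hℓ
      have h2 := ha ℓ
      rw [hs', map_smul, hs, smul_smul] at h2
      exact Submodule.mem_span_singleton.2 ⟨_, h2.symm⟩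
    exact ⟨_, coe_inv_mem_stab h1, by rw [hF, ψ.equivariant]⟩
  · rintro ⟨a, ha, rfl⟩
    obtain ⟨b, rfl⟩ := exists_orthogonalGroup (stab_subset ℓ ha)
    refine ⟨u.act b⁻¹, ?_, by rw [ψ.equivariant, inv_inv, hF]⟩
    obtain ⟨s, hs⟩ := Submodule.mem_span_singleton.1 (coe_inv_mem_stab ha).2
    have h1 : (u.act b⁻¹).toEquiv ℓ =
        u.toEquiv (((b⁻¹ : orthogonalGroup p q) : Model p q ≃L[ℝ] Model p q) ℓ) := rfl
    have h2 : ((b⁻¹ : orthogonalGroup p q) : Model p q ≃L[ℝ] Model p q) ℓ = s • ℓ := hs.symm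
    rw [Frame.IsAdapted, h1, h2, map_smul]
    exact Submodule.smul_mem _ _ hu

/-- A change of frame by `b` conjugates `a` by `b`, so the stabiliser can be read off in any fixed
frame. -/
theorem ParallelSection.mem_stabiliser_iff (u : Frame g x) (A : Tractor n x ≃L[ℝ] Tractor n x) :
    A ∈ ψ.stabiliser x ↔ ∃ a : orthogonalGroup p q, ρ a (ψ.toFun x u) = ψ.toFun x u ∧
      ∀ w, A (u.toEquiv w) = u.toEquiv ((a : Model p q ≃L[ℝ] Model p q) w) := by
  refine ⟨?_, fun ⟨a, ha⟩ => ⟨u, a, ha⟩⟩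
  rintro ⟨u', a, ha, hA⟩
  obtain ⟨b, rfl, -⟩ := u.exists_act_eq u'
  rw [ψ.equivariant] at ha
  refine ⟨b * a * b⁻¹, ?_, fun w => ?_⟩
  · rw [map_mul, map_mul, Module.End.mul_apply, Module.End.mul_apply, ha,
      representation_inv_apply_apply]
  · have h1 := hA (((b⁻¹ : orthogonalGroup p q) : Model p q ≃L[ℝ] Model p q) w)
    have h2 : ∀ v, (u.act b).toEquiv v = u.toEquiv ((b : Model p q ≃L[ℝ] Model p q) v) :=
      fun v => rfl
    rw [h2, h2] at h1
    have h3 : (b : Model p q ≃L[ℝ] Model p q)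
        (((b⁻¹ : orthogonalGroup p q) : Model p q ≃L[ℝ] Model p q) w) = w :=
      (b : Model p q ≃L[ℝ] Model p q).apply_symm_apply w
    rw [h3] at h1
    exact h1

end Frames

/-! ### The rank is constant on curved orbits -/

section Rank

variable {n p q : ℕ} {M : Type*} [TopologicalSpace M]
  [ChartedSpace (EuclideanSpace ℝ (Fin n)) M] [IsManifold (𝓡 n) ∞ M]
  {g : SemiRiemannianMetric n p q M} {ℓ : Model p q} {x y : M}
  {V : Type*} [NormedAddCommGroup V] [NormedSpace ℝ V]
  {ρ : Representation ℝ (orthogonalGroup p q) V} {ψ : ParallelSection g ρ}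

theorem conj_exp_smul {T T' : Type*} [NormedAddCommGroup T] [NormedSpace ℝ T] [CompleteSpace T]
    [NormedAddCommGroup T'] [NormedSpace ℝ T'] (B : T ≃L[ℝ] T') (A : T →L[ℝ] T) (t : ℝ) :
    B.conjContinuousAlgEquiv (NormedSpace.exp (t • A)) =
      NormedSpace.exp (t • B.conjContinuousAlgEquiv A) := by
  rw [NormedSpace.map_exp_of_mem_ball (𝕂 := ℝ) B.conjContinuousAlgEquiv
    B.conjContinuousAlgEquiv.continuous _
    ((NormedSpace.expSeries_radius_eq_top ℝ (T →L[ℝ] T)).symm ▸ edist_lt_top _ _), map_smul]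

/-- Frames with the same value of the section identify the stabilisers of `ψ_x` and `ψ_y`, which by
hypothesis are the holonomy groups. Conjugation commutes with the exponential, so it respects their
Lie algebras. -/
theorem holAlgebra_conj {u : Frame g x} {u' : Frame g y} (h : ψ.toFun x u = ψ.toFun y u')
    (hHol : ∀ x : M, Hol g x = ψ.stabiliser x) {A : Tractor n x →L[ℝ] Tractor n x}
    (hA : A ∈ holAlgebra g x) :
    (u.toEquiv.symm.trans u'.toEquiv).conjContinuousAlgEquiv A ∈ holAlgebra g y := by
  set B : Tractor n x ≃L[ℝ] Tractor n y := u.toEquiv.symm.trans u'.toEquiv with hB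
  let L : (Tractor n x →L[ℝ] Tractor n x) →ₗ[ℝ] (Tractor n y →L[ℝ] Tractor n y) :=
    B.conjContinuousAlgEquiv.toAlgEquiv.toLinearMap
  suffices holAlgebra g x ≤ (holAlgebra g y).comap L from this hA
  refine Submodule.span_le.2 fun A hA => Submodule.subset_span fun t => ?_
  obtain ⟨C, hC, hCA⟩ := hA t
  rw [hHol, ψ.mem_stabiliser_iff u] at hC
  obtain ⟨a, ha, hCa⟩ := hC
  refine ⟨B.symm.trans (C.trans B), ?_, ?_⟩
  · rw [hHol, ψ.mem_stabiliser_iff u']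
    refine ⟨a, by rw [← h, ha], fun w => ?_⟩
    simp [hB, hCa]
  · have h1 := conj_exp_smul B A t
    rw [← hCA] at h1
    exact h1

theorem Frame.IsAdapted.exists_map_sMinus {u : Frame g x} {u' : Frame g y} (hu : u.IsAdapted ℓ)
    (hu' : u'.IsAdapted ℓ) (hℓ : ℓ ≠ 0) :
    ∃ r : ℝ, r ≠ 0 ∧ u'.toEquiv (u.toEquiv.symm (sMinus n x)) = r • sMinus n y := by
  obtain ⟨r, hr, hur⟩ := hu.exists_eq_smul hℓ
  obtain ⟨s, hs, hus⟩ := hu'.exists_eq_smul hℓ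
  refine ⟨r⁻¹ * s, mul_ne_zero (inv_ne_zero hr) hs, ?_⟩
  have h1 : u.toEquiv.symm (sMinus n x) = r⁻¹ • ℓ := by
    rw [ContinuousLinearEquiv.symm_apply_eq, map_smul, hur, smul_smul, inv_mul_cancel₀ hr, one_smul]
  rw [h1, map_smul, hus, smul_smul]

/-- The map `u' ∘ u⁻¹` is an isometry and, both frames being adapted, carries the canonical line to
the canonical line; `𝔤₁` is defined by these data alone. -/
theorem gOne_conj {u : Frame g x} {u' : Frame g y} (hu : u.IsAdapted ℓ) (hu' : u'.IsAdapted ℓ)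
    (hℓ : ℓ ≠ 0) {A : Tractor n x →L[ℝ] Tractor n x} (hA : A ∈ gOne g x) :
    (u.toEquiv.symm.trans u'.toEquiv).conjContinuousAlgEquiv A ∈ gOne g y := by
  set B : Tractor n x ≃L[ℝ] Tractor n y := u.toEquiv.symm.trans u'.toEquiv with hB
  have hiso : ∀ S T, tractorMetric g y S (B T) = tractorMetric g x (B.symm S) T := fun S T => by
    simp only [hB, ContinuousLinearEquiv.trans_apply, ContinuousLinearEquiv.symm_trans_apply,
      ContinuousLinearEquiv.symm_symm]
    rw [← u'.modelForm_symm, u'.toEquiv.symm_apply_apply, ← u.modelForm_symm,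
      u.toEquiv.symm_apply_apply]
  have hiso' : ∀ S T, tractorMetric g y (B S) T = tractorMetric g x S (B.symm T) := fun S T => by
    rw [← B.apply_symm_apply T, hiso, B.symm_apply_apply, B.symm_apply_apply]
  obtain ⟨r, hr, hBr⟩ := hu'.exists_map_sMinus hu hℓ
  have hBs : B.symm (sMinus n y) = r • sMinus n x := hBr
  obtain ⟨hA1, hA2, hA3⟩ := hA
  refine ⟨fun v w => ?_, ?_, fun v hv => ?_⟩
  · simp only [ContinuousLinearEquiv.conjContinuousAlgEquiv_apply_apply]
    rw [hiso, hiso', hA1]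
  · simp [hBs, hA2]
  · rw [ContinuousLinearEquiv.conjContinuousAlgEquiv_apply_apply]
    have h1 : tractorMetric g x (B.symm v) (sMinus n x) = 0 := by
      have h2 := hiso' (B.symm v) (sMinus n y)
      rw [B.apply_symm_apply, hv, hBs, tractorMetric_smul_right] at h2
      exact (mul_eq_zero.1 h2.symm).resolve_left hr
    obtain ⟨s, hs⟩ := Submodule.mem_span_singleton.1 (hA3 _ h1)
    obtain ⟨r', -, hr'⟩ := hu.exists_map_sMinus hu' hℓ
    have h3 : B (sMinus n x) = r' • sMinus n y := hr'
    rw [← hs, map_smul, h3]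
    exact Submodule.smul_mem _ _ (Submodule.smul_mem _ _ (Submodule.mem_span_singleton_self _))

theorem rankE_le_of_toFun_eq {u : Frame g x} {u' : Frame g y} (hu : u.IsAdapted ℓ)
    (hu' : u'.IsAdapted ℓ) (hℓ : ℓ ≠ 0) (h : ψ.toFun x u = ψ.toFun y u')
    (hHol : ∀ x : M, Hol g x = ψ.stabiliser x) : rankE g x ≤ rankE g y := by
  let L : (Tractor n x →L[ℝ] Tractor n x) ≃ₗ[ℝ] (Tractor n y →L[ℝ] Tractor n y) :=
    (u.toEquiv.symm.trans u'.toEquiv).conjContinuousAlgEquiv.toAlgEquiv.toLinearEquiv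
  rw [rankE, rankE, ← LinearEquiv.finrank_map_eq L]
  refine Submodule.finrank_mono ?_
  rintro _ ⟨A, hA, rfl⟩
  exact ⟨holAlgebra_conj h hHol hA.1, gOne_conj hu hu' hℓ hA.2⟩

theorem ParallelSection.rankE_eq_of_pType_eq (ψ : ParallelSection g ρ) (hℓ : ℓ ≠ 0)
    (hℓℓ : modelForm p q ℓ ℓ = 0) (hHol : ∀ x : M, Hol g x = ψ.stabiliser x)
    (h : ψ.pType ℓ x = ψ.pType ℓ y) : rankE g x = rankE g y := by
  obtain ⟨u, hu⟩ := exists_isAdapted g x hℓ hℓℓ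
  obtain ⟨u', hu', huu'⟩ : ψ.toFun x u ∈ ψ.pType ℓ y := h ▸ ⟨u, hu, rfl⟩
  exact (rankE_le_of_toFun_eq hu hu' hℓ huu'.symm hHol).antisymm
    (rankE_le_of_toFun_eq hu' hu hℓ huu' hHol)

end Rank

/-! ### The smooth extension of the representation is multiplicative on the group -/

section RepresentationExtension

variable {p q : ℕ} {V : Type*} [NormedAddCommGroup V] [NormedSpace ℝ V]
  {ρ : Representation ℝ (orthogonalGroup p q) V} {F : (Model p q →L[ℝ] Model p q) → V →L[ℝ] V}
  (hF : ∀ (a : orthogonalGroup p q) (v : V),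
    F ((a : Model p q ≃L[ℝ] Model p q) : Model p q →L[ℝ] Model p q) v = ρ a v)

include hF in
theorem representation_extension_one : F 1 = 1 := by
  ext1 v
  have h := hF 1 v
  rw [map_one] at h
  exact h

include hF in
theorem representation_extension_mul :
    ∀ a ∈ stab (0 : Model p q), ∀ b ∈ stab (0 : Model p q), F (a * b) = F a * F b := by
  intro a ha b hb
  obtain ⟨a, rfl⟩ := exists_orthogonalGroup ha
  obtain ⟨b, rfl⟩ := exists_orthogonalGroup hb
  ext1 v
  have h := hF (a * b) v
  rw [map_mul] at h
  exact h.trans ((congrArg (ρ a) (hF b v)).symm.trans (hF a _).symm)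

end RepresentationExtension

/-! ### Curved orbits are initial submanifolds -/

section CurvedOrbits

variable {n p q : ℕ} {M : Type*} [TopologicalSpace M]
  [ChartedSpace (EuclideanSpace ℝ (Fin n)) M] [IsManifold (𝓡 n) ∞ M]
  {g : SemiRiemannianMetric n p q M} {ℓ : Model p q} {x₀ : M}
  {V : Type*} [NormedAddCommGroup V] [NormedSpace ℝ V]
  {ρ : Representation ℝ (orthogonalGroup p q) V}
  {F : (Model p q →L[ℝ] Model p q) → V →L[ℝ] V}

theorem Frame.ext_apply {x : M} {u u' : Frame g x} (h : ∀ v, u.toEquiv v = u'.toEquiv v) :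
    u = u' := by
  obtain ⟨e, he⟩ := u
  obtain ⟨e', he'⟩ := u'
  obtain rfl : e = e' := by
    ext v : 2
    exact h v
  rfl

/-- This collects what the local analysis of the orbits needs. The last two clauses say that `df` is
tangent to the `G`-orbit and, at the centre, fills its tangent space modulo that of the `P`-orbit.
-/
theorem exists_localSection (ψ : ParallelSection g ρ)
    (hF : ∀ (a : orthogonalGroup p q) (v : V),
      F ((a : Model p q ≃L[ℝ] Model p q) : Model p q →L[ℝ] Model p q) v = ρ a v)
    (hFd : ContDiff ℝ ∞ F) (hℓ : ℓ ≠ 0) {c₀ : EuclideanSpace ℝ (Fin n)}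
    (hc₀ : c₀ ∈ (extChartAt (𝓡 n) x₀).target) {u₀ : Frame g (chartPoint x₀ c₀)}
    (hu₀ : u₀.IsAdapted ℓ) :
    ∃ (r : ℝ) (f : EuclideanSpace ℝ (Fin n) → V), 0 < r ∧
      Metric.ball c₀ r ⊆ (extChartAt (𝓡 n) x₀).target ∧ ContDiffOn ℝ ∞ f (Metric.ball c₀ r) ∧
      f c₀ = ψ.toFun _ u₀ ∧
      (∀ c ∈ Metric.ball c₀ r, ψ.pType ℓ (chartPoint x₀ c) = {w | ∃ a ∈ stab ℓ, F a (f c) = w}) ∧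
      (∀ c ∈ Metric.ball c₀ r, ∃ a ∈ stab 0, f c = F a (f c₀)) ∧
      (∀ c ∈ Metric.ball c₀ r, ∀ h, fderiv ℝ f c h ∈ orbitTangent F 0 (f c)) ∧
      ∀ d ∈ orbitTangent F 0 (f c₀), ∃ h, d - fderiv ℝ f c₀ h ∈ orbitTangent F ℓ (f c₀) := by
  have hsrc : chartPoint x₀ c₀ ∈ (extChartAt (𝓡 n) x₀).source :=
    (extChartAt (𝓡 n) x₀).map_target hc₀
  let e : Model p q ≃L[ℝ] CoordTractor n := u₀.toEquiv.trans
    (ContinuousLinearEquiv.equivOfInverse (toCoord x₀ (chartPoint x₀ c₀))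
      (ofCoord x₀ (chartPoint x₀ c₀)) (ofCoord_toCoord hsrc) (toCoord_ofCoord hsrc))
  have he : ∀ v, ofCoord x₀ (chartPoint x₀ c₀) (e v) = u₀.toEquiv v := fun v =>
    ofCoord_toCoord hsrc _
  obtain ⟨U, u, ui, hU, hc₀U, hu, hue⟩ :=
    (isMetricOn_chartComponents g x₀).exists_frameField hc₀ e (fun v w => by
      rw [← tractorMetric_ofCoord, he, he, u₀.isometry])
  have hframe : hu.frame hU hc₀U = u₀ := Frame.ext_apply fun v => by
    rw [hu.frame_apply, hue, he]
  obtain ⟨r, hr, hur⟩ := hu₀.exists_eq_smul hℓ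
  have heℓ : e ℓ = r • ((1, 0, 0) : CoordTractor n) := by
    have h1 : e ℓ = toCoord x₀ (chartPoint x₀ c₀) (u₀.toEquiv ℓ) := rfl
    rw [h1, hur, map_smul, toCoord_sMinus]
  have hw : r • e.symm ((1, 0, 0) : CoordTractor n) = ℓ := by
    rw [← map_smul, ← heℓ, e.symm_apply_apply]
  have huℓ : ∀ c ∈ U, u c ℓ = r • ((1, 0, 0) : CoordTractor n) := fun c hc => by
    rw [← hw, map_smul, ← hu.inv_sMinus c hc, hu.apply_inv c hc]
  have hadapted : ∀ c (hc : c ∈ U), (hu.frame hU hc).IsAdapted ℓ := fun c hc => by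
    rw [Frame.IsAdapted, hu.frame_apply, huℓ c hc, map_smul, ofCoord_sMinus]
    exact Submodule.smul_mem _ _ (Submodule.mem_span_singleton_self _)
  obtain ⟨δ, a, hδ, -, -, ha⟩ := hu.exists_localSection_add hU ψ hF hc₀U
  have hball : ∀ c ∈ Metric.ball c₀ δ, c ∈ U ∧ ∃ b ∈ stab 0,
      hu.localSection hU ψ c = F b (hu.localSection hU ψ c₀) := by
    intro c hc
    obtain ⟨h1, h2, h3⟩ := ha (c - c₀) (by rwa [← dist_eq_norm])
    rw [add_sub_cancel] at h1 h3
    exact ⟨h1, _, h2, h3⟩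
  have hder := fun c hc => hu.hasFDerivAt_localSection hU ψ hF hFd (c := c) hc
  refine ⟨δ, hu.localSection hU ψ, hδ, fun c hc => hU (hball c hc).1,
    (hu.contDiffOn_localSection hU ψ hF hFd).mono fun c hc => (hball c hc).1, ?_, fun c hc => ?_,
    fun c hc => (hball c hc).2, fun c hc h => ?_, fun d hd => ?_⟩
  · rw [hu.localSection_of_mem hU ψ hc₀U, hframe]
  · have hcU := (hball c hc).1
    rw [hu.localSection_of_mem hU ψ hcU]
    exact ψ.pType_eq hF hℓ (hadapted c hcU)
  · have hcU := (hball c hc).1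
    rw [(hder c hcU).fderiv]
    exact mem_orbitTangent.2 ⟨_, hu.frameForm_mem_stabAlg hcU h, rfl⟩
  · obtain ⟨X, hX, rfl⟩ := mem_orbitTangent.1 hd
    obtain ⟨h, hh⟩ := hu.exists_sub_frameForm_mem_stabAlg hc₀U hr (huℓ c₀ hc₀U) hX
    refine ⟨h, mem_orbitTangent.2 ⟨_, hh, ?_⟩⟩
    rw [(hder c₀ hc₀U).fderiv, map_sub]
    rfl

theorem ParallelSection.IsCurvedOrbit.isInitialSubmanifold [FiniteDimensional ℝ V]
    {ψ : ParallelSection g ρ} (hρ : IsSmoothRep ρ) (hℓ : ℓ ≠ 0) (hℓℓ : modelForm p q ℓ ℓ = 0)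
    {N : Set M} (hN : ψ.IsCurvedOrbit ℓ N) : IsInitialSubmanifold n N := by
  obtain ⟨x₁, rfl⟩ := hN
  obtain ⟨F, hFd, hF⟩ := hρ
  have hF1 : F 1 = 1 := representation_extension_one hF
  have hFm := representation_extension_mul hF
  obtain ⟨u₁, hu₁⟩ := exists_isAdapted g x₁ hℓ hℓℓ
  obtain ⟨C, W, y, z, hW, hvW, hy, hz, hyv, hzv, hCz, hzC, hC0, hCT, hCC, hyd, hcount, hmem⟩ :=
    exists_orbit_slice hFd hF1 hFm ℓ (ψ.toFun x₁ u₁)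
  set v : V := ψ.toFun x₁ u₁ with hv
  -- The slice is built once, at the value `v` belonging to `x₁`, so the dimension is the same at
  -- every point of the curved orbit.
  refine ⟨n - Module.finrank ℝ C.range, Nat.sub_le _ _, fun x hx => ?_⟩
  set c₀ : EuclideanSpace ℝ (Fin n) := chartAt (EuclideanSpace ℝ (Fin n)) x x with hc₀
  have hc₀t : c₀ ∈ (extChartAt (𝓡 n) x).target := mem_extChartAt_target x
  have hxc : chartPoint x c₀ = x := extChartAt_to_inv x
  -- Equality of `P`-types provides an adapted frame at `x` at which the section takes exactly the
  -- value `v`.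
  obtain ⟨u₀, hu₀, hu₀v⟩ : v ∈ ψ.pType ℓ (chartPoint x c₀) := by
    rw [hxc, (hx : ψ.pType ℓ x = _)]
    exact ⟨u₁, hu₁, rfl⟩
  obtain ⟨r, f, hr, hball, hf, hf0, hfP, hfo, hft, hfs⟩ :=
    exists_localSection ψ hF hFd hℓ hc₀t hu₀
  rw [hu₀v] at hf0
  have hfW : ContinuousAt f c₀ := hf.continuousOn.continuousAt (Metric.ball_mem_nhds c₀ hr)
  obtain ⟨s, hs, hsW⟩ := Metric.eventually_nhds_iff_ball.1
    (hfW.eventually (hW.mem_nhds (by rwa [hf0])))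
  set D := Metric.ball c₀ (min r s) with hD
  have hDr : D ⊆ Metric.ball c₀ r := Metric.ball_subset_ball (min_le_left _ _)
  have hDW : ∀ c ∈ D, f c ∈ W := fun c hc => hsW c (Metric.ball_subset_ball (min_le_right _ _) hc)
  have hc₀D : c₀ ∈ D := Metric.mem_ball_self (lt_min hr hs)
  have hfd : ∀ c ∈ D, HasFDerivAt f (fderiv ℝ f c) c := fun c hc =>
    ((hf.contDiffAt (Metric.isOpen_ball.mem_nhds (hDr hc))).differentiableAt (by simp)).hasFDerivAt
  -- `df` is tangent to the `G`-orbit of `v`, along which the derivative of `y` vanishes; so `y ∘ f`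
  -- is constant on the ball.
  have hyd0 : ∀ c ∈ D, HasFDerivAt (fun c => y (f c)) (0 : EuclideanSpace ℝ (Fin n) →L[ℝ] V) c := by
    intro c hc
    have h1 : HasFDerivAt y (fderiv ℝ y (f c)) (f c) :=
      ((hy.contDiffAt (hW.mem_nhds (hDW c hc))).differentiableAt (by simp)).hasFDerivAt
    refine (h1.comp c (hfd c hc)).congr_fderiv ?_
    ext1 h
    obtain ⟨a, ha, hac⟩ := hfo c (hDr hc)
    have h2 := hft c (hDr hc) h
    have h3 := hDW c hc
    rw [hf0] at hac
    rw [ContinuousLinearMap.comp_apply]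
    rw [hac] at h2 h3 ⊢
    exact hyd a ha h3 _ h2
  have hy0 : ∀ c ∈ D, y (f c) = 0 := by
    intro c hc
    have h1 := (convex_ball c₀ (min r s)).is_const_of_fderivWithin_eq_zero (𝕜 := ℝ)
      (f := fun c => y (f c)) (fun c hc => (hyd0 c hc).differentiableAt.differentiableWithinAt)
      (fun c hc => by
        rw [fderivWithin_of_isOpen Metric.isOpen_ball hc]; exact (hyd0 c hc).fderiv) hc hc₀D
    have h2 : y (f c) = y (f c₀) := h1
    rw [h2, hf0, hyv]
  have hZ : HasFDerivAt (fun c => z (f c)) (C.comp (fderiv ℝ f c₀)) c₀ := by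
    refine HasFDerivAt.comp c₀ ?_ (hfd c₀ hc₀D)
    rwa [hf0]
  -- `C ξ` is tangent to the `G`-orbit, hence `df h` modulo the tangent space of the `P`-orbit,
  -- which `C` annihilates. So composing `C` with `df` loses no rank.
  have hrange : (C.comp (fderiv ℝ f c₀)).range = C.range := by
    refine le_antisymm ?_ ?_
    · rintro _ ⟨h, rfl⟩
      exact ⟨fderiv ℝ f c₀ h, rfl⟩
    · rintro _ ⟨ξ, rfl⟩
      rw [hf0] at hfs
      obtain ⟨h, hh⟩ := hfs (C ξ) (hCT ξ)
      refine ⟨h, ?_⟩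
      have h1 := hC0 _ hh
      rw [map_sub, hCC, sub_eq_zero] at h1
      exact h1.symm
  have hcurved : ∀ c ∈ D, chartPoint x c ∈ {y | ψ.pType ℓ y = ψ.pType ℓ x₁} ↔
      ∃ a ∈ stab ℓ, F a v = f c := by
    intro c hc
    have h1 : ψ.pType ℓ x₁ = {w | ∃ a ∈ stab ℓ, F a v = w} := ψ.pType_eq hF hℓ hu₁
    rw [mem_ofPred_eq, hfP c (hDr hc), h1]
    refine ⟨fun h => ?_, ?_⟩
    · have h2 : f c ∈ {w | ∃ a ∈ stab ℓ, F a (f c) = w} := ⟨1, one_mem_stab ℓ, by rw [hF1]; rfl⟩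
      rwa [h] at h2
    · rintro ⟨a, ha, hac⟩
      obtain ⟨b, hb, -, hba⟩ := exists_inv_stab ha
      have hbv : F b (f c) = v := by
        rw [← hac]
        have h2 := hFm b (stab_subset ℓ hb) a (stab_subset ℓ ha)
        rw [hba, hF1] at h2
        exact (DFunLike.congr_fun h2 v).symm
      ext w
      constructor
      · rintro ⟨d, hd, rfl⟩
        refine ⟨d * a, mul_mem_stab hd ha, ?_⟩
        rw [hFm d (stab_subset ℓ hd) a (stab_subset ℓ ha), ← hac]
        rfl
      · rintro ⟨d, hd, rfl⟩
        refine ⟨d * b, mul_mem_stab hd hb, ?_⟩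
        rw [hFm d (stab_subset ℓ hd) b (stab_subset ℓ hb)]
        exact congrArg (F d) hbv
  have key := exists_slice_chart (N := {y | ψ.pType ℓ y = ψ.pType ℓ x₁}) (x := x)
    (IsManifold.chart_mem_maximalAtlas (I := 𝓡 n) (n := ∞) x) (mem_chart_source _ x)
    (z := fun c => z (f c)) (D := D) Metric.isOpen_ball
    (fun c hc => by simpa [extChartAt_target] using hball (hDr hc)) hc₀D
    (hz.comp (hf.mono hDr) hDW) hZ (by rw [← hc₀, hf0, hzv])
    (fun c hc => by rw [hrange]; exact ⟨_, hCz _ (hDW c hc)⟩)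
    (hcount.mono ?_) (fun c hc h0 => ?_)
  · rwa [hrange] at key
  · rintro _ ⟨c, hc, hcN, rfl⟩
    obtain ⟨a, ha, hac⟩ := (hcurved c hc).1 hcN
    exact ⟨a, ha, by rw [hac]; exact hDW c hc, by rw [hac]⟩
  · exact (hcurved c hc).2 (hmem _ (hDW c hc) (hy0 c hc) h0)

end CurvedOrbits

end ConformalHolonomy

end

theorem mainTheorem5 {n p q : ℕ} (hn : 3 ≤ n)
    {M : Type*} [TopologicalSpace M] [T2Space M] [SecondCountableTopology M]
    [ChartedSpace (EuclideanSpace ℝ (Fin n)) M] [IsManifold (𝓡 n) ∞ M]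
    (c : Set (ConformalHolonomy.SemiRiemannianMetric n p q M))
    (hc : ConformalHolonomy.IsConformalStructure c)
    (g : ConformalHolonomy.SemiRiemannianMetric n p q M) (hg : g ∈ c)
    (ℓ : ConformalHolonomy.Model p q) (hℓ : ℓ ≠ 0)
    (hℓℓ : ConformalHolonomy.modelForm p q ℓ ℓ = 0)
    {V : Type*} [NormedAddCommGroup V] [NormedSpace ℝ V] [FiniteDimensional ℝ V]
    (ρ : Representation ℝ (ConformalHolonomy.orthogonalGroup p q) V)
    (hρ : ConformalHolonomy.IsSmoothRep ρ)
    (ψ : ConformalHolonomy.ParallelSection g ρ)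
    (hHol : ∀ x : M, ConformalHolonomy.Hol g x = ψ.stabiliser x) :
    ∀ k : ℕ, ∃ S : Set (Set M),
      (∀ N ∈ S, ψ.IsCurvedOrbit ℓ N ∧ ConformalHolonomy.IsInitialSubmanifold n N) ∧
      {x : M | ConformalHolonomy.rankE g x = k} = ⋃₀ S := by
  intro k
  -- These are the curved orbits through points of rank `k`; constancy of the rank keeps each of
  -- them inside the level set.
  refine ⟨{N | ∃ x, ConformalHolonomy.rankE g x = k ∧ N = {y | ψ.pType ℓ y = ψ.pType ℓ x}},
    ?_, ?_⟩
  · rintro N ⟨x, -, hN⟩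
    have hN' : ψ.IsCurvedOrbit ℓ N := ⟨x, hN⟩
    exact ⟨hN', hN'.isInitialSubmanifold hρ hℓ hℓℓ⟩
  · ext y
    constructor
    · exact fun hy => ⟨_, ⟨y, hy, rfl⟩, rfl⟩
    · rintro ⟨_, ⟨x, hx, rfl⟩, hy⟩
      exact (ψ.rankE_eq_of_pType_eq hℓ hℓℓ hHol hy).trans hx
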